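/- Let $p\in C^1([0,1];(0,\infty))$, $r\in C^0([0,1];(0,\infty))$, $q\in C^0([0,1])$ and let $a_1,a_2,b_1,b_2\in\mathbb R$ with $|a_1|+|a_2|>0$, $|b_1|+|b_2|>0$. Let $L^2_r(0,1)$ be the space of (classes of) measurable functions on $[0,1]$ with $\|g\|_r^2=\int_0^1 r(x)|g(x)|^2dx<\infty$. Let $A$ be the Sturm–Liouville operator $$(Ag)(x)=-\frac1{r(x)}\frac{d}{dx}\Big(p(x)\frac{dg}{dx}(x)\Big)+\frac{q(x)}{r(x)}g(x)$$ with domain $D$, the set of $g\in H^2(0,1)$ with $b_1g(0)+b_2g'(0)=a_1g(1)+a_2g'(1)=0$. Let $\lambda_1<\lambda_2<\cdots$ be its eigenvalues and $\phi_n\in C^2([0,1])$ the corresponding eigenfunctions with $\|\phi_n\|_r=1$. Assume (H) $\sum_{n\ge N}\lambda_n^{-1}\max_{0\le x\le1}|\phi_n(x)|<\infty$ for some $N$ with $\lambda_N>0$. Below, $(\tau_i)_{i\ge0}$ always denotes a strictly increasing sequence with $\tau_0=0$ and $\tau_i\to+\infty$. $PC^1([0,1])$ is the class of continuous $g:[0,1]\to\mathbb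 R$ that have a finite right derivative at every point of $[0,1)$ and a finite left derivative at every point of $(0,1]$, and that are differentiable with continuous derivative on $(0,1)\setminus S$ for some finite $S\subset(0,1)$. Class $GD$: $f:\mathbb R_+\times[0,1]\to\mathbb R$ is in $GD$, with times $(\tau_i)$, if for every $i\ge1$ there are $f_1,f_2\in C^0((\tau_{i-1},\tau_i)\times[0,1])$, $a\in PC^1([0,1])$, $b\in C^0([0,1])$, $c\in D\cap C^2([0,1])$ such that, for $t\in(\tau_{i-1},\tau_i)$, $f_1(t,\cdot)\in PC^1([0,1])$, $f_2(t,\cdot)\in D\cap C^2([0,1])$ and $f(t,\cdot)=f_1(t,\cdot)+f_2(t,\cdot)$ on $[0,1]$; $\sup_{t\in(\tau_{i-1},\tau_i)}\int_0^1 r\,(|f_1(t,x)|^2+|f_2(t,x)|^2+|(Af_2(t,\cdot))(x)|^2)\,dx<\infty$; $\partial f_1/\partial t$ exists and is continuous on $(\tau_{i-1},\tau_i)\times[0,1]$; and, as $t\to\tau_i^-$, $f_1(t,x)\to a(x)$ and $f_2(t,x)\to c(x)$ for every $x\in[0,1]$, and $\frac{\partial f_1}{\partial t}(t,x)\to b(x)$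 uniformly in $x\in[0,1]$. Class $GB$: a right continuous $d:\mathbb R_+\to\mathbb R$ is in $GB$, with times $(\tau_i)$, if $d\in C^2(\mathbb R_+\setminus\{\tau_i\})$, the left limits of $d,\dot d,\ddot d$ at every $\tau_i$, $i\ge1$, exist and are finite, and $\sup_{(\tau_i,\tau_{i+1})}|\dot d|<\infty$ for every $i\ge0$. **Theorem.** Let $f\in GD$ and $d_0,d_1\in GB$. Then there is a sequence $(\tau_i)$ that serves for $f$, $d_0$ and $d_1$ simultaneously. For every such sequence, with $I=\mathbb R_+\setminus\{\tau_i: i\ge0\}$, and for every $u_0\in L^2_r(0,1)$, there is a unique $u:\mathbb R_+\times[0,1]\to\mathbb R$ such that: $t\mapsto u(t,\cdot)$ is continuous from $\mathbb R_+$ to $L^2_r(0,1)$; $u\in C^1(I\times[0,1])$; $u(t,\cdot)\in C^2([0,1])$ for all $t>0$; for all $i\ge1$ and $x\in[0,1]$, $$\lim_{t\to\tau_i^-}u(t,x)=u(\tau_i,x),\quad \lim_{t\to\tau_i^-}\frac{\partial u}{\partial x}(t,x)=\frac{\partial u}{\partial x}(\tau_i,x),\quad \lim_{t\to\tau_i^-}\frac{\partial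 u}{\partial t}(t,x)=-(Au(\tau_i,\cdot))(x)+\lim_{t\to\tau_i^-}f(t,x),$$ the limit of $f$ on the right existing; $u(0,x)=u_0(x)$ for all $x\in[0,1]$; $$\frac{\partial u}{\partial t}(t,x)-\frac1{r(x)}\frac{\partial}{\partial x}\Big(p(x)\frac{\partial u}{\partial x}(t,x)\Big)+\frac{q(x)}{r(x)}u(t,x)=f(t,x)\quad\text{for all }(t,x)\in I\times(0,1);$$ $$b_1u(t,0)+b_2\frac{\partial u}{\partial x}(t,0)-d_0(t)=a_1u(t,1)+a_2\frac{\partial u}{\partial x}(t,1)-d_1(t)=0\quad\text{for all }t\in I.$$ -/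

import Mathlib

open Set Filter Topology MeasureTheory

noncomputable section

namespace SLParabolic

/-- The data of a regular Sturm-Liouville operator on `[0,1]`: coefficients
`p ∈ C¹([0,1];(0,∞))`, `r ∈ C⁰([0,1];(0,∞))`, `q ∈ C⁰([0,1])` and nontrivial boundary constants.
Only the values of `p`, `q`, `r` on `[0,1]` matter. -/
structure SLData where
  p : ℝ → ℝ
  q : ℝ → ℝ
  r : ℝ → ℝ
  a₁ : ℝ
  a₂ : ℝ
  b₁ : ℝ
  b₂ : ℝ
  p_contDiff : ContDiffOn ℝ 1 p (Icc 0 1)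
  p_pos : ∀ x ∈ Icc (0 : ℝ) 1, 0 < p x
  r_cont : ContinuousOn r (Icc 0 1)
  r_pos : ∀ x ∈ Icc (0 : ℝ) 1, 0 < r x
  q_cont : ContinuousOn q (Icc 0 1)
  a_ne : 0 < |a₁| + |a₂|
  b_ne : 0 < |b₁| + |b₂|

/-- The derivative on `[0,1]` (one-sided at the end points). -/
def dx (g : ℝ → ℝ) (x : ℝ) : ℝ := derivWithin g (Icc 0 1) x

/-- `(A g)(x) = -(1/r(x)) (p g')'(x) + (q(x)/r(x)) g(x)` for `x ∈ [0,1]`. -/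
def SLData.op (A : SLData) (g : ℝ → ℝ) (x : ℝ) : ℝ :=
  -(1 / A.r x) * dx (fun y => A.p y * dx g y) x + A.q x / A.r x * g x

/-- The left boundary functional `b₁ g(0) + b₂ g'(0)`. -/
def SLData.bc0 (A : SLData) (g : ℝ → ℝ) : ℝ := A.b₁ * g 0 + A.b₂ * dx g 0

/-- The right boundary functional `a₁ g(1) + a₂ g'(1)`. -/
def SLData.bc1 (A : SLData) (g : ℝ → ℝ) : ℝ := A.a₁ * g 1 + A.a₂ * dx g 1

/-- Membership in `D ∩ C²([0,1])`, where `D` is the set of `H²(0,1)` functions satisfying the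
homogeneous boundary conditions. -/
def SLData.MemDC2 (A : SLData) (g : ℝ → ℝ) : Prop :=
  ContDiffOn ℝ 2 g (Icc 0 1) ∧ A.bc0 g = 0 ∧ A.bc1 g = 0

/-- The measure `r(x) dx` on `[0,1]`; `L²_r(0,1)` is the `L²` space of this measure. -/
def SLData.wt (A : SLData) : Measure ℝ :=
  (volume.restrict (Icc 0 1)).withDensity (fun x => ENNReal.ofReal (A.r x))

/-- `φ` is an eigenfunction of `A` for the eigenvalue `μ`, with `‖φ‖_r = 1`. -/
def SLData.IsEigenfunction (A : SLData) (μ : ℝ) (φ : ℝ → ℝ) : Prop :=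
  A.MemDC2 φ ∧ (∀ x ∈ Ioo (0 : ℝ) 1, A.op φ x = μ * φ x) ∧
    ∫ x in (0 : ℝ)..1, A.r x * φ x ^ 2 = 1

def SLData.IsEigenvalue (A : SLData) (μ : ℝ) : Prop := ∃ φ, A.IsEigenfunction μ φ

/-- Assumption (H): `∑_{n ≥ N} λ_n⁻¹ max_{[0,1]} |φ_n| < ∞` for some `N` with `λ_N > 0`.
The eigenvalues `λ_1 < λ_2 < ⋯` are simple, so the sum over `n ≥ N` is the sum over all
eigenvalues `μ ≥ Λ := λ_N`; `φ μ` is the normalized eigenfunction (unique up to sign) of `μ`. -/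
def SLData.AssumptionH (A : SLData) : Prop :=
  ∃ φ : ℝ → ℝ → ℝ, (∀ μ, A.IsEigenvalue μ → A.IsEigenfunction μ (φ μ)) ∧
    ∃ Λ : ℝ, A.IsEigenvalue Λ ∧ 0 < Λ ∧
      Summable (fun μ : {μ : ℝ // A.IsEigenvalue μ ∧ Λ ≤ μ} =>
        (μ : ℝ)⁻¹ * sSup ((fun x => |φ μ x|) '' Icc 0 1))

/-- The class `PC¹([0,1])` of continuous, piecewise `C¹` functions. -/
def PC1 (g : ℝ → ℝ) : Prop :=
  ContinuousOn g (Icc 0 1) ∧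
  (∀ x ∈ Ico (0 : ℝ) 1, DifferentiableWithinAt ℝ g (Ici x) x) ∧
  (∀ x ∈ Ioc (0 : ℝ) 1, DifferentiableWithinAt ℝ g (Iic x) x) ∧
  ∃ S : Set ℝ, S.Finite ∧ S ⊆ Ioo 0 1 ∧
    (∀ x ∈ Ioo (0 : ℝ) 1 \ S, DifferentiableAt ℝ g x) ∧
    ContinuousOn (deriv g) (Ioo 0 1 \ S)

/-- Increasing sequences of times `0 = τ_0 < τ_1 < ⋯` tending to `+∞`. -/
def IsTimes (τ : ℕ → ℝ) : Prop := StrictMono τ ∧ τ 0 = 0 ∧ Tendsto τ atTop atTop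

/-- The set `I = ℝ₊ \ {τ_i : i = 0, 1, 2, …}`. -/
def offTimes (τ : ℕ → ℝ) : Set ℝ := Ici 0 \ range τ

/-- The requirements of the class `GD` on the time interval `(s, T)`. The left limit of
`∂f₁/∂t` at `T` is uniform in `x ∈ [0,1]`. -/
def SLData.GDOn (A : SLData) (s T : ℝ) (f : ℝ → ℝ → ℝ) : Prop :=
  ∃ (f₁ f₂ : ℝ → ℝ → ℝ) (a b c : ℝ → ℝ),
    ContinuousOn (fun z : ℝ × ℝ => f₁ z.1 z.2) (Ioo s T ×ˢ Icc 0 1) ∧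
    ContinuousOn (fun z : ℝ × ℝ => f₂ z.1 z.2) (Ioo s T ×ˢ Icc 0 1) ∧
    PC1 a ∧ ContinuousOn b (Icc 0 1) ∧ A.MemDC2 c ∧
    (∀ t ∈ Ioo s T, PC1 (f₁ t) ∧ A.MemDC2 (f₂ t)) ∧
    (∀ t ∈ Ioo s T, ∀ x ∈ Icc (0 : ℝ) 1, f t x = f₁ t x + f₂ t x) ∧
    (∃ M : ℝ, ∀ t ∈ Ioo s T,
      ∫ x in (0 : ℝ)..1, A.r x * (|f₁ t x| ^ 2 + |f₂ t x| ^ 2 + |A.op (f₂ t) x| ^ 2) ≤ M) ∧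
    (∀ t ∈ Ioo s T, ∀ x ∈ Icc (0 : ℝ) 1, DifferentiableAt ℝ (fun s' => f₁ s' x) t) ∧
    ContinuousOn (fun z : ℝ × ℝ => deriv (fun s' => f₁ s' z.2) z.1) (Ioo s T ×ˢ Icc 0 1) ∧
    (∀ x ∈ Icc (0 : ℝ) 1, Tendsto (fun t => f₁ t x) (𝓝[<] T) (𝓝 (a x))) ∧
    TendstoUniformlyOn (fun t x => deriv (fun s' => f₁ s' x) t) b (𝓝[<] T) (Icc 0 1) ∧
    (∀ x ∈ Icc (0 : ℝ) 1, Tendsto (fun t => f₂ t x) (𝓝[<] T) (𝓝 (c x)))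

/-- `f` satisfies the requirements of the class `GD` with the sequence of times `τ`. -/
def SLData.GDAlong (A : SLData) (τ : ℕ → ℝ) (f : ℝ → ℝ → ℝ) : Prop :=
  ∀ i, A.GDOn (τ i) (τ (i + 1)) f

/-- The class `GD`. -/
def SLData.GD (A : SLData) (f : ℝ → ℝ → ℝ) : Prop := ∃ τ, IsTimes τ ∧ A.GDAlong τ f

/-- `d` satisfies the requirements of the class `GB` with the sequence of times `τ`. -/
def GBAlong (τ : ℕ → ℝ) (d : ℝ → ℝ) : Prop :=
  (∀ t, 0 ≤ t → ContinuousWithinAt d (Ici t) t) ∧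
  ContDiffOn ℝ 2 d (offTimes τ) ∧
  (∀ i, 1 ≤ i → (∃ L, Tendsto d (𝓝[<] (τ i)) (𝓝 L)) ∧
    (∃ L, Tendsto (deriv d) (𝓝[<] (τ i)) (𝓝 L)) ∧
    (∃ L, Tendsto (deriv (deriv d)) (𝓝[<] (τ i)) (𝓝 L))) ∧
  (∀ i, ∃ M : ℝ, ∀ t ∈ Ioo (τ i) (τ (i + 1)), |deriv d t| ≤ M)

/-- The class `GB`. -/
def GB (d : ℝ → ℝ) : Prop := ∃ τ, IsTimes τ ∧ GBAlong τ d

/-- `τ` is a sequence of times that serves for `f ∈ GD` and `d₀, d₁ ∈ GB` at the same time. -/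
def SLData.Admissible (A : SLData) (τ : ℕ → ℝ) (f : ℝ → ℝ → ℝ) (d₀ d₁ : ℝ → ℝ) : Prop :=
  IsTimes τ ∧ A.GDAlong τ f ∧ GBAlong τ d₀ ∧ GBAlong τ d₁

/-- `u ∈ C⁰(ℝ₊; L²_r(0,1))`. -/
def SLData.ContL2 (A : SLData) (u : ℝ → ℝ → ℝ) : Prop :=
  (∀ t, 0 ≤ t → MemLp (u t) 2 A.wt) ∧
  ∀ t₀, 0 ≤ t₀ → Tendsto (fun t => eLpNorm (u t - u t₀) 2 A.wt) (𝓝[Ici 0] t₀) (𝓝 0)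

/-- `u` solves the initial-boundary value problem with inputs `f, d₀, d₁`, switching times `τ`
and initial state `u₀`. Only the values of `u` on `[0,∞) × [0,1]` matter. -/
structure SLData.IsSolution (A : SLData) (τ : ℕ → ℝ) (f : ℝ → ℝ → ℝ) (d₀ d₁ : ℝ → ℝ)
    (u₀ : ℝ → ℝ) (u : ℝ → ℝ → ℝ) : Prop where
  contL2 : A.ContL2 u
  contDiff_one : ContDiffOn ℝ 1 (fun z : ℝ × ℝ => u z.1 z.2) (offTimes τ ×ˢ Icc 0 1)
  contDiff_two : ∀ t, 0 < t → ContDiffOn ℝ 2 (u t) (Icc 0 1)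
  left_limit : ∀ i, 1 ≤ i → ∀ x ∈ Icc (0 : ℝ) 1,
    Tendsto (fun t => u t x) (𝓝[<] (τ i)) (𝓝 (u (τ i) x))
  left_limit_dt : ∀ i, 1 ≤ i → ∀ x ∈ Icc (0 : ℝ) 1,
    ∃ L, Tendsto (fun t => f t x) (𝓝[<] (τ i)) (𝓝 L) ∧
      Tendsto (fun t => deriv (fun s => u s x) t) (𝓝[<] (τ i)) (𝓝 (-A.op (u (τ i)) x + L))
  left_limit_dx : ∀ i, 1 ≤ i → ∀ x ∈ Icc (0 : ℝ) 1,
    Tendsto (fun t => dx (u t) x) (𝓝[<] (τ i)) (𝓝 (dx (u (τ i)) x))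
  initial : ∀ x ∈ Icc (0 : ℝ) 1, u 0 x = u₀ x
  pde : ∀ t ∈ offTimes τ, ∀ x ∈ Ioo (0 : ℝ) 1,
    deriv (fun s => u s x) t - 1 / A.r x * dx (fun y => A.p y * dx (u t) y) x
      + A.q x / A.r x * u t x = f t x
  boundary : ∀ t ∈ offTimes τ, A.bc0 (u t) - d₀ t = 0 ∧ A.bc1 (u t) - d₁ t = 0

end SLParabolic

end

noncomputable section

namespace SLParabolic

/-! Fix κ ≤ 0 below the spectrum of A. The solutions of A y = κ y that meet the left and the right
boundary condition give the Green function of A − κ, and the integral operator with this kernel is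
compact, symmetric and injective on L²_r. Hence the normalized eigenfunctions φ_μ form a Hilbert
basis (`Green.basis`). With ω = μ − κ > 1, assumption (H) becomes ∑ ω⁻¹ max |φ_μ| < ∞ over all
eigenvalues (`nonempty_spectral`), so an eigenfunction series converges uniformly as soon as its
coefficients are O(1/ω).

Existence on one interval (s, T] (`Spectral.exists_intervalSol`): subtracting a lift of the boundary
data leaves w_t + A w = F with homogeneous boundary conditions, which decouples into the scalar
equations c' = −μ c + h. Both c and c' must be O(1/ω), uniformly away from s (`exists_mode_bound`).
The class GD is made for this. Write h = h₁ + h₂. The part h₂ comes from f₂, which takes values in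
the domain with A f₂ bounded in L²_r, so h₂ = O(1/ω). The part h₁ comes from f₁ and the boundary
data; it is bounded and has a derivative in time that is bounded away from s. Exponential decay
gives c = O(1/ω). Moreover c − h₁/ω satisfies the same equation with a source O(1/ω), so it is
O(1/ω²), whence c' = O(1/ω).

The series is not differentiated twice in x. Comparing coefficients gives w = (A − κ)⁻¹(F − w_t − κ
w), and the Green operator maps continuous functions to C² functions satisfying the boundary
conditions (`Spectral.exists_solution_homogeneous`). The initial value is attained in L²_r by
Parseval and dominated convergence. Since the data extend continuously to t = T, all estimates hold
up to T; this yields the left limits and a final state from which the next interval starts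
(`isSolution_of_intervalSol`).

Uniqueness (`IsSolution.eqOn`): off the switching times the difference of two solutions lies in the
domain, so its coefficients satisfy c' = −μ c. They are continuous across the switching times and
vanish at 0, hence vanish; completeness of the eigenfunctions concludes.

A sequence of times serving all three data is a common refinement, since both classes are stable
under refinement. -/

/-! ### Linear first-order systems on the unit interval -/

/-- Truncation of a real number to `[-R, R]`. -/
def clamp (R y : ℝ) : ℝ := max (-R) (min R y)

lemma abs_clamp_sub_le (R y z : ℝ) : |clamp R y - clamp R z| ≤ |y - z| := by
  refine (abs_max_sub_max_le_max _ _ _ _).trans (max_le (by simp) ?_)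
  exact (abs_min_sub_min_le_max _ _ _ _).trans (max_le (by simp) le_rfl)

lemma abs_clamp_le {R : ℝ} (hR : 0 ≤ R) (y : ℝ) : |clamp R y| ≤ R := by
  unfold clamp
  rw [abs_le]
  exact ⟨le_max_left _ _, max_le (by linarith) (min_le_left _ _)⟩

lemma clamp_eq_self {R y : ℝ} (h : |y| ≤ R) : clamp R y = y := by
  unfold clamp
  rw [abs_le] at h
  rw [min_eq_right h.2, max_eq_right h.1]

lemma abs_clamp_le_abs {R : ℝ} (hR : 0 ≤ R) (y : ℝ) : |clamp R y| ≤ |y| := by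
  have h := abs_clamp_sub_le R y 0
  have h0 : clamp R 0 = 0 := clamp_eq_self (by simpa using hR)
  simpa [h0] using h

/-- A continuous function on `[0,1]` is bounded there by a positive constant. -/
lemma exists_abs_le_of_continuousOn {g : ℝ → ℝ} {a b : ℝ} (hg : ContinuousOn g (Icc a b)) :
    ∃ C, 0 < C ∧ ∀ x ∈ Icc a b, |g x| ≤ C := by
  obtain ⟨C, hC⟩ := isCompact_Icc.exists_bound_of_continuousOn hg
  exact ⟨max C 1, by positivity, fun x hx => (hC x hx).trans (le_max_left _ _)⟩

/-- Global existence for the linear system `y' = α z`, `z' = β y` on `[0,1]`. -/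
lemma exists_linearSystem {α β : ℝ → ℝ} (hα : ContinuousOn α (Icc 0 1))
    (hβ : ContinuousOn β (Icc 0 1)) (y₀ z₀ : ℝ) :
    ∃ y z : ℝ → ℝ, y 0 = y₀ ∧ z 0 = z₀ ∧ ∀ x ∈ Icc (0 : ℝ) 1,
      HasDerivWithinAt y (α x * z x) (Icc 0 1) x ∧
      HasDerivWithinAt z (β x * y x) (Icc 0 1) x := by
  obtain ⟨K₁, hK₁, hαK⟩ := exists_abs_le_of_continuousOn hα
  obtain ⟨K₂, hK₂, hβK⟩ := exists_abs_le_of_continuousOn hβ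
  set K := max K₁ K₂
  have hK : 0 < K := lt_max_of_lt_left hK₁
  replace hαK : ∀ x ∈ Icc (0 : ℝ) 1, |α x| ≤ K := fun x hx => (hαK x hx).trans (le_max_left _ _)
  replace hβK : ∀ x ∈ Icc (0 : ℝ) 1, |β x| ≤ K := fun x hx => (hβK x hx).trans (le_max_right _ _)
  set x₀ : ℝ × ℝ := (y₀, z₀)
  -- The Gronwall bound on [0,1] for a solution starting at x₀. Truncation at level R makes the
  -- field bounded by K R, so the Picard–Lindelöf time covers all of [0,1]; by Gronwall the solution
  -- never leaves the region where the truncation is inactive.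
  set R := ‖x₀‖ * Real.exp K
  have hR : 0 ≤ R := by positivity
  let v : ℝ → ℝ × ℝ → ℝ × ℝ := fun t w => (α t * clamp R w.2, β t * clamp R w.1)
  have hv : ∀ t ∈ Icc (0 : ℝ) 1, ∀ w w', ‖v t w - v t w'‖ ≤ K * ‖w - w'‖ := by
    intro t ht w w'
    simp only [v, Prod.norm_def, Prod.fst_sub, Prod.snd_sub, ← mul_sub, Real.norm_eq_abs, abs_mul]
    refine max_le ?_ ?_
    · exact mul_le_mul (hαK t ht) ((abs_clamp_sub_le _ _ _).trans (le_max_right _ _))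
        (abs_nonneg _) hK.le
    · exact mul_le_mul (hβK t ht) ((abs_clamp_sub_le _ _ _).trans (le_max_left _ _))
        (abs_nonneg _) hK.le
  have hvR : ∀ t ∈ Icc (0 : ℝ) 1, ∀ w, ‖v t w‖ ≤ K * R := by
    intro t ht w
    simp only [v, Prod.norm_def, Real.norm_eq_abs, abs_mul]
    exact max_le (mul_le_mul (hαK t ht) (abs_clamp_le hR _) (abs_nonneg _) hK.le)
      (mul_le_mul (hβK t ht) (abs_clamp_le hR _) (abs_nonneg _) hK.le)
  have hvK : ∀ t ∈ Icc (0 : ℝ) 1, ∀ w, ‖v t w‖ ≤ K * ‖w‖ := by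
    intro t ht w
    simp only [v, Prod.norm_def, Real.norm_eq_abs, abs_mul]
    exact max_le (mul_le_mul (hαK t ht) ((abs_clamp_le_abs hR _).trans (le_max_right _ _))
        (abs_nonneg _) hK.le)
      (mul_le_mul (hβK t ht) ((abs_clamp_le_abs hR _).trans (le_max_left _ _)) (abs_nonneg _) hK.le)
  have hPL : IsPicardLindelof v (⟨0, by simp⟩ : Icc (0 : ℝ) 1) x₀
      ⟨K * R, by positivity⟩ 0 ⟨K * R, by positivity⟩ ⟨K, hK.le⟩ := by
    refine ⟨fun t ht => ?_, fun w _ => ?_, fun t ht w _ => hvR t ht w, ?_⟩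
    · refine LipschitzOnWith.of_dist_le_mul fun w _ w' _ => ?_
      rw [dist_eq_norm, dist_eq_norm]
      exact hv t ht w w'
    · exact (hα.mul continuousOn_const).prodMk (hβ.mul continuousOn_const)
    · simp
  obtain ⟨φ, hφ0, hφ⟩ := hPL.exists_eq_forall_mem_Icc_hasDerivWithinAt₀
  have hφc : ContinuousOn φ (Icc 0 1) := fun t ht => (hφ t ht).continuousWithinAt
  have hbd : ∀ t ∈ Icc (0 : ℝ) 1, ‖φ t‖ ≤ R := by
    intro t ht
    have := norm_le_gronwallBound_of_norm_deriv_right_le (f := φ) (f' := fun t => v t (φ t))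
      (δ := ‖x₀‖) (K := K) (ε := 0) (a := 0) (b := 1) hφc
      (fun x hx => (hφ x (Ico_subset_Icc_self hx)).mono_of_mem_nhdsWithin
        (Icc_mem_nhdsGE_of_mem hx)) (by rw [show φ 0 = x₀ from hφ0])
      (fun x hx => by simpa using hvK x (Ico_subset_Icc_self hx) (φ x)) t ht
    rw [gronwallBound_ε0] at this
    refine this.trans ?_
    refine mul_le_mul_of_nonneg_left (Real.exp_le_exp.2 ?_) (norm_nonneg _)
    nlinarith [ht.1, ht.2]
  refine ⟨fun t => (φ t).1, fun t => (φ t).2, by simp [show φ 0 = x₀ from hφ0, x₀],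
    by simp [show φ 0 = x₀ from hφ0, x₀], fun t ht => ?_⟩
  have h1 : |(φ t).1| ≤ R := (norm_fst_le (φ t)).trans (hbd t ht)
  have h2 : |(φ t).2| ≤ R := (norm_snd_le (φ t)).trans (hbd t ht)
  have h := hφ t ht
  simp only [v, clamp_eq_self h1, clamp_eq_self h2] at h
  exact ⟨h.fst, h.snd⟩

/-- Global existence for the linear system `y' = α z`, `z' = β y` on `[0,1]`, with Cauchy data
at `1`. -/
lemma exists_linearSystem_right {α β : ℝ → ℝ} (hα : ContinuousOn α (Icc 0 1))
    (hβ : ContinuousOn β (Icc 0 1)) (y₁ z₁ : ℝ) :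
    ∃ y z : ℝ → ℝ, y 1 = y₁ ∧ z 1 = z₁ ∧ ∀ x ∈ Icc (0 : ℝ) 1,
      HasDerivWithinAt y (α x * z x) (Icc 0 1) x ∧
      HasDerivWithinAt z (β x * y x) (Icc 0 1) x := by
  have hmaps : MapsTo (fun x : ℝ => 1 - x) (Icc 0 1) (Icc 0 1) := fun x hx =>
    ⟨by linarith [hx.2], by linarith [hx.1]⟩
  have hcont : ContinuousOn (fun x : ℝ => 1 - x) (Icc 0 1) := by fun_prop
  obtain ⟨y, z, hy, hz, h⟩ := exists_linearSystem (hα.comp hcont hmaps) (hβ.comp hcont hmaps)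
    y₁ (-z₁)
  -- The reflection x ↦ 1 − x reverses the sign of both derivatives; changing the sign of z restores
  -- both equations.
  refine ⟨fun x => y (1 - x), fun x => -z (1 - x), by simpa using hy, by simp [hz], fun x hx => ?_⟩
  have hd : HasDerivWithinAt (fun x : ℝ => 1 - x) (-1) (Icc 0 1) x := by
    simpa using (hasDerivWithinAt_id x (Icc (0 : ℝ) 1)).const_sub 1
  obtain ⟨h1, h2⟩ := h (1 - x) (hmaps hx)
  constructor
  · have := h1.scomp x hd hmaps
    refine this.congr_deriv ?_
    simp
  · have := (h2.scomp x hd hmaps).neg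
    refine this.congr_deriv ?_
    simp

/-- Uniqueness for the linear system `y' = α z`, `z' = β y` on `[0,1]`. -/
lemma linearSystem_eq_zero {α β y z : ℝ → ℝ} (hα : ContinuousOn α (Icc 0 1))
    (hβ : ContinuousOn β (Icc 0 1)) (hy0 : y 0 = 0) (hz0 : z 0 = 0)
    (hy : ∀ x ∈ Icc (0 : ℝ) 1, HasDerivWithinAt y (α x * z x) (Icc 0 1) x)
    (hz : ∀ x ∈ Icc (0 : ℝ) 1, HasDerivWithinAt z (β x * y x) (Icc 0 1) x) :
    ∀ x ∈ Icc (0 : ℝ) 1, y x = 0 ∧ z x = 0 := by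
  obtain ⟨K₁, hK₁, hαK⟩ := exists_abs_le_of_continuousOn hα
  obtain ⟨K₂, hK₂, hβK⟩ := exists_abs_le_of_continuousOn hβ
  intro x hx
  have hd : ∀ x ∈ Icc (0 : ℝ) 1, HasDerivWithinAt (fun t => (y t, z t)) (α x * z x, β x * y x)
    (Icc 0 1) x := fun x hx => (hy x hx).prodMk (hz x hx)
  have := norm_le_gronwallBound_of_norm_deriv_right_le (f := fun t => (y t, z t))
      (f' := fun x => (α x * z x, β x * y x))
      (δ := 0) (K := max K₁ K₂) (ε := 0) (a := 0) (b := 1)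
      (fun t ht => (hd t ht).continuousWithinAt)
      (fun x hx => (hd x (Ico_subset_Icc_self hx)).mono_of_mem_nhdsWithin
        (Icc_mem_nhdsGE_of_mem hx)) (by simp [hy0, hz0])
      (fun x hx => by
        have hx' := Ico_subset_Icc_self hx
        simp only [Prod.norm_def, Real.norm_eq_abs, abs_mul, add_zero]
        exact max_le (mul_le_mul ((hαK x hx').trans (le_max_left _ _)) (le_max_right _ _)
          (abs_nonneg _) (by positivity)) (mul_le_mul ((hβK x hx').trans (le_max_right _ _))
            (le_max_left _ _) (abs_nonneg _) (by positivity))) x hx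
  rw [gronwallBound_ε0_δ0] at this
  have h0 := norm_le_zero_iff.1 this
  exact ⟨congrArg Prod.fst h0, congrArg Prod.snd h0⟩

/-! ### Calculus on [0,1], the Sturm–Liouville operator and its lower bound -/

lemma uniqueDiffOn_unit : UniqueDiffOn ℝ (Icc (0 : ℝ) 1) := uniqueDiffOn_Icc zero_lt_one

lemma dx_eq {g : ℝ → ℝ} {g' x : ℝ} (hx : x ∈ Icc (0 : ℝ) 1)
    (h : HasDerivWithinAt g g' (Icc 0 1) x) : dx g x = g' :=
  h.derivWithin (uniqueDiffOn_unit x hx)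

lemma dx_congr {g h : ℝ → ℝ} (H : EqOn g h (Icc 0 1)) {x : ℝ} (hx : x ∈ Icc (0 : ℝ) 1) :
    dx g x = dx h x :=
  derivWithin_congr H (H hx)

lemma hasDerivWithinAt_dx {g : ℝ → ℝ} (hg : ContDiffOn ℝ 1 g (Icc 0 1)) {x : ℝ}
    (hx : x ∈ Icc (0 : ℝ) 1) : HasDerivWithinAt g (dx g x) (Icc 0 1) x :=
  ((hg.differentiableOn one_ne_zero) x hx).hasDerivWithinAt

lemma continuousOn_dx {g : ℝ → ℝ} (hg : ContDiffOn ℝ 1 g (Icc 0 1)) :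
    ContinuousOn (dx g) (Icc 0 1) :=
  hg.continuousOn_derivWithin uniqueDiffOn_unit le_rfl

lemma contDiffOn_dx {g : ℝ → ℝ} (hg : ContDiffOn ℝ 2 g (Icc 0 1)) :
    ContDiffOn ℝ 1 (dx g) (Icc 0 1) :=
  hg.derivWithin uniqueDiffOn_unit (by norm_num)

lemma contDiffOn_one_of_hasDerivWithinAt {g g' : ℝ → ℝ}
    (h : ∀ x ∈ Icc (0 : ℝ) 1, HasDerivWithinAt g (g' x) (Icc 0 1) x)
    (hg' : ContinuousOn g' (Icc 0 1)) : ContDiffOn ℝ 1 g (Icc 0 1) := by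
  have := (contDiffOn_succ_iff_derivWithin (𝕜 := ℝ) (n := 0) (f := g) uniqueDiffOn_unit).2
    ⟨fun x hx => (h x hx).differentiableWithinAt, by simp, ?_⟩
  · simpa using this
  · rw [contDiffOn_zero]
    exact hg'.congr fun x hx => dx_eq hx (h x hx)

lemma contDiffOn_two_of_hasDerivWithinAt {g g' : ℝ → ℝ}
    (h : ∀ x ∈ Icc (0 : ℝ) 1, HasDerivWithinAt g (g' x) (Icc 0 1) x)
    (hg' : ContDiffOn ℝ 1 g' (Icc 0 1)) : ContDiffOn ℝ 2 g (Icc 0 1) := by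
  have := (contDiffOn_succ_iff_derivWithin (𝕜 := ℝ) (n := 1) (f := g) uniqueDiffOn_unit).2
    ⟨fun x hx => (h x hx).differentiableWithinAt, by simp, ?_⟩
  · exact this.of_le (by norm_num)
  · exact hg'.congr fun x hx => dx_eq hx (h x hx)

/-- The primitive of a function continuous on `[0,1]`. -/
lemma hasDerivWithinAt_integral {g : ℝ → ℝ} (hg : ContinuousOn g (Icc 0 1)) {x : ℝ}
    (hx : x ∈ Icc (0 : ℝ) 1) :
    HasDerivWithinAt (fun x => ∫ y in (0 : ℝ)..x, g y) (g x) (Icc 0 1) x := by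
  have hc : Continuous (IccExtend (zero_le_one' ℝ) ((Icc (0 : ℝ) 1).domRestrict g)) :=
    hg.domRestrict.Icc_extend'
  have h1 := (hc.integral_hasStrictDerivAt 0 x).hasDerivAt.hasDerivWithinAt (s := Icc (0 : ℝ) 1)
  have key : ∀ y ∈ Icc (0 : ℝ) 1, IccExtend (zero_le_one' ℝ) ((Icc (0 : ℝ) 1).domRestrict g) y = g y :=
    fun y hy => IccExtend_of_mem _ _ hy
  rw [key x hx] at h1
  refine h1.congr_of_mem (fun y hy => ?_) hx
  refine intervalIntegral.integral_congr fun w hw => ?_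
  rw [uIcc_of_le hy.1] at hw
  exact (key w ⟨hw.1, hw.2.trans hy.2⟩).symm

lemma intervalIntegrable_of_continuousOn {g : ℝ → ℝ} (hg : ContinuousOn g (Icc 0 1)) {a b : ℝ}
    (ha : a ∈ Icc (0 : ℝ) 1) (hb : b ∈ Icc (0 : ℝ) 1) : IntervalIntegrable g volume a b :=
  (hg.mono (uIcc_subset_Icc ha hb)).intervalIntegrable

lemma hasDerivWithinAt_integral_right {g : ℝ → ℝ} (hg : ContinuousOn g (Icc 0 1)) {x : ℝ}
    (hx : x ∈ Icc (0 : ℝ) 1) :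
    HasDerivWithinAt (fun x => ∫ y in x..(1 : ℝ), g y) (-g x) (Icc 0 1) x := by
  have h := (hasDerivWithinAt_integral hg hx).const_sub (∫ y in (0 : ℝ)..1, g y)
  refine h.congr_of_mem (fun y hy => ?_) hx
  have := intervalIntegral.integral_add_adjacent_intervals
    (intervalIntegrable_of_continuousOn hg (left_mem_Icc.2 zero_le_one) hy)
    (intervalIntegrable_of_continuousOn hg hy (right_mem_Icc.2 zero_le_one))
  linarith

namespace SLData

variable (A : SLData)

lemma p_ne {x : ℝ} (hx : x ∈ Icc (0 : ℝ) 1) : A.p x ≠ 0 := (A.p_pos x hx).ne'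

lemma r_ne {x : ℝ} (hx : x ∈ Icc (0 : ℝ) 1) : A.r x ≠ 0 := (A.r_pos x hx).ne'

lemma continuousOn_inv_p : ContinuousOn (fun x => (A.p x)⁻¹) (Icc 0 1) :=
  A.p_contDiff.continuousOn.inv₀ fun _ hx => A.p_ne hx

/-- The flux `p g'`. -/
def flux (g : ℝ → ℝ) (x : ℝ) : ℝ := A.p x * dx g x

variable {A}

lemma contDiffOn_flux {g : ℝ → ℝ} (hg : ContDiffOn ℝ 2 g (Icc 0 1)) :
    ContDiffOn ℝ 1 (A.flux g) (Icc 0 1) := A.p_contDiff.mul (contDiffOn_dx hg)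

/-- With the flux p g' as second unknown, the equation for A becomes a first-order system with
merely continuous coefficients, so q and r need not be differentiated. -/
lemma hasDerivWithinAt_of_flux {g : ℝ → ℝ} (hg : ContDiffOn ℝ 2 g (Icc 0 1)) {x : ℝ}
    (hx : x ∈ Icc (0 : ℝ) 1) : HasDerivWithinAt g ((A.p x)⁻¹ * A.flux g x) (Icc 0 1) x := by
  have h := hasDerivWithinAt_dx (hg.of_le (by norm_num)) hx
  rwa [flux, inv_mul_cancel_left₀ (A.p_ne hx)]

lemma dx_flux_eq (g : ℝ → ℝ) {x : ℝ} (hx : x ∈ Icc (0 : ℝ) 1) :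
    dx (A.flux g) x = A.q x * g x - A.r x * A.op g x := by
  have := A.r_ne hx
  unfold op flux
  field_simp
  ring

lemma hasDerivWithinAt_flux {g : ℝ → ℝ} (hg : ContDiffOn ℝ 2 g (Icc 0 1)) {x : ℝ}
    (hx : x ∈ Icc (0 : ℝ) 1) :
    HasDerivWithinAt (A.flux g) (A.q x * g x - A.r x * A.op g x) (Icc 0 1) x := by
  rw [← dx_flux_eq g hx]
  exact hasDerivWithinAt_dx (contDiffOn_flux hg) hx

lemma continuousOn_op {g : ℝ → ℝ} (hg : ContDiffOn ℝ 2 g (Icc 0 1)) :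
    ContinuousOn (A.op g) (Icc 0 1) := by
  have h1 : ContinuousOn (dx (A.flux g)) (Icc 0 1) := continuousOn_dx (contDiffOn_flux hg)
  have h2 := hg.continuousOn
  have h3 := A.r_cont.inv₀ fun _ hx => A.r_ne hx
  have : ContinuousOn (fun x => -(A.r x)⁻¹ * dx (A.flux g) x + A.q x * (A.r x)⁻¹ * g x)
    (Icc 0 1) := (h3.neg.mul h1).add ((A.q_cont.mul h3).mul h2)
  refine this.congr fun x _ => ?_
  simp only [op, div_eq_mul_inv, one_mul]
  rfl

/-- `g` with flux `z` solves `(p g')' = k` classically, hence it is `C²`. -/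
lemma classical_of_system {g z k : ℝ → ℝ}
    (hg : ∀ x ∈ Icc (0 : ℝ) 1, HasDerivWithinAt g ((A.p x)⁻¹ * z x) (Icc 0 1) x)
    (hz : ∀ x ∈ Icc (0 : ℝ) 1, HasDerivWithinAt z (k x) (Icc 0 1) x)
    (hk : ContinuousOn k (Icc 0 1)) :
    ContDiffOn ℝ 2 g (Icc 0 1) ∧ (∀ x ∈ Icc (0 : ℝ) 1, dx g x = (A.p x)⁻¹ * z x) ∧
      ∀ x ∈ Icc (0 : ℝ) 1, A.op g x = (A.q x * g x - k x) / A.r x := by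
  have hdx : ∀ x ∈ Icc (0 : ℝ) 1, dx g x = (A.p x)⁻¹ * z x := fun x hx => dx_eq hx (hg x hx)
  refine ⟨?_, hdx, fun x hx => ?_⟩
  · refine contDiffOn_two_of_hasDerivWithinAt hg ?_
    exact (A.p_contDiff.inv fun x hx => A.p_ne hx).mul (contDiffOn_one_of_hasDerivWithinAt hz hk)
  · have h1 : dx (fun y => A.p y * dx g y) x = k x := by
      rw [dx_congr (h := z) (fun y hy => ?_) hx, dx_eq hx (hz x hx)]
      show A.p y * dx g y = z y
      rw [hdx y hy, mul_inv_cancel_left₀ (A.p_ne hy)]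
    unfold op
    rw [h1]
    ring

lemma op_congr {g h : ℝ → ℝ} (H : EqOn g h (Icc 0 1)) {x : ℝ} (hx : x ∈ Icc (0 : ℝ) 1) :
    A.op g x = A.op h x := by
  unfold op
  rw [dx_congr (h := fun y => A.p y * dx h y) (fun y hy => ?_) hx, H hx]
  show A.p y * dx g y = A.p y * dx h y
  rw [dx_congr H hy]

lemma bc0_congr {g h : ℝ → ℝ} (H : EqOn g h (Icc 0 1)) : A.bc0 g = A.bc0 h := by
  unfold bc0
  rw [H (by simp), dx_congr H (by simp)]

lemma bc1_congr {g h : ℝ → ℝ} (H : EqOn g h (Icc 0 1)) : A.bc1 g = A.bc1 h := by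
  unfold bc1
  rw [H (by simp), dx_congr H (by simp)]

lemma dx_combo {g h : ℝ → ℝ} (hg : ContDiffOn ℝ 1 g (Icc 0 1)) (hh : ContDiffOn ℝ 1 h (Icc 0 1))
    (a b : ℝ) {x : ℝ} (hx : x ∈ Icc (0 : ℝ) 1) :
    dx (fun y => a * g y + b * h y) x = a * dx g x + b * dx h x :=
  dx_eq hx (((hasDerivWithinAt_dx hg hx).const_mul a).add ((hasDerivWithinAt_dx hh hx).const_mul b))

lemma op_combo {g h : ℝ → ℝ} (hg : ContDiffOn ℝ 2 g (Icc 0 1)) (hh : ContDiffOn ℝ 2 h (Icc 0 1))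
    (a b : ℝ) {x : ℝ} (hx : x ∈ Icc (0 : ℝ) 1) :
    A.op (fun y => a * g y + b * h y) x = a * A.op g x + b * A.op h x := by
  have h1 : dx (fun y => A.p y * dx (fun y => a * g y + b * h y) y) x
      = a * dx (A.flux g) x + b * dx (A.flux h) x := by
    rw [← dx_combo (contDiffOn_flux hg) (contDiffOn_flux hh) a b hx]
    refine dx_congr (fun y hy => ?_) hx
    simp only [flux]
    rw [dx_combo (hg.of_le (by norm_num)) (hh.of_le (by norm_num)) a b hy]
    ring
  unfold op
  rw [h1]
  unfold flux
  ring

lemma bc0_combo {g h : ℝ → ℝ} (hg : ContDiffOn ℝ 1 g (Icc 0 1)) (hh : ContDiffOn ℝ 1 h (Icc 0 1))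
    (a b : ℝ) : A.bc0 (fun y => a * g y + b * h y) = a * A.bc0 g + b * A.bc0 h := by
  unfold bc0
  rw [dx_combo hg hh a b (by simp)]
  ring

lemma bc1_combo {g h : ℝ → ℝ} (hg : ContDiffOn ℝ 1 g (Icc 0 1)) (hh : ContDiffOn ℝ 1 h (Icc 0 1))
    (a b : ℝ) : A.bc1 (fun y => a * g y + b * h y) = a * A.bc1 g + b * A.bc1 h := by
  unfold bc1
  rw [dx_combo hg hh a b (by simp)]
  ring

lemma MemDC2.combo {g h : ℝ → ℝ} (hg : A.MemDC2 g) (hh : A.MemDC2 h) (a b : ℝ) :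
    A.MemDC2 (fun y => a * g y + b * h y) := by
  refine ⟨(contDiffOn_const.mul hg.1).add (contDiffOn_const.mul hh.1), ?_, ?_⟩
  · rw [bc0_combo (hg.1.of_le (by norm_num)) (hh.1.of_le (by norm_num)), hg.2.1, hh.2.1]; ring
  · rw [bc1_combo (hg.1.of_le (by norm_num)) (hh.1.of_le (by norm_num)), hg.2.2, hh.2.2]; ring

lemma MemDC2.congr {g h : ℝ → ℝ} (hg : A.MemDC2 g) (H : EqOn h g (Icc 0 1)) : A.MemDC2 h :=
  ⟨hg.1.congr H, by rw [bc0_congr H, hg.2.1], by rw [bc1_congr H, hg.2.2]⟩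

lemma eqOn_Icc_of_Ioo {g h : ℝ → ℝ} (hg : ContinuousOn g (Icc 0 1))
    (hh : ContinuousOn h (Icc 0 1)) (H : ∀ x ∈ Ioo (0 : ℝ) 1, g x = h x) :
    ∀ x ∈ Icc (0 : ℝ) 1, g x = h x :=
  EqOn.of_subset_closure (s := Ioo (0 : ℝ) 1) H hg hh Ioo_subset_Icc_self
    (by rw [closure_Ioo zero_ne_one])

lemma IsEigenfunction.op_eq {μ : ℝ} {φ : ℝ → ℝ} (h : A.IsEigenfunction μ φ) :
    ∀ x ∈ Icc (0 : ℝ) 1, A.op φ x = μ * φ x :=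
  eqOn_Icc_of_Ioo (continuousOn_op h.1.1) (continuousOn_const.mul h.1.1.continuousOn) h.2.1

/-- A solution of `A g = μ g` with vanishing Cauchy data at `0` vanishes. -/
lemma eq_zero_of_cauchy {μ : ℝ} {g : ℝ → ℝ} (hg : ContDiffOn ℝ 2 g (Icc 0 1))
    (hop : ∀ x ∈ Icc (0 : ℝ) 1, A.op g x = μ * g x) (h0 : g 0 = 0) (h0' : dx g 0 = 0) :
    ∀ x ∈ Icc (0 : ℝ) 1, g x = 0 := by
  intro x hx
  refine (linearSystem_eq_zero (α := fun x => (A.p x)⁻¹) (β := fun x => A.q x - μ * A.r x)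
    (y := g) (z := A.flux g) A.continuousOn_inv_p (A.q_cont.sub (continuousOn_const.mul A.r_cont))
    h0 (by simp [flux, h0']) (fun x hx => hasDerivWithinAt_of_flux hg hx) (fun x hx => ?_) x hx).1
  refine (hasDerivWithinAt_flux hg hx).congr_deriv ?_
  rw [hop x hx]
  ring

/-- Eigenvalues are simple. -/
lemma eigenspace_simple {μ : ℝ} {g h : ℝ → ℝ} (hg : A.MemDC2 g) (hh : A.MemDC2 h)
    (hgop : ∀ x ∈ Icc (0 : ℝ) 1, A.op g x = μ * g x)
    (hhop : ∀ x ∈ Icc (0 : ℝ) 1, A.op h x = μ * h x)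
    (hne : ∃ x ∈ Icc (0 : ℝ) 1, h x ≠ 0) :
    ∃ a : ℝ, ∀ x ∈ Icc (0 : ℝ) 1, g x = a * h x := by
  have key : ∀ a b : ℝ, a * g 0 + b * h 0 = 0 → a * dx g 0 + b * dx h 0 = 0 →
      ∀ x ∈ Icc (0 : ℝ) 1, a * g x + b * h x = 0 := by
    intro a b h1 h2
    refine eq_zero_of_cauchy (A := A) (μ := μ) (g := fun y => a * g y + b * h y)
      (hg.combo hh a b).1 (fun x hx => ?_) h1 ?_
    · rw [op_combo hg.1 hh.1 a b hx, hgop x hx, hhop x hx]; ring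
    · rw [dx_combo (hg.1.of_le (by norm_num)) (hh.1.of_le (by norm_num)) a b (by simp)]
      exact h2
  have hnz : h 0 ≠ 0 ∨ dx h 0 ≠ 0 := by
    by_contra! hc
    obtain ⟨x, hx, hxne⟩ := hne
    exact hxne (eq_zero_of_cauchy hh.1 hhop hc.1 hc.2 x hx)
  -- Both Cauchy vectors (g(0), g'(0)) and (h(0), h'(0)) are orthogonal to (b₁, b₂) ≠ 0, hence
  -- proportional; Cauchy uniqueness then carries the proportionality to all of [0,1].
  have hdet : g 0 * dx h 0 - dx g 0 * h 0 = 0 := by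
    have e1 := hg.2.1
    have e2 := hh.2.1
    unfold bc0 at e1 e2
    have hb : A.b₁ ≠ 0 ∨ A.b₂ ≠ 0 := by
      by_contra! hc
      simpa [hc.1, hc.2] using A.b_ne
    rcases hb with hb | hb
    · apply mul_left_cancel₀ hb
      linear_combination dx h 0 * e1 - dx g 0 * e2
    · apply mul_left_cancel₀ hb
      linear_combination g 0 * e2 - h 0 * e1
  rcases hnz with hz | hz
  · refine ⟨g 0 / h 0, fun x hx => ?_⟩
    have := key (h 0) (-g 0) (by ring) (by linear_combination -hdet) x hx
    field_simp
    linarith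
  · refine ⟨dx g 0 / dx h 0, fun x hx => ?_⟩
    have := key (dx h 0) (-dx g 0) (by linear_combination hdet) (by ring) x hx
    field_simp
    linarith

variable (A)

/-- Below a certain level there are no nontrivial solutions of `A g = μ g` in the domain. -/
lemma exists_lowerBound : ∃ κ₀ : ℝ, ∀ μ ≤ κ₀, ∀ g, A.MemDC2 g →
    (∀ x ∈ Icc (0 : ℝ) 1, A.op g x = μ * g x) → ∀ x ∈ Icc (0 : ℝ) 1, g x = 0 := by
  -- Chosen so that p g' + s g vanishes at the end points by the boundary conditions. If b₂ = 0,
  -- division by zero gives s₀ = 0, which is harmless because then g(0) = 0; likewise at 1.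
  set s₀ := A.p 0 * (A.b₁ / A.b₂)
  set s₁ := A.p 1 * (A.a₁ / A.a₂)
  let σ : ℝ → ℝ := fun x => s₀ + (s₁ - s₀) * x
  have hσ : ∀ x, HasDerivWithinAt σ (s₁ - s₀) (Icc 0 1) x := fun x => by
    have := ((hasDerivWithinAt_id x (Icc (0 : ℝ) 1)).const_mul (s₁ - s₀)).const_add s₀
    rwa [mul_one] at this
  have hσc : ContinuousOn σ (Icc 0 1) := by fun_prop
  obtain ⟨C, hC, hbd⟩ := exists_abs_le_of_continuousOn (a := 0) (b := 1)
    (g := fun x => (A.q x + (s₁ - s₀) - σ x ^ 2 * (A.p x)⁻¹) * (A.r x)⁻¹)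
    (((A.q_cont.add continuousOn_const).sub ((hσc.pow 2).mul A.continuousOn_inv_p)).mul
      (A.r_cont.inv₀ fun _ hx => A.r_ne hx))
  -- As q + σ' − σ²/p ≥ −C r, the condition μ ≤ −C − 1 makes the coefficient of g² in E' at least r
  -- > 0.
  refine ⟨-C - 1, fun μ hμ g hg hop => ?_⟩
  -- The energy identity in differential form: E vanishes at both ends, and completing the square
  -- shows E' ≥ 0. So E is constantly 0, thus E' = 0, and the g² term of E' forces g = 0.
  let E : ℝ → ℝ := fun x => (A.flux g x + σ x * g x) * g x
  let E' : ℝ → ℝ := fun x => (A.flux g x + σ x * g x) ^ 2 / A.p x +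
    (A.q x + (s₁ - s₀) - σ x ^ 2 * (A.p x)⁻¹ - μ * A.r x) * g x ^ 2
  have hE : ∀ x ∈ Icc (0 : ℝ) 1, HasDerivWithinAt E (E' x) (Icc 0 1) x := by
    intro x hx
    have h1 := hasDerivWithinAt_of_flux (A := A) hg.1 hx
    have h2 := hasDerivWithinAt_flux (A := A) hg.1 hx
    refine ((h2.add ((hσ x).mul h1)).mul h1).congr_deriv ?_
    have := A.p_ne hx
    simp only [E', hop x hx, Pi.add_apply, Pi.mul_apply]
    field_simp
    ring
  have hcoef : ∀ x ∈ Icc (0 : ℝ) 1,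
      0 < A.q x + (s₁ - s₀) - σ x ^ 2 * (A.p x)⁻¹ - μ * A.r x := by
    intro x hx
    have hr := A.r_pos x hx
    have h1 := (abs_le.1 (hbd x hx)).1
    have h2 : -C * A.r x ≤ A.q x + (s₁ - s₀) - σ x ^ 2 * (A.p x)⁻¹ := by
      have := mul_le_mul_of_nonneg_right h1 hr.le
      rwa [inv_mul_cancel_right₀ hr.ne'] at this
    nlinarith
  have hE'nn : ∀ x ∈ Icc (0 : ℝ) 1, 0 ≤ E' x := fun x hx =>
    add_nonneg (div_nonneg (sq_nonneg _) (A.p_pos x hx).le)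
      (mul_nonneg (hcoef x hx).le (sq_nonneg _))
  have hmono : MonotoneOn E (Icc 0 1) := by
    refine monotoneOn_of_deriv_nonneg (convex_Icc 0 1) (fun x hx => (hE x hx).continuousWithinAt)
      ?_ ?_
    · intro x hx
      rw [interior_Icc] at hx
      exact ((hE x (Ioo_subset_Icc_self hx)).hasDerivAt
        (Icc_mem_nhds hx.1 hx.2)).differentiableAt.differentiableWithinAt
    · intro x hx
      rw [interior_Icc] at hx
      rw [((hE x (Ioo_subset_Icc_self hx)).hasDerivAt (Icc_mem_nhds hx.1 hx.2)).deriv]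
      exact hE'nn x (Ioo_subset_Icc_self hx)
  have hE0 : E 0 = 0 := by
    have e := hg.2.1
    unfold bc0 at e
    simp only [E, σ, s₀, flux]
    by_cases hb : A.b₂ = 0
    · have hb1 : A.b₁ ≠ 0 := by
        intro hc
        simpa [hb, hc] using A.b_ne
      have : g 0 = 0 := by simpa [hb, hb1] using e
      simp [this]
    · field_simp
      linear_combination A.p 0 * g 0 * e
  have hE1 : E 1 = 0 := by
    have e := hg.2.2
    unfold bc1 at e
    simp only [E, σ, s₁, flux]
    by_cases hb : A.a₂ = 0
    · have hb1 : A.a₁ ≠ 0 := by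
        intro hc
        simpa [hb, hc] using A.a_ne
      have : g 1 = 0 := by simpa [hb, hb1] using e
      simp [this]
    · field_simp
      linear_combination A.p 1 * g 1 * e
  intro x hx
  have hEz : EqOn E (fun _ => 0) (Icc 0 1) := fun y hy =>
    le_antisymm (hE1 ▸ hmono hy (by simp) hy.2) (hE0 ▸ hmono (by simp) hy hy.1)
  have hE'z : E' x = 0 := by
    rw [← dx_eq hx (hE x hx), dx_congr hEz hx]
    exact dx_eq hx (hasDerivWithinAt_const _ _ _)
  have h1 : 0 ≤ (A.flux g x + σ x * g x) ^ 2 / A.p x :=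
    div_nonneg (sq_nonneg _) (A.p_pos x hx).le
  have h2 := mul_nonneg (hcoef x hx).le (sq_nonneg (g x))
  have h3 : (A.q x + (s₁ - s₀) - σ x ^ 2 * (A.p x)⁻¹ - μ * A.r x) * g x ^ 2 = 0 := by
    simp only [E'] at hE'z
    linarith
  rcases mul_eq_zero.1 h3 with h | h
  · exact absurd h (hcoef x hx).ne'
  · exact pow_eq_zero_iff (two_ne_zero) |>.1 h

end SLData

/-! ### The Green function below the spectrum, and the lifts of the boundary data -/

namespace SLData

/-- Data for the Green function of `A - κ`, where `κ` lies below the spectrum of `A`: solutions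
`y₁`, `y₂` of `A y = κ y`, with fluxes `z₁`, `z₂`, satisfying the left and the right boundary
condition respectively, and their Wronskian `W`. -/
structure Green (A : SLData) where
  κ : ℝ
  y₁ : ℝ → ℝ
  z₁ : ℝ → ℝ
  y₂ : ℝ → ℝ
  z₂ : ℝ → ℝ
  W : ℝ
  κ_nonpos : κ ≤ 0
  eq_zero : ∀ μ ≤ κ + 1, ∀ g, A.MemDC2 g →
    (∀ x ∈ Icc (0 : ℝ) 1, A.op g x = μ * g x) → ∀ x ∈ Icc (0 : ℝ) 1, g x = 0
  hy₁ : ∀ x ∈ Icc (0 : ℝ) 1, HasDerivWithinAt y₁ ((A.p x)⁻¹ * z₁ x) (Icc 0 1) x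
  hz₁ : ∀ x ∈ Icc (0 : ℝ) 1, HasDerivWithinAt z₁ ((A.q x - κ * A.r x) * y₁ x) (Icc 0 1) x
  hy₂ : ∀ x ∈ Icc (0 : ℝ) 1, HasDerivWithinAt y₂ ((A.p x)⁻¹ * z₂ x) (Icc 0 1) x
  hz₂ : ∀ x ∈ Icc (0 : ℝ) 1, HasDerivWithinAt z₂ ((A.q x - κ * A.r x) * y₂ x) (Icc 0 1) x
  W_ne : W ≠ 0
  wronskian : ∀ x ∈ Icc (0 : ℝ) 1, y₁ x * z₂ x - z₁ x * y₂ x = W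
  bc0_y₁ : A.b₁ * y₁ 0 + A.b₂ * ((A.p 0)⁻¹ * z₁ 0) = 0
  bc1_y₂ : A.a₁ * y₂ 1 + A.a₂ * ((A.p 1)⁻¹ * z₂ 1) = 0
  bc0_y₂ : A.b₁ * y₂ 0 + A.b₂ * ((A.p 0)⁻¹ * z₂ 0) ≠ 0
  bc1_y₁ : A.a₁ * y₁ 1 + A.a₂ * ((A.p 1)⁻¹ * z₁ 1) ≠ 0

variable (A : SLData)

/-- The Cauchy data (b₂, −p(0) b₁) at 0 and (a₂, −p(1) a₁) at 1 are those that satisfy the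
respective boundary condition. The Wronskian is, up to a nonzero factor, the right boundary value of
y₁; if this were zero, y₁ would solve A y = κ y in the domain and hence vanish, contradicting its
Cauchy data. -/
lemma nonempty_green : Nonempty A.Green := by
  obtain ⟨κ₀, hκ₀⟩ := A.exists_lowerBound
  -- The margin 1 ensures μ − κ > 1 for every eigenvalue. The sign κ ≤ 0 gives (μ − κ)⁻¹ ≤ μ⁻¹ for
  -- positive μ and the exponential comparison in the mode estimates.
  set κ := min (κ₀ - 1) 0
  have hα := A.continuousOn_inv_p
  have hβ : ContinuousOn (fun x => A.q x - κ * A.r x) (Icc 0 1) :=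
    A.q_cont.sub (continuousOn_const.mul A.r_cont)
  have hp0 : A.p 0 ≠ 0 := A.p_ne (left_mem_Icc.2 zero_le_one)
  have hp1 : A.p 1 ≠ 0 := A.p_ne (right_mem_Icc.2 zero_le_one)
  obtain ⟨y₁, z₁, hy₁0, hz₁0, h₁⟩ := exists_linearSystem hα hβ A.b₂ (-(A.p 0 * A.b₁))
  obtain ⟨y₂, z₂, hy₂1, hz₂1, h₂⟩ := exists_linearSystem_right hα hβ A.a₂ (-(A.p 1 * A.a₁))
  have heq : ∀ μ ≤ κ + 1, ∀ g, A.MemDC2 g →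
    (∀ x ∈ Icc (0 : ℝ) 1, A.op g x = μ * g x) → ∀ x ∈ Icc (0 : ℝ) 1, g x = 0 := fun μ hμ =>
      hκ₀ μ (hμ.trans (by linarith [min_le_left (κ₀ - 1) 0]))
  set W := y₁ 0 * z₂ 0 - z₁ 0 * y₂ 0 with hW
  have hwr : ∀ x ∈ Icc (0 : ℝ) 1, y₁ x * z₂ x - z₁ x * y₂ x = W := by
    have hd : ∀ x ∈ Icc (0 : ℝ) 1,
        HasDerivWithinAt (fun x => y₁ x * z₂ x - z₁ x * y₂ x) 0 (Icc 0 1) x := by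
      intro x hx
      refine (((h₁ x hx).1.mul (h₂ x hx).2).sub ((h₁ x hx).2.mul (h₂ x hx).1)).congr_deriv ?_
      ring
    exact constant_of_derivWithin_zero (fun x hx => (hd x hx).differentiableWithinAt)
      fun x hx => dx_eq (Ico_subset_Icc_self hx) (hd x (Ico_subset_Icc_self hx))
  have hbc1 : A.a₁ * y₁ 1 + A.a₂ * ((A.p 1)⁻¹ * z₁ 1) ≠ 0 := by
    intro h
    have hk : ContinuousOn (fun x => (A.q x - κ * A.r x) * y₁ x) (Icc 0 1) :=
      hβ.mul fun x hx => (h₁ x hx).1.continuousWithinAt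
    obtain ⟨c1, c2, c3⟩ := classical_of_system (A := A) (fun x hx => (h₁ x hx).1)
      (fun x hx => (h₁ x hx).2) hk
    have hmem : A.MemDC2 y₁ := by
      refine ⟨c1, ?_, ?_⟩
      · rw [bc0, c2 0 (by simp), hy₁0, hz₁0]
        field_simp
        ring
      · rw [bc1, c2 1 (by simp)]
        exact h
    have hz := heq κ (by linarith) y₁ hmem (fun x hx => by
      rw [c3 x hx]
      have := A.r_ne hx
      field_simp
      ring)
    have e0 : y₁ 0 = 0 := hz 0 (by simp)
    have e1 : dx y₁ 0 = 0 := by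
      rw [dx_congr (h := fun _ => 0) hz (by simp)]
      exact dx_eq (by simp) (hasDerivWithinAt_const _ _ _)
    rw [c2 0 (by simp), hz₁0] at e1
    have hb1 : A.b₁ = 0 := by
      field_simp at e1
      linarith
    have hb2 : A.b₂ = 0 := by rw [← hy₁0, e0]
    simpa [hb1, hb2] using A.b_ne
  have hW1 : W = -(A.p 1 * (A.a₁ * y₁ 1 + A.a₂ * ((A.p 1)⁻¹ * z₁ 1))) := by
    rw [← hwr 1 (by simp), hy₂1, hz₂1]
    field_simp
    ring
  have hW0 : W = A.p 0 * (A.b₁ * y₂ 0 + A.b₂ * ((A.p 0)⁻¹ * z₂ 0)) := by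
    rw [hW, hy₁0, hz₁0]
    field_simp
    ring
  have hWne : W ≠ 0 := by
    rw [hW1]
    exact neg_ne_zero.2 (mul_ne_zero hp1 hbc1)
  refine ⟨⟨κ, y₁, z₁, y₂, z₂, W, min_le_right _ _, heq, fun x hx => (h₁ x hx).1,
    fun x hx => (h₁ x hx).2, fun x hx => (h₂ x hx).1, fun x hx => (h₂ x hx).2, hWne, hwr,
    ?_, ?_, ?_, hbc1⟩⟩
  · rw [hy₁0, hz₁0]; field_simp; ring
  · rw [hy₂1, hz₂1]; field_simp; ring
  · intro h
    rw [h, mul_zero] at hW0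
    exact hWne hW0

namespace Green

variable {A} (G : A.Green)

lemma continuousOn_y₁ : ContinuousOn G.y₁ (Icc 0 1) := fun x hx => (G.hy₁ x hx).continuousWithinAt

lemma continuousOn_y₂ : ContinuousOn G.y₂ (Icc 0 1) := fun x hx => (G.hy₂ x hx).continuousWithinAt

lemma continuousOn_z₁ : ContinuousOn G.z₁ (Icc 0 1) := fun x hx => (G.hz₁ x hx).continuousWithinAt

lemma continuousOn_z₂ : ContinuousOn G.z₂ (Icc 0 1) := fun x hx => (G.hz₂ x hx).continuousWithinAt

/-- The solution of `A g - κ g = F` with homogeneous boundary conditions, for continuous `F`. -/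
def res (F : ℝ → ℝ) (x : ℝ) : ℝ :=
  -G.W⁻¹ * (G.y₂ x * (∫ y in (0 : ℝ)..x, G.y₁ y * (A.r y * F y)) +
    G.y₁ x * ∫ y in x..(1 : ℝ), G.y₂ y * (A.r y * F y))

/-- The flux of `res F`. -/
def resFlux (F : ℝ → ℝ) (x : ℝ) : ℝ :=
  -G.W⁻¹ * (G.z₂ x * (∫ y in (0 : ℝ)..x, G.y₁ y * (A.r y * F y)) +
    G.z₁ x * ∫ y in x..(1 : ℝ), G.y₂ y * (A.r y * F y))

/-- Variation of parameters: the terms from differentiating the limits of integration cancel here,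
while for the flux they combine to the Wronskian and produce the source −r F. -/
lemma hasDerivWithinAt_res {F : ℝ → ℝ} (hF : ContinuousOn F (Icc 0 1))
    {x : ℝ} (hx : x ∈ Icc (0 : ℝ) 1) :
    HasDerivWithinAt (G.res F) ((A.p x)⁻¹ * G.resFlux F x) (Icc 0 1) x := by
  have h1 := hasDerivWithinAt_integral (G.continuousOn_y₁.mul (A.r_cont.mul hF)) hx
  have h2 := hasDerivWithinAt_integral_right (G.continuousOn_y₂.mul (A.r_cont.mul hF)) hx
  refine ((((G.hy₂ x hx).mul h1).add ((G.hy₁ x hx).mul h2)).const_mul (-G.W⁻¹)).congr_deriv ?_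
  simp only [resFlux, Pi.mul_apply]
  ring

lemma hasDerivWithinAt_resFlux {F : ℝ → ℝ} (hF : ContinuousOn F (Icc 0 1))
    {x : ℝ} (hx : x ∈ Icc (0 : ℝ) 1) :
    HasDerivWithinAt (G.resFlux F) ((A.q x - G.κ * A.r x) * G.res F x - A.r x * F x)
      (Icc 0 1) x := by
  have h1 := hasDerivWithinAt_integral (G.continuousOn_y₁.mul (A.r_cont.mul hF)) hx
  have h2 := hasDerivWithinAt_integral_right (G.continuousOn_y₂.mul (A.r_cont.mul hF)) hx
  refine ((((G.hz₂ x hx).mul h1).add ((G.hz₁ x hx).mul h2)).const_mul (-G.W⁻¹)).congr_deriv ?_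
  simp only [res, Pi.mul_apply]
  have hW := G.W_ne
  field_simp
  linear_combination (-A.r x * F x) * G.wronskian x hx

lemma continuousOn_res {F : ℝ → ℝ} (hF : ContinuousOn F (Icc 0 1)) :
    ContinuousOn (G.res F) (Icc 0 1) := fun _ hx =>
  (G.hasDerivWithinAt_res hF hx).continuousWithinAt

lemma dx_res {F : ℝ → ℝ} (hF : ContinuousOn F (Icc 0 1)) {x : ℝ} (hx : x ∈ Icc (0 : ℝ) 1) :
    dx (G.res F) x = (A.p x)⁻¹ * G.resFlux F x := dx_eq hx (G.hasDerivWithinAt_res hF hx)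

/-- At 0 the first integral is empty, so the Cauchy data of `res F` are a multiple of those of y₁;
at 1 they are a multiple of those of y₂. -/
lemma memDC2_res {F : ℝ → ℝ} (hF : ContinuousOn F (Icc 0 1)) : A.MemDC2 (G.res F) := by
  have hk : ContinuousOn (fun x => (A.q x - G.κ * A.r x) * G.res F x - A.r x * F x) (Icc 0 1) :=
    ((A.q_cont.sub (continuousOn_const.mul A.r_cont)).mul (G.continuousOn_res hF)).sub
      (A.r_cont.mul hF)
  refine ⟨(classical_of_system (A := A) (fun x hx => G.hasDerivWithinAt_res hF hx)
    (fun x hx => G.hasDerivWithinAt_resFlux hF hx) hk).1, ?_, ?_⟩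
  · rw [bc0, G.dx_res hF (by simp), res, resFlux]
    simp only [intervalIntegral.integral_same]
    linear_combination (-G.W⁻¹ * ∫ y in (0 : ℝ)..1, G.y₂ y * (A.r y * F y)) * G.bc0_y₁
  · rw [bc1, G.dx_res hF (by simp), res, resFlux]
    simp only [intervalIntegral.integral_same]
    linear_combination (-G.W⁻¹ * ∫ y in (0 : ℝ)..1, G.y₁ y * (A.r y * F y)) * G.bc1_y₂

lemma op_res {F : ℝ → ℝ} (hF : ContinuousOn F (Icc 0 1))
    {x : ℝ} (hx : x ∈ Icc (0 : ℝ) 1) : A.op (G.res F) x = G.κ * G.res F x + F x := by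
  have hk : ContinuousOn (fun x => (A.q x - G.κ * A.r x) * G.res F x - A.r x * F x) (Icc 0 1) :=
    ((A.q_cont.sub (continuousOn_const.mul A.r_cont)).mul (G.continuousOn_res hF)).sub
      (A.r_cont.mul hF)
  rw [(classical_of_system (A := A) (fun x hx => G.hasDerivWithinAt_res hF hx)
    (fun x hx => G.hasDerivWithinAt_resFlux hF hx) hk).2.2 x hx]
  have := A.r_ne hx
  field_simp
  ring

/-- `res` inverts `A - κ` on the domain. -/
lemma res_op_sub {g : ℝ → ℝ} (hg : A.MemDC2 g) :
    ∀ x ∈ Icc (0 : ℝ) 1, g x = G.res (fun y => A.op g y - G.κ * g y) x := by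
  have hF : ContinuousOn (fun y => A.op g y - G.κ * g y) (Icc 0 1) :=
    (continuousOn_op hg.1).sub (continuousOn_const.mul hg.1.continuousOn)
  intro x hx
  have := G.eq_zero G.κ (by linarith) _ (hg.combo (G.memDC2_res hF) 1 (-1)) (fun x hx => by
    rw [op_combo hg.1 (G.memDC2_res hF).1 1 (-1) hx, G.op_res hF hx]
    ring) x hx
  linarith

/-- The lift of the left boundary datum: `A g₀ = κ g₀`, `bc0 g₀ = 1`, `bc1 g₀ = 0`. -/
lemma exists_lift_left : ∃ g : ℝ → ℝ, ContDiffOn ℝ 2 g (Icc 0 1) ∧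
    (∀ x ∈ Icc (0 : ℝ) 1, A.op g x = G.κ * g x) ∧ A.bc0 g = 1 ∧ A.bc1 g = 0 := by
  set c := A.b₁ * G.y₂ 0 + A.b₂ * ((A.p 0)⁻¹ * G.z₂ 0) with hc
  have hc0 : c ≠ 0 := G.bc0_y₂
  obtain ⟨c1, c2, c3⟩ := classical_of_system (A := A) (g := fun x => c⁻¹ * G.y₂ x)
    (z := fun x => c⁻¹ * G.z₂ x) (k := fun x => (A.q x - G.κ * A.r x) * (c⁻¹ * G.y₂ x))
    (fun x hx => ((G.hy₂ x hx).const_mul c⁻¹).congr_deriv (by ring))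
    (fun x hx => ((G.hz₂ x hx).const_mul c⁻¹).congr_deriv (by ring))
    ((A.q_cont.sub (continuousOn_const.mul A.r_cont)).mul
      (continuousOn_const.mul G.continuousOn_y₂))
  refine ⟨_, c1, fun x hx => ?_, ?_, ?_⟩
  · rw [c3 x hx]
    have := A.r_ne hx
    field_simp
    ring
  · rw [bc0, c2 0 (by simp)]
    linear_combination mul_inv_cancel₀ hc0 - c⁻¹ * hc
  · rw [bc1, c2 1 (by simp)]
    linear_combination c⁻¹ * G.bc1_y₂

/-- The lift of the right boundary datum: `A g₁ = κ g₁`, `bc0 g₁ = 0`, `bc1 g₁ = 1`. -/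
lemma exists_lift_right : ∃ g : ℝ → ℝ, ContDiffOn ℝ 2 g (Icc 0 1) ∧
    (∀ x ∈ Icc (0 : ℝ) 1, A.op g x = G.κ * g x) ∧ A.bc0 g = 0 ∧ A.bc1 g = 1 := by
  set c := A.a₁ * G.y₁ 1 + A.a₂ * ((A.p 1)⁻¹ * G.z₁ 1) with hc
  have hc0 : c ≠ 0 := G.bc1_y₁
  obtain ⟨c1, c2, c3⟩ := classical_of_system (A := A) (g := fun x => c⁻¹ * G.y₁ x)
    (z := fun x => c⁻¹ * G.z₁ x) (k := fun x => (A.q x - G.κ * A.r x) * (c⁻¹ * G.y₁ x))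
    (fun x hx => ((G.hy₁ x hx).const_mul c⁻¹).congr_deriv (by ring))
    (fun x hx => ((G.hz₁ x hx).const_mul c⁻¹).congr_deriv (by ring))
    ((A.q_cont.sub (continuousOn_const.mul A.r_cont)).mul
      (continuousOn_const.mul G.continuousOn_y₁))
  refine ⟨_, c1, fun x hx => ?_, ?_, ?_⟩
  · rw [c3 x hx]
    have := A.r_ne hx
    field_simp
    ring
  · rw [bc0, c2 0 (by simp)]
    linear_combination c⁻¹ * G.bc0_y₁
  · rw [bc1, c2 1 (by simp)]
    linear_combination mul_inv_cancel₀ hc0 - c⁻¹ * hc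

end Green

end SLData

/-! ### The weighted space L²_r and its continuous functions -/

namespace SLData

variable (A : SLData)

lemma aemeasurable_density :
    AEMeasurable (fun x => ENNReal.ofReal (A.r x)) (volume.restrict (Icc (0 : ℝ) 1)) :=
  (A.r_cont.aemeasurable measurableSet_Icc).ennreal_ofReal

lemma wt_absolutelyContinuous : A.wt ≪ volume.restrict (Icc (0 : ℝ) 1) :=
  withDensity_absolutelyContinuous _ _

/-- Positivity of r makes the weighted measure and Lebesgue measure on [0,1] have the same null
sets, so continuous functions that agree almost everywhere for the weight agree on [0,1]. -/
lemma absolutelyContinuous_wt : volume.restrict (Icc (0 : ℝ) 1) ≪ A.wt := by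
  refine withDensity_absolutelyContinuous' A.aemeasurable_density ?_
  filter_upwards [ae_restrict_mem measurableSet_Icc] with x hx
  simpa using A.r_pos x hx

lemma ae_wt_mem_Ioo : ∀ᵐ x ∂A.wt, x ∈ Ioo (0 : ℝ) 1 := by
  refine A.wt_absolutelyContinuous.ae_le ?_
  rw [← restrict_Ioo_eq_restrict_Icc]
  exact ae_restrict_mem measurableSet_Ioo

lemma ae_wt_mem : ∀ᵐ x ∂A.wt, x ∈ Icc (0 : ℝ) 1 :=
  A.ae_wt_mem_Ioo.mono fun _ hx => Ioo_subset_Icc_self hx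

instance : IsFiniteMeasure A.wt := by
  obtain ⟨C, hC, hb⟩ := exists_abs_le_of_continuousOn A.r_cont
  refine isFiniteMeasure_withDensity (ne_of_lt ?_)
  calc ∫⁻ x in Icc (0 : ℝ) 1, ENNReal.ofReal (A.r x)
      ≤ ∫⁻ x in Icc (0 : ℝ) 1, ENNReal.ofReal C :=
        setLIntegral_mono' measurableSet_Icc fun x hx =>
          ENNReal.ofReal_le_ofReal ((le_abs_self _).trans (hb x hx))
    _ < ⊤ := by simp

lemma integral_wt (g : ℝ → ℝ) : ∫ x, g x ∂A.wt = ∫ x in (0 : ℝ)..1, A.r x * g x := by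
  rw [wt, integral_withDensity_eq_integral_toReal_smul₀ A.aemeasurable_density (by simp),
    intervalIntegral.integral_of_le zero_le_one, ← integral_Icc_eq_integral_Ioc]
  refine setIntegral_congr_fun measurableSet_Icc fun x hx => ?_
  simp [(A.r_pos x hx).le]

variable {A}

lemma aestronglyMeasurable_wt {g : ℝ → ℝ} (hg : ContinuousOn g (Icc 0 1)) :
    AEStronglyMeasurable g A.wt :=
  (hg.aestronglyMeasurable measurableSet_Icc).mono_ac A.wt_absolutelyContinuous

lemma memLp_wt {g : ℝ → ℝ} (hg : ContinuousOn g (Icc 0 1)) : MemLp g 2 A.wt := by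
  obtain ⟨C, hC, hb⟩ := exists_abs_le_of_continuousOn hg
  exact MemLp.of_bound (aestronglyMeasurable_wt hg) C (A.ae_wt_mem.mono fun x hx => hb x hx)

lemma integrable_wt {g : ℝ → ℝ} (hg : ContinuousOn g (Icc 0 1)) : Integrable g A.wt :=
  (memLp_wt hg).integrable (by norm_num)

lemma eqOn_of_ae_wt {g h : ℝ → ℝ} (H : g =ᵐ[A.wt] h) (hg : ContinuousOn g (Icc 0 1))
    (hh : ContinuousOn h (Icc 0 1)) : EqOn g h (Icc 0 1) :=
  Measure.eqOn_Icc_of_ae_eq volume zero_ne_one (A.absolutelyContinuous_wt.ae_le H) hg hh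

lemma ae_wt_of_eqOn {g h : ℝ → ℝ} (H : EqOn g h (Icc 0 1)) : g =ᵐ[A.wt] h :=
  A.ae_wt_mem.mono fun _ hx => H hx

variable (A)

/-- The Hilbert space `L²_r(0,1)`. -/
abbrev L2 := Lp ℝ 2 A.wt

/-- The class in `L²_r(0,1)` of a function (`0` if it is not square integrable). -/
def cls (g : ℝ → ℝ) : A.L2 := by
  classical exact if h : MemLp g 2 A.wt then h.toLp g else 0

variable {A}

lemma cls_of_memLp {g : ℝ → ℝ} (hg : MemLp g 2 A.wt) : A.cls g = hg.toLp g := by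
  simp [cls, hg]

lemma coeFn_cls {g : ℝ → ℝ} (hg : MemLp g 2 A.wt) : A.cls g =ᵐ[A.wt] g := by
  rw [cls_of_memLp hg]
  exact hg.coeFn_toLp

lemma cls_congr {g h : ℝ → ℝ} (hg : MemLp g 2 A.wt) (H : g =ᵐ[A.wt] h) : A.cls g = A.cls h := by
  have hh : MemLp h 2 A.wt := hg.ae_eq H
  rw [cls_of_memLp hg, cls_of_memLp hh]
  exact MemLp.toLp_congr _ _ H

lemma eq_ae_of_cls_eq {g h : ℝ → ℝ} (hg : MemLp g 2 A.wt) (hh : MemLp h 2 A.wt)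
    (H : A.cls g = A.cls h) : g =ᵐ[A.wt] h :=
  (coeFn_cls hg).symm.trans (H ▸ coeFn_cls hh)

lemma cls_smul {g : ℝ → ℝ} (hg : MemLp g 2 A.wt) (a : ℝ) :
    A.cls (fun x => a * g x) = a • A.cls g := by
  have h : MemLp (fun x => a * g x) 2 A.wt := hg.const_mul a
  rw [cls_of_memLp hg, cls_of_memLp h]
  rfl

lemma cls_sub {g h : ℝ → ℝ} (hg : MemLp g 2 A.wt) (hh : MemLp h 2 A.wt) :
    A.cls (g - h) = A.cls g - A.cls h := by
  rw [cls_of_memLp hg, cls_of_memLp hh, cls_of_memLp (hg.sub hh)]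
  rfl

lemma inner_cls_left {g : ℝ → ℝ} (hg : MemLp g 2 A.wt) (F : A.L2) :
    inner ℝ (A.cls g) F = ∫ x, g x * F x ∂A.wt := by
  rw [L2.inner_def]
  refine integral_congr_ae ?_
  filter_upwards [coeFn_cls hg] with x hx
  simp [hx, mul_comm]

lemma inner_cls {g h : ℝ → ℝ} (hg : MemLp g 2 A.wt) (hh : MemLp h 2 A.wt) :
    inner ℝ (A.cls g) (A.cls h) = ∫ x, g x * h x ∂A.wt := by
  rw [inner_cls_left hg]
  refine integral_congr_ae ?_
  filter_upwards [coeFn_cls hh] with x hx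
  rw [hx]

lemma norm_cls_sq {g : ℝ → ℝ} (hg : MemLp g 2 A.wt) :
    ‖A.cls g‖ ^ 2 = ∫ x, g x ^ 2 ∂A.wt := by
  rw [← real_inner_self_eq_norm_sq, inner_cls hg hg]
  simp [pow_two]

lemma norm_cls_le {g : ℝ → ℝ} (hg : MemLp g 2 A.wt) {C : ℝ} (hC : 0 ≤ C)
    (hb : ∀ x ∈ Icc (0 : ℝ) 1, |g x| ≤ C) :
    ‖A.cls g‖ ≤ (measureUnivNNReal A.wt : ℝ) ^ ((2 : ℝ)⁻¹) * C := by
  have := Lp.norm_le_of_ae_bound (f := A.cls g) hC (by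
    filter_upwards [coeFn_cls hg, A.ae_wt_mem] with x hx hx'
    rw [hx]
    exact hb x hx')
  simpa using this

variable (A)

/-- The restriction to `[0,1]` of a continuous function, extended by constants. -/
lemma continuousOn_IccExtend (g : C(Icc (0 : ℝ) 1, ℝ)) :
    ContinuousOn (IccExtend (zero_le_one' ℝ) g) (Icc 0 1) :=
  (g.continuous.Icc_extend' (h := zero_le_one' ℝ)).continuousOn

/-- The embedding of `C([0,1])` into `L²_r(0,1)`. -/
def ofCont : C(Icc (0 : ℝ) 1, ℝ) →L[ℝ] A.L2 :=
  LinearMap.mkContinuous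
    { toFun := fun g => A.cls (IccExtend (zero_le_one' ℝ) g)
      map_add' := fun g h => by
        have hg := memLp_wt (A := A) (continuousOn_IccExtend g)
        have hh := memLp_wt (A := A) (continuousOn_IccExtend h)
        rw [cls_of_memLp hg, cls_of_memLp hh, ← MemLp.toLp_add,
          cls_of_memLp (memLp_wt (A := A) (continuousOn_IccExtend (g + h)))]
        rfl
      map_smul' := fun a g => by
        have hg := memLp_wt (A := A) (continuousOn_IccExtend g)
        exact cls_smul hg a }
    ((measureUnivNNReal A.wt : ℝ) ^ ((2 : ℝ)⁻¹))
    (fun g => norm_cls_le (memLp_wt (A := A) (continuousOn_IccExtend g)) (norm_nonneg _)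
      fun x _ => g.norm_coe_le_norm _)

lemma ofCont_apply (g : C(Icc (0 : ℝ) 1, ℝ)) :
    A.ofCont g = A.cls (IccExtend (zero_le_one' ℝ) g) := rfl

lemma ofCont_eq_cls {g : C(Icc (0 : ℝ) 1, ℝ)} {h : ℝ → ℝ} (H : ∀ x, g x = h x) :
    A.ofCont g = A.cls h := by
  rw [ofCont_apply]
  refine cls_congr (memLp_wt (A := A) (continuousOn_IccExtend g)) (ae_wt_of_eqOn fun x hx => ?_)
  rw [IccExtend_of_mem _ _ hx, H]

end SLData

/-! ### The resolvent on L²_r and the Hilbert basis of eigenfunctions -/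

namespace SLData

namespace Green

variable {A : SLData} (G : A.Green)

/-- The projection of the real line onto `[0,1]`. -/
def unitProj (x : ℝ) : ℝ := projIcc 0 1 zero_le_one x

lemma continuous_unitProj : Continuous unitProj := continuous_subtype_val.comp continuous_projIcc

lemma unitProj_mem (x : ℝ) : unitProj x ∈ Icc (0 : ℝ) 1 := (projIcc 0 1 zero_le_one x).2

lemma unitProj_of_mem {x : ℝ} (hx : x ∈ Icc (0 : ℝ) 1) : unitProj x = x := by
  simp [unitProj, projIcc_of_mem zero_le_one hx]

lemma continuous_comp_unitProj {g : ℝ → ℝ} (hg : ContinuousOn g (Icc 0 1)) :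
    Continuous (fun x => g (unitProj x)) :=
  hg.comp_continuous continuous_unitProj unitProj_mem

/-- The Green function of `A - κ`. -/
def ker (x y : ℝ) : ℝ := -G.W⁻¹ * (G.y₁ (unitProj (min x y)) * G.y₂ (unitProj (max x y)))

lemma continuous_ker : Continuous (fun z : ℝ × ℝ => G.ker z.1 z.2) :=
  continuous_const.mul
    (((continuous_comp_unitProj G.continuousOn_y₁).comp (continuous_fst.min continuous_snd)).mul
      ((continuous_comp_unitProj G.continuousOn_y₂).comp (continuous_fst.max continuous_snd)))

lemma ker_comm (x y : ℝ) : G.ker x y = G.ker y x := by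
  unfold ker
  rw [min_comm, max_comm]

lemma exists_ker_bound : ∃ C, 0 < C ∧ ∀ x y, |G.ker x y| ≤ C := by
  obtain ⟨C₁, h₁, hb₁⟩ := exists_abs_le_of_continuousOn G.continuousOn_y₁
  obtain ⟨C₂, h₂, hb₂⟩ := exists_abs_le_of_continuousOn G.continuousOn_y₂
  have hW := G.W_ne
  refine ⟨|G.W⁻¹| * (C₁ * C₂), by positivity, fun x y => ?_⟩
  rw [ker, abs_mul, abs_neg, abs_mul]
  gcongr
  · exact hb₁ _ (unitProj_mem _)
  · exact hb₂ _ (unitProj_mem _)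

/-- The Green function as a continuous family of continuous functions. -/
def kerC : C(Icc (0 : ℝ) 1, C(Icc (0 : ℝ) 1, ℝ)) :=
  ContinuousMap.curry ⟨fun z => G.ker z.1 z.2, G.continuous_ker.comp
    ((continuous_subtype_val.comp continuous_fst).prodMk
      (continuous_subtype_val.comp continuous_snd))⟩

lemma continuous_ker_right (x : ℝ) : Continuous (G.ker x) :=
  G.continuous_ker.comp (continuous_const.prodMk continuous_id)

lemma ofCont_kerC (x : Icc (0 : ℝ) 1) : A.ofCont (G.kerC x) = A.cls (G.ker x) :=
  A.ofCont_eq_cls fun _ => rfl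

/-- The sections of the Green function depend continuously on the parameter in `L²_r`. -/
lemma continuous_section : Continuous (fun x : Icc (0 : ℝ) 1 => A.cls (G.ker x)) := by
  have : Continuous (fun x : Icc (0 : ℝ) 1 => A.ofCont (G.kerC x)) :=
    A.ofCont.continuous.comp G.kerC.continuous
  simpa only [ofCont_kerC] using this

lemma exists_section_bound : ∃ C, 0 < C ∧ ∀ x, ‖A.cls (G.ker x)‖ ≤ C := by
  obtain ⟨C, hC, hb⟩ := G.exists_ker_bound
  refine ⟨(measureUnivNNReal A.wt : ℝ) ^ ((2 : ℝ)⁻¹) * C + 1, by positivity, fun x => ?_⟩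
  have := norm_cls_le (memLp_wt (A := A) (G.continuous_ker_right x).continuousOn) hC.le
    fun y _ => hb x y
  linarith

/-- The integral operator with the Green function as its kernel, into `C([0,1])`. -/
def toCont : A.L2 →L[ℝ] C(Icc (0 : ℝ) 1, ℝ) :=
  LinearMap.mkContinuous
    { toFun := fun F => ⟨fun x => inner ℝ (A.cls (G.ker x)) F,
        G.continuous_section.inner continuous_const⟩
      map_add' := fun F H => by ext x; simp [inner_add_right]
      map_smul' := fun a F => by ext x; simp [inner_smul_right] }
    G.exists_section_bound.choose
    (fun F => by
      obtain ⟨h0, hb⟩ := G.exists_section_bound.choose_spec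
      refine (ContinuousMap.norm_le _ (by positivity)).2 fun x => ?_
      exact (norm_inner_le_norm _ _).trans (mul_le_mul_of_nonneg_right (hb x) (norm_nonneg _)))

lemma toCont_apply (F : A.L2) (x : Icc (0 : ℝ) 1) :
    G.toCont F x = inner ℝ (A.cls (G.ker x)) F := rfl

/-- The resolvent `(A - κ)⁻¹` on `L²_r(0,1)`. -/
def resL : A.L2 →L[ℝ] A.L2 := A.ofCont ∘L G.toCont

/-- Arzelà–Ascoli on the image of the unit ball in C([0,1]): its members x ↦ ⟨k_x, F⟩, with k_x the
section of the Green function at x, are bounded by sup ‖k_x‖, and equicontinuous because |⟨k_x −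
k_{x₀}, F⟩| ≤ ‖k_x − k_{x₀}‖. The embedding of C([0,1]) into L²_r preserves compactness. -/
lemma isCompactOperator_resL : IsCompactOperator G.resL := by
  let L := ContinuousMap.linearIsometryBoundedOfCompact (Icc (0 : ℝ) 1) ℝ ℝ
  let J : A.L2 →L[ℝ] BoundedContinuousFunction (Icc (0 : ℝ) 1) ℝ :=
    (L.toContinuousLinearEquiv : C(Icc (0 : ℝ) 1, ℝ) →L[ℝ] _) ∘L G.toCont
  have hJ : ∀ F x, J F x = inner ℝ (A.cls (G.ker x)) F := fun F x => rfl
  obtain ⟨C, hC, hb⟩ := G.exists_section_bound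
  have hcomp : IsCompactOperator J := by
    refine (isCompactOperator_iff_isCompact_closure_image_closedBall J.toLinearMap
      zero_lt_one).2 ?_
    refine BoundedContinuousFunction.arzela_ascoli (Metric.closedBall 0 C)
      (isCompact_closedBall 0 C) _ ?_ ?_
    · rintro _ x ⟨F, hF, rfl⟩
      rw [mem_closedBall_zero_iff] at hF ⊢
      change ‖J F x‖ ≤ C
      rw [hJ]
      refine (norm_inner_le_norm _ _).trans ?_
      nlinarith [hb x, norm_nonneg F]
    · intro x₀
      rw [Metric.equicontinuousAt_iff]
      intro ε hε
      obtain ⟨δ, hδ, h⟩ := Metric.continuousAt_iff.1 (G.continuous_section.continuousAt (x := x₀))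
        ε hε
      refine ⟨δ, hδ, fun x hx ⟨_, F, hF, hFe⟩ => ?_⟩
      subst hFe
      rw [mem_closedBall_zero_iff] at hF
      change dist (J F x₀) (J F x) < ε
      rw [hJ, hJ, dist_eq_norm, ← inner_sub_left]
      have h' := h hx
      rw [dist_comm, dist_eq_norm] at h'
      refine ((norm_inner_le_norm _ _).trans ?_).trans_lt h'
      exact mul_le_of_le_one_right (norm_nonneg _) hF
  let L' : BoundedContinuousFunction (Icc (0 : ℝ) 1) ℝ →L[ℝ] C(Icc (0 : ℝ) 1, ℝ) :=
    (L.symm.toContinuousLinearEquiv :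
      BoundedContinuousFunction (Icc (0 : ℝ) 1) ℝ →L[ℝ] C(Icc (0 : ℝ) 1, ℝ))
  have : G.resL = (A.ofCont ∘L L') ∘L J := by
    ext1 F
    exact congrArg A.ofCont (L.symm_apply_apply (G.toCont F)).symm
  rw [this]
  exact IsCompactOperator.clm_comp (f := J) hcomp (A.ofCont ∘L L')

lemma resL_coeFn (F : A.L2) : G.resL F =ᵐ[A.wt] fun x => ∫ y, G.ker x y * F y ∂A.wt := by
  have h1 := coeFn_cls (memLp_wt (A := A) (continuousOn_IccExtend (G.toCont F)))
  filter_upwards [h1, A.ae_wt_mem] with x hx hx'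
  change A.ofCont (G.toCont F) x = _
  rw [ofCont_apply, hx, IccExtend_of_mem _ _ hx', toCont_apply,
    inner_cls_left (memLp_wt (G.continuous_ker_right x).continuousOn)]

/-- Fubini for a bounded symmetric kernel. -/
lemma resL_isSymmetric : (G.resL : A.L2 →ₗ[ℝ] A.L2).IsSymmetric := by
  intro F H
  change inner ℝ (G.resL F) H = inner ℝ F (G.resL H)
  rw [L2.inner_def, L2.inner_def]
  have hF : Integrable F A.wt := (Lp.memLp F).integrable (by norm_num)
  have hH : Integrable H A.wt := (Lp.memLp H).integrable (by norm_num)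
  obtain ⟨C, hC, hb⟩ := G.exists_ker_bound
  have hint : Integrable (Function.uncurry fun x y => G.ker x y * (H x * F y))
      (A.wt.prod A.wt) :=
    (hH.mul_prod hF).bdd_mul (c := C) G.continuous_ker.aestronglyMeasurable
      (Eventually.of_forall fun z => hb z.1 z.2)
  calc ∫ x, inner ℝ (G.resL F x) (H x) ∂A.wt
      = ∫ x, ∫ y, G.ker x y * (H x * F y) ∂A.wt ∂A.wt := by
        refine integral_congr_ae ?_
        filter_upwards [G.resL_coeFn F] with x hx
        rw [hx]
        simp only [RCLike.inner_apply, conj_trivial]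
        rw [← integral_const_mul]
        congr 1; ext y; ring
    _ = ∫ y, ∫ x, G.ker x y * (H x * F y) ∂A.wt ∂A.wt := integral_integral_swap hint
    _ = ∫ y, inner ℝ (F y) (G.resL H y) ∂A.wt := by
        refine integral_congr_ae ?_
        filter_upwards [G.resL_coeFn H] with y hy
        rw [hy]
        simp only [RCLike.inner_apply, conj_trivial]
        rw [← integral_mul_const]
        congr 1; ext x; rw [G.ker_comm x y]; ring

/-- On continuous functions the integral operator is `res`. -/
lemma res_eq_integral {F : ℝ → ℝ} (hF : ContinuousOn F (Icc 0 1)) {x : ℝ}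
    (hx : x ∈ Icc (0 : ℝ) 1) : G.res F x = ∫ y, G.ker x y * F y ∂A.wt := by
  rw [integral_wt]
  have hc : ContinuousOn (fun y => A.r y * (G.ker x y * F y)) (Icc 0 1) :=
    A.r_cont.mul ((G.continuous_ker_right x).continuousOn.mul hF)
  rw [← intervalIntegral.integral_add_adjacent_intervals
    (intervalIntegrable_of_continuousOn hc (left_mem_Icc.2 zero_le_one) hx)
    (intervalIntegrable_of_continuousOn hc hx (right_mem_Icc.2 zero_le_one)), res, mul_add,
    ← intervalIntegral.integral_const_mul, ← intervalIntegral.integral_const_mul,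
    ← intervalIntegral.integral_const_mul, ← intervalIntegral.integral_const_mul]
  congr 1
  · refine intervalIntegral.integral_congr fun y hy => ?_
    rw [uIcc_of_le hx.1] at hy
    simp only [ker]
    rw [min_eq_right hy.2, max_eq_left hy.2, unitProj_of_mem hx,
      unitProj_of_mem ⟨hy.1, hy.2.trans hx.2⟩]
    ring
  · refine intervalIntegral.integral_congr fun y hy => ?_
    rw [uIcc_of_le hx.2] at hy
    simp only [ker]
    rw [min_eq_left hy.1, max_eq_right hy.1, unitProj_of_mem hx,
      unitProj_of_mem ⟨hx.1.trans hy.1, hy.2⟩]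
    ring

lemma res_eq_inner {F : ℝ → ℝ} (hF : ContinuousOn F (Icc 0 1)) {x : ℝ}
    (hx : x ∈ Icc (0 : ℝ) 1) : G.res F x = inner ℝ (A.cls (G.ker x)) (A.cls F) := by
  rw [G.res_eq_integral hF hx, inner_cls (memLp_wt (G.continuous_ker_right x).continuousOn)
    (memLp_wt hF)]

lemma resL_cls {F : ℝ → ℝ} (hF : ContinuousOn F (Icc 0 1)) :
    G.resL (A.cls F) = A.cls (G.res F) :=
  A.ofCont_eq_cls fun x => (G.res_eq_inner hF x.2).symm

/-- Functions in the domain satisfy a uniform modulus of continuity. -/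
lemma eq_inner_of_memDC2 {g : ℝ → ℝ} (hg : A.MemDC2 g) {x : ℝ} (hx : x ∈ Icc (0 : ℝ) 1) :
    g x = inner ℝ (A.cls (G.ker x)) (A.cls (fun y => A.op g y - G.κ * g y)) := by
  have hF : ContinuousOn (fun y => A.op g y - G.κ * g y) (Icc 0 1) :=
    (continuousOn_op hg.1).sub (continuousOn_const.mul hg.1.continuousOn)
  rw [← G.res_eq_inner hF hx]
  exact G.res_op_sub hg x hx

/-- A smooth ψ with compact support in (0,1) lies in the domain, so ψ is the image of (A − κ)ψ under
the resolvent; by symmetry ⟨ψ, F⟩ = 0. Test functions detect F almost everywhere. -/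
lemma eq_zero_of_resL_eq_zero {F : A.L2} (hF : G.resL F = 0) : F = 0 := by
  have hloc : LocallyIntegrable F A.wt :=
    ((Lp.memLp F).integrable (by norm_num)).locallyIntegrable
  have key := isOpen_Ioo.ae_eq_zero_of_integral_contDiff_smul_eq_zero
    (hloc.locallyIntegrableOn (Ioo (0 : ℝ) 1)) (μ := A.wt) (fun ψ hψ hc hs => ?_)
  · rw [Lp.eq_zero_iff_ae_eq_zero]
    filter_upwards [key, A.ae_wt_mem_Ioo] with x hx hx'
    exact hx hx'
  · have h2 : ContDiff ℝ 2 ψ := contDiff_infty.1 hψ 2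
    have hz : ∀ x, x ∉ Ioo (0 : ℝ) 1 → ψ x = 0 ∧ HasDerivAt ψ 0 x := by
      intro x hx
      have hx' : x ∉ tsupport ψ := fun h => hx (hs h)
      have he : ψ =ᶠ[𝓝 x] fun _ => 0 := notMem_tsupport_iff_eventuallyEq.1 hx'
      exact ⟨he.self_of_nhds, (hasDerivAt_const x 0).congr_of_eventuallyEq he⟩
    have hmem : A.MemDC2 ψ := by
      refine ⟨h2.contDiffOn, ?_, ?_⟩
      · obtain ⟨e, d⟩ := hz 0 (by simp)
        rw [bc0, e, dx_eq (by simp) d.hasDerivWithinAt]; simp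
      · obtain ⟨e, d⟩ := hz 1 (by simp)
        rw [bc1, e, dx_eq (by simp) d.hasDerivWithinAt]; simp
    have hFc : ContinuousOn (fun y => A.op ψ y - G.κ * ψ y) (Icc 0 1) :=
      (continuousOn_op hmem.1).sub (continuousOn_const.mul hmem.1.continuousOn)
    have hcl : A.cls ψ = G.resL (A.cls (fun y => A.op ψ y - G.κ * ψ y)) := by
      rw [G.resL_cls hFc]
      exact cls_congr (memLp_wt hmem.1.continuousOn) (ae_wt_of_eqOn (G.res_op_sub hmem))
    have h0 : inner ℝ (A.cls ψ) F = 0 := by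
      rw [hcl]
      have := G.resL_isSymmetric (A.cls (fun y => A.op ψ y - G.κ * ψ y)) F
      change inner ℝ (G.resL _) F = inner ℝ _ (G.resL F) at this
      rw [this, hF, inner_zero_right]
    rw [inner_cls_left (memLp_wt hmem.1.continuousOn)] at h0
    simpa using h0

lemma lt_of_isEigenfunction {μ : ℝ} {φ : ℝ → ℝ} (h : A.IsEigenfunction μ φ) : G.κ + 1 < μ := by
  by_contra! hc
  have hz := G.eq_zero μ hc φ h.1 h.op_eq
  have h1 := h.2.2
  rw [intervalIntegral.integral_congr (g := fun _ => (0 : ℝ))] at h1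
  · simp at h1
  · intro x hx
    rw [uIcc_of_le zero_le_one] at hx
    simp [hz x hx]

lemma resL_eigenfunction {μ : ℝ} {φ : ℝ → ℝ} (h : A.IsEigenfunction μ φ) :
    G.resL (A.cls φ) = (μ - G.κ)⁻¹ • A.cls φ := by
  have hlt := G.lt_of_isEigenfunction h
  have hne : μ - G.κ ≠ 0 := by linarith
  have hc := h.1.1.continuousOn
  have hc' : ContinuousOn (fun x => (μ - G.κ) * φ x) (Icc 0 1) := continuousOn_const.mul hc
  have e : A.cls φ = (μ - G.κ) • G.resL (A.cls φ) := by
    rw [← map_smul, ← cls_smul (memLp_wt hc), G.resL_cls hc']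
    refine cls_congr (memLp_wt hc) (ae_wt_of_eqOn fun x hx => ?_)
    rw [G.res_op_sub h.1 x hx]
    unfold res
    have : ∀ y ∈ Icc (0 : ℝ) 1, A.op φ y - G.κ * φ y = (μ - G.κ) * φ y := fun y hy => by
      rw [h.op_eq y hy]; ring
    have e1 : ∫ y in (0 : ℝ)..x, G.y₁ y * (A.r y * (A.op φ y - G.κ * φ y)) =
        ∫ y in (0 : ℝ)..x, G.y₁ y * (A.r y * ((μ - G.κ) * φ y)) := by
      refine intervalIntegral.integral_congr fun y hy => ?_
      rw [uIcc_of_le hx.1] at hy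
      simp only [this y ⟨hy.1, hy.2.trans hx.2⟩]
    have e2 : ∫ y in x..(1 : ℝ), G.y₂ y * (A.r y * (A.op φ y - G.κ * φ y)) =
        ∫ y in x..(1 : ℝ), G.y₂ y * (A.r y * ((μ - G.κ) * φ y)) := by
      refine intervalIntegral.integral_congr fun y hy => ?_
      rw [uIcc_of_le hx.2] at hy
      simp only [this y ⟨hx.1.trans hy.1, hy.2⟩]
    rw [e1, e2]
  rw [eq_inv_smul_iff₀ hne]
  exact e.symm

lemma norm_cls_eigenfunction {μ : ℝ} {φ : ℝ → ℝ} (h : A.IsEigenfunction μ φ) :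
    ‖A.cls φ‖ = 1 := by
  have := norm_cls_sq (memLp_wt (A := A) h.1.1.continuousOn)
  rw [integral_wt, h.2.2] at this
  nlinarith [norm_nonneg (A.cls φ)]

/-- An eigenvector of the resolvent is a multiple of an eigenfunction of `A`. -/
lemma exists_eigenfunction_of_resL {F : A.L2} {θ : ℝ} (hθ : θ ≠ 0) (hF : G.resL F = θ • F)
    (hF0 : F ≠ 0) : ∃ μ φ, A.IsEigenfunction μ φ ∧ ∃ a : ℝ, F = a • A.cls φ := by
  -- The continuous representative of F. The eigenvector relation then holds pointwise, so g is a
  -- multiple of `res g` and inherits its regularity and boundary conditions.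
  set g : ℝ → ℝ := fun x => θ⁻¹ * IccExtend (zero_le_one' ℝ) (G.toCont F) x with hg
  have hgc : ContinuousOn g (Icc 0 1) := continuousOn_const.mul (continuousOn_IccExtend _)
  have hFg : F = A.cls g := by
    rw [hg, cls_smul (memLp_wt (continuousOn_IccExtend _)), ← ofCont_apply]
    change F = θ⁻¹ • G.resL F
    rw [hF, inv_smul_smul₀ hθ]
  have hres : EqOn (G.res g) (fun x => θ * g x) (Icc 0 1) := by
    refine eqOn_of_ae_wt (A := A) (eq_ae_of_cls_eq (memLp_wt (G.continuousOn_res hgc))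
      (memLp_wt (continuousOn_const.mul hgc)) ?_) (G.continuousOn_res hgc)
      (continuousOn_const.mul hgc)
    rw [← G.resL_cls hgc, cls_smul (memLp_wt hgc), ← hFg, hF]
  -- The term with coefficient 0 only serves to match the two-term form of the linearity lemmas.
  have hgeq : EqOn g (fun x => θ⁻¹ * G.res g x + 0 * G.res g x) (Icc 0 1) := fun x hx => by
    simp only [hres hx]
    field_simp
    ring
  have hmem : A.MemDC2 g := ((G.memDC2_res hgc).combo (G.memDC2_res hgc) θ⁻¹ 0).congr hgeq
  have hop : ∀ x ∈ Icc (0 : ℝ) 1, A.op g x = (G.κ + θ⁻¹) * g x := fun x hx => by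
    rw [op_congr hgeq hx, op_combo (G.memDC2_res hgc).1 (G.memDC2_res hgc).1 _ _ hx,
      G.op_res hgc hx, hres hx]
    field_simp
    ring
  have hN : 0 < ‖F‖ := norm_pos_iff.2 hF0
  refine ⟨G.κ + θ⁻¹, fun x => ‖F‖⁻¹ * g x + 0 * g x, ⟨hmem.combo hmem _ _, fun x hx => ?_, ?_⟩,
    ‖F‖, ?_⟩
  · rw [op_combo hmem.1 hmem.1 _ _ (Ioo_subset_Icc_self hx), hop x (Ioo_subset_Icc_self hx)]
    ring
  · have h1 := norm_cls_sq (memLp_wt (A := A) hgc)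
    rw [← hFg, integral_wt] at h1
    have h2 : ∀ x, A.r x * (‖F‖⁻¹ * g x + 0 * g x) ^ 2 = (‖F‖⁻¹) ^ 2 * (A.r x * g x ^ 2) := by
      intro x; ring
    simp only [h2]
    rw [intervalIntegral.integral_const_mul, ← h1]
    field_simp
  · have : (fun x => ‖F‖⁻¹ * g x + 0 * g x) = fun x => ‖F‖⁻¹ * g x := by ext x; ring
    rw [this, cls_smul (memLp_wt hgc), ← hFg, smul_inv_smul₀ hN.ne']

lemma orthonormal_eigenfunctions (G : A.Green) {φ : ℝ → ℝ → ℝ}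
    (hφ : ∀ μ, A.IsEigenvalue μ → A.IsEigenfunction μ (φ μ)) :
    Orthonormal ℝ (fun μ : {μ : ℝ // A.IsEigenvalue μ} => A.cls (φ μ)) := by
  refine ⟨fun μ => norm_cls_eigenfunction (hφ μ μ.2), fun μ ν hne => ?_⟩
  have h := G.resL_isSymmetric (A.cls (φ μ)) (A.cls (φ ν))
  change inner ℝ (G.resL _) _ = inner ℝ _ (G.resL _) at h
  rw [G.resL_eigenfunction (hφ μ μ.2), G.resL_eigenfunction (hφ ν ν.2), real_inner_smul_left,
    real_inner_smul_right] at h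
  have h1 := G.lt_of_isEigenfunction (hφ μ μ.2)
  have h2 := G.lt_of_isEigenfunction (hφ ν ν.2)
  by_contra hc
  have := inv_injective (mul_right_cancel₀ hc h)
  exact hne (Subtype.ext (by linarith))

/-- The eigenfunctions form a Hilbert basis of `L²_r(0,1)`. -/
def basis {φ : ℝ → ℝ → ℝ} (hφ : ∀ μ, A.IsEigenvalue μ → A.IsEigenfunction μ (φ μ)) :
    HilbertBasis {μ : ℝ // A.IsEigenvalue μ} ℝ A.L2 :=
  HilbertBasis.mkOfOrthogonalEqBot (G.orthonormal_eigenfunctions hφ) (by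
    rw [eq_bot_iff]
    -- By the spectral theorem the eigenspaces of the resolvent have trivial orthogonal complement,
    -- so it suffices that each of them lies in the span of the φ_μ: injectivity excludes the
    -- eigenvalue 0, and simplicity identifies every other eigenvector with a multiple of some φ_μ.
    have hsp := ContinuousLinearMap.orthogonalComplement_iSup_eigenspaces_eq_bot
      G.isCompactOperator_resL G.resL_isSymmetric
    rw [← hsp]
    refine Submodule.orthogonal_le (iSup_le fun θ F hF => ?_)
    replace hF : G.resL F = θ • F := Module.End.mem_eigenspace_iff.1 hF
    by_cases hF0 : F = 0
    · rw [hF0]; exact Submodule.zero_mem _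
    have hθ : θ ≠ 0 := by
      rintro rfl
      rw [zero_smul] at hF
      exact hF0 (G.eq_zero_of_resL_eq_zero hF)
    obtain ⟨μ, ψ, hψ, a, rfl⟩ := G.exists_eigenfunction_of_resL hθ hF hF0
    have hμ := hφ μ ⟨ψ, hψ⟩
    obtain ⟨b, hb⟩ := eigenspace_simple hψ.1 hμ.1 hψ.op_eq hμ.op_eq (by
      by_contra! hc
      have h1 := norm_cls_eigenfunction hμ
      rw [cls_congr (h := fun _ => 0 * φ μ 0) (memLp_wt hμ.1.1.continuousOn)
        (ae_wt_of_eqOn fun x hx => by simp [hc x hx]), cls_smul (memLp_wt continuousOn_const),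
        zero_smul, norm_zero] at h1
      exact zero_ne_one h1)
    have hψ' : A.cls ψ = b • A.cls (φ μ) := by
      rw [← cls_smul (memLp_wt hμ.1.1.continuousOn)]
      exact cls_congr (memLp_wt hψ.1.1.continuousOn) (ae_wt_of_eqOn hb)
    rw [hψ']
    exact Submodule.smul_mem _ _ (Submodule.smul_mem _ _
      (Submodule.subset_span ⟨⟨μ, ψ, hψ⟩, rfl⟩)))

lemma basis_apply {φ : ℝ → ℝ → ℝ} (hφ : ∀ μ, A.IsEigenvalue μ → A.IsEigenfunction μ (φ μ))
    (μ : {μ : ℝ // A.IsEigenvalue μ}) : G.basis hφ μ = A.cls (φ μ) := by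
  simp [basis]

end Green

end SLData

/-! ### Summability over the eigenvalues and eigenfunction coefficients -/

namespace SLData

variable (A : SLData)

/-- The eigenvalues of `A`. -/
abbrev Eig := {μ : ℝ // A.IsEigenvalue μ}

/-- Maximum of `|g|` on `[0,1]`. -/
def supAbs (g : ℝ → ℝ) : ℝ := sSup ((fun x => |g x|) '' Icc 0 1)

/-- Green function data, normalized eigenfunctions and the summability of
`max |φ_μ| / (μ - κ)` over all eigenvalues. -/
structure Spectral where
  G : A.Green
  φ : ℝ → ℝ → ℝ
  hφ : ∀ μ, A.IsEigenvalue μ → A.IsEigenfunction μ (φ μ)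
  summable_sup : Summable fun μ : A.Eig => (μ - G.κ)⁻¹ * supAbs (φ μ)

variable {A}

lemma abs_le_supAbs {g : ℝ → ℝ} (hg : ContinuousOn g (Icc 0 1)) {x : ℝ}
    (hx : x ∈ Icc (0 : ℝ) 1) : |g x| ≤ supAbs g :=
  le_csSup (isCompact_Icc.bddAbove_image hg.abs) (mem_image_of_mem _ hx)

lemma supAbs_nonneg (g : ℝ → ℝ) : 0 ≤ supAbs g :=
  Real.sSup_nonneg (by rintro _ ⟨x, _, rfl⟩; exact abs_nonneg _)

namespace Green

variable (G : A.Green)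

lemma res_eigenfunction {μ : ℝ} {φ : ℝ → ℝ} (h : A.IsEigenfunction μ φ) :
    ∀ x ∈ Icc (0 : ℝ) 1, G.res φ x = (μ - G.κ)⁻¹ * φ x := by
  have hc := h.1.1.continuousOn
  refine eqOn_of_ae_wt (A := A) (eq_ae_of_cls_eq (memLp_wt (G.continuousOn_res hc))
    (memLp_wt (continuousOn_const.mul hc)) ?_) (G.continuousOn_res hc) (continuousOn_const.mul hc)
  rw [cls_smul (memLp_wt hc), ← G.resL_cls hc, G.resL_eigenfunction h]

/-- The coefficients of the section k_x of the Green function are (μ − κ)⁻¹ φ_μ(x). Bessel bounds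
the sum of their squares by sup ‖k_x‖², and integration in x removes φ_μ, which has norm 1. -/
lemma summable_inv_sq {φ : ℝ → ℝ → ℝ} (hφ : ∀ μ, A.IsEigenvalue μ → A.IsEigenfunction μ (φ μ)) :
    Summable fun μ : A.Eig => ((μ - G.κ)⁻¹) ^ 2 := by
  obtain ⟨C, hC, hb⟩ := G.exists_section_bound
  refine summable_of_sum_le (c := ∫ _, C ^ 2 ∂A.wt) (fun μ => sq_nonneg _) fun S => ?_
  have hpt : ∀ x ∈ Icc (0 : ℝ) 1, ∑ μ ∈ S, ((μ - G.κ)⁻¹ * φ μ x) ^ 2 ≤ C ^ 2 := by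
    intro x hx
    have h1 := (G.orthonormal_eigenfunctions hφ).sum_inner_products_le (A.cls (G.ker x)) (s := S)
    have h2 : ∑ μ ∈ S, ((μ - G.κ)⁻¹ * φ μ x) ^ 2 =
        ∑ μ ∈ S, ‖inner ℝ (A.cls (φ μ)) (A.cls (G.ker x))‖ ^ 2 := by
      refine Finset.sum_congr rfl fun μ _ => ?_
      rw [real_inner_comm, ← G.res_eq_inner (hφ μ μ.2).1.1.continuousOn hx,
        G.res_eigenfunction (hφ μ μ.2) x hx, Real.norm_eq_abs, sq_abs]
    rw [h2]
    exact h1.trans (pow_le_pow_left₀ (norm_nonneg _) (hb x) 2)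
  have hc : ∀ μ : A.Eig, ContinuousOn (φ μ) (Icc 0 1) := fun μ => (hφ μ μ.2).1.1.continuousOn
  calc ∑ μ ∈ S, ((μ - G.κ)⁻¹) ^ 2
      = ∑ μ ∈ S, ∫ x, ((μ - G.κ)⁻¹ * φ μ x) ^ 2 ∂A.wt := by
        refine Finset.sum_congr rfl fun μ _ => ?_
        have h1 := norm_cls_sq (memLp_wt (A := A) (hc μ))
        rw [norm_cls_eigenfunction (hφ μ μ.2)] at h1
        simp only [mul_pow]
        rw [integral_const_mul, ← h1]
        ring
    _ = ∫ x, ∑ μ ∈ S, ((μ - G.κ)⁻¹ * φ μ x) ^ 2 ∂A.wt := by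
        rw [integral_finsetSum]
        exact fun μ _ => integrable_wt ((continuousOn_const.mul (hc μ)).pow 2)
    _ ≤ ∫ _, C ^ 2 ∂A.wt := by
        refine integral_mono_ae ?_ (integrable_const _) (A.ae_wt_mem.mono fun x hx => hpt x hx)
        exact integrable_finsetSum _ fun μ _ =>
          integrable_wt ((continuousOn_const.mul (hc μ)).pow 2)

end Green

/-- Under assumption (H), the spectral data exist. -/
lemma nonempty_spectral (hH : A.AssumptionH) : Nonempty A.Spectral := by
  obtain ⟨G⟩ := A.nonempty_green
  obtain ⟨φ, hφ, Λ, hΛ, hΛ0, hs⟩ := hH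
  refine ⟨⟨G, φ, hφ, ?_⟩⟩
  have hlt : ∀ μ : A.Eig, G.κ + 1 < μ := fun μ => G.lt_of_isEigenfunction (hφ μ μ.2)
  -- (H) speaks only of eigenvalues from Λ on. Below Λ the terms (μ − κ)⁻² exceed a fixed positive
  -- number, so summability leaves finitely many of them.
  have hfin : {μ : A.Eig | (μ : ℝ) < Λ}.Finite := by
    have h1 := (G.summable_inv_sq hφ).tendsto_cofinite_zero
    have hpos : 0 < Λ - G.κ := by linarith [hlt ⟨Λ, hΛ⟩]
    have h2 := h1.eventually_lt_const (u := ((Λ - G.κ)⁻¹) ^ 2) (by positivity)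
    rw [eventually_cofinite] at h2
    refine h2.subset fun μ hμ => ?_
    simp only [mem_ofPred_eq, not_lt] at hμ ⊢
    have : 0 < (μ : ℝ) - G.κ := by linarith [hlt μ]
    gcongr
  rw [← hfin.summable_compl_iff]
  let e : ↥({μ : A.Eig | (μ : ℝ) < Λ}ᶜ) ≃ {μ : ℝ // A.IsEigenvalue μ ∧ Λ ≤ μ} :=
    { toFun := fun μ => ⟨μ.1, μ.1.2, not_lt.1 μ.2⟩
      invFun := fun μ => ⟨⟨μ.1, μ.2.1⟩, not_lt.2 μ.2.2⟩
      left_inv := fun _ => rfl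
      right_inv := fun _ => rfl }
  have hs' := (e.summable_iff).2 hs
  refine hs'.of_nonneg_of_le (fun μ => ?_) fun μ => ?_
  · have := hlt μ.1
    exact mul_nonneg (inv_nonneg.2 (by linarith)) (supAbs_nonneg _)
  · have h1 : Λ ≤ ((μ : A.Eig) : ℝ) := not_lt.1 μ.2
    have h2 := G.κ_nonpos
    have h3 : ((μ : A.Eig) - G.κ : ℝ)⁻¹ ≤ ((μ : A.Eig) : ℝ)⁻¹ :=
      inv_anti₀ (by linarith) (by linarith)
    exact mul_le_mul_of_nonneg_right h3 (supAbs_nonneg _)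

namespace Spectral

variable (S : A.Spectral)

/-- The distance of an eigenvalue to `κ`. -/
def ω (μ : A.Eig) : ℝ := μ - S.G.κ

lemma one_lt_ω (μ : A.Eig) : 1 < S.ω μ := by
  have := S.G.lt_of_isEigenfunction (S.hφ μ μ.2)
  unfold ω
  linarith

lemma ω_pos (μ : A.Eig) : 0 < S.ω μ := zero_lt_one.trans (S.one_lt_ω μ)

lemma continuousOn_φ (μ : A.Eig) : ContinuousOn (S.φ μ) (Icc 0 1) :=
  (S.hφ μ μ.2).1.1.continuousOn

/-- A summable real family with no zero term has a countable index set. This is needed for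
exchanging sums over eigenvalues with integrals. -/
lemma countable_eig (S : A.Spectral) : Countable A.Eig := by
  have h := (S.G.summable_inv_sq S.hφ).countable_support
  refine Set.countable_univ_iff.1 (h.mono fun μ _ => ?_)
  have := S.ω_pos μ
  unfold ω at this
  simp only [Function.mem_support]
  positivity

lemma summable_inv_ω_sq : Summable fun μ : A.Eig => ((S.ω μ)⁻¹) ^ 2 := S.G.summable_inv_sq S.hφ

lemma summable_inv_ω_mul : Summable fun μ : A.Eig => (S.ω μ)⁻¹ * supAbs (S.φ μ) := S.summable_sup

/-- The coefficients in the eigenfunction expansion. -/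
def coef (g : ℝ → ℝ) (μ : A.Eig) : ℝ := ∫ x, g x * S.φ μ x ∂A.wt

lemma coef_eq_inner {g : ℝ → ℝ} (hg : MemLp g 2 A.wt) (μ : A.Eig) :
    S.coef g μ = inner ℝ (A.cls (S.φ μ)) (A.cls g) := by
  rw [inner_cls (memLp_wt (S.continuousOn_φ μ)) hg, coef]
  simp only [mul_comm]

lemma abs_coef_le {g : ℝ → ℝ} (hg : MemLp g 2 A.wt) (μ : A.Eig) :
    |S.coef g μ| ≤ ‖A.cls g‖ := by
  rw [S.coef_eq_inner hg]
  refine (abs_real_inner_le_norm _ _).trans ?_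
  rw [Green.norm_cls_eigenfunction (S.hφ μ μ.2), one_mul]

lemma hasSum_coef_sq {g : ℝ → ℝ} (hg : MemLp g 2 A.wt) :
    HasSum (fun μ => S.coef g μ ^ 2) (‖A.cls g‖ ^ 2) := by
  have := (S.G.basis S.hφ).hasSum_inner_mul_inner (A.cls g) (A.cls g)
  rw [real_inner_self_eq_norm_sq] at this
  have e : (fun μ => S.coef g μ ^ 2) = fun μ => inner ℝ (A.cls g) (S.G.basis S.hφ μ) *
      inner ℝ (S.G.basis S.hφ μ) (A.cls g) := by
    ext μ
    rw [S.coef_eq_inner hg, S.G.basis_apply, real_inner_comm (A.cls g), pow_two]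
  rw [e]
  exact this

lemma coef_congr {g h : ℝ → ℝ} (H : EqOn g h (Icc 0 1)) (μ : A.Eig) : S.coef g μ = S.coef h μ :=
  integral_congr_ae (A.ae_wt_mem.mono fun x hx => by simp only [H hx])

lemma coef_combo {g h : ℝ → ℝ} (hg : MemLp g 2 A.wt) (hh : MemLp h 2 A.wt) (a b : ℝ)
    (μ : A.Eig) : S.coef (fun x => a * g x + b * h x) μ = a * S.coef g μ + b * S.coef h μ := by
  have hφ := memLp_wt (A := A) (S.continuousOn_φ μ)
  unfold coef
  rw [← integral_const_mul, ← integral_const_mul, ← integral_add]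
  · congr 1; ext x; ring
  · exact (hg.integrable_mul hφ).const_mul a
  · exact (hh.integrable_mul hφ).const_mul b

lemma coef_sub {g h : ℝ → ℝ} (hg : MemLp g 2 A.wt) (hh : MemLp h 2 A.wt) (μ : A.Eig) :
    S.coef (g - h) μ = S.coef g μ - S.coef h μ := by
  have := S.coef_combo hg hh 1 (-1) μ
  rw [one_mul, neg_one_mul, ← sub_eq_add_neg] at this
  rw [← this]
  congr 1; ext x; simp; ring

lemma ae_eq_zero_of_coef {g : ℝ → ℝ} (hg : MemLp g 2 A.wt) (H : ∀ μ, S.coef g μ = 0) :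
    g =ᵐ[A.wt] 0 := by
  have h1 := S.hasSum_coef_sq hg
  simp only [H, ne_eq, OfNat.ofNat_ne_zero, not_false_eq_true, zero_pow] at h1
  have h2 : A.cls g = 0 := by simpa using h1.unique hasSum_zero
  have h3 := coeFn_cls hg
  rw [h2] at h3
  exact h3.symm.trans (Lp.coeFn_zero _ _ _)

/-- Continuous functions with the same coefficients coincide. -/
lemma eqOn_of_coef {g h : ℝ → ℝ} (hg : ContinuousOn g (Icc 0 1)) (hh : ContinuousOn h (Icc 0 1))
    (H : ∀ μ, S.coef g μ = S.coef h μ) : EqOn g h (Icc 0 1) := by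
  have h1 := S.ae_eq_zero_of_coef ((memLp_wt (A := A) hg).sub (memLp_wt hh))
    (fun μ => by rw [S.coef_sub (memLp_wt hg) (memLp_wt hh), H, sub_self])
  refine eqOn_of_ae_wt (A := A) (h1.mono fun x hx => ?_) hg hh
  exact sub_eq_zero.1 hx

lemma coef_res {g : ℝ → ℝ} (hg : ContinuousOn g (Icc 0 1)) (μ : A.Eig) :
    S.coef (S.G.res g) μ = (S.ω μ)⁻¹ * S.coef g μ := by
  rw [S.coef_eq_inner (memLp_wt (S.G.continuousOn_res hg)), S.coef_eq_inner (memLp_wt hg),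
    ← S.G.resL_cls hg]
  have h := S.G.resL_isSymmetric (A.cls (S.φ μ)) (A.cls g)
  change inner ℝ (S.G.resL _) _ = inner ℝ _ (S.G.resL _) at h
  rw [← h, S.G.resL_eigenfunction (S.hφ μ μ.2), real_inner_smul_left]
  rfl

/-- Green's identity without integration by parts: g is the resolvent of (A − κ)g, the resolvent is
symmetric, and φ_μ is an eigenvector of it. -/
lemma coef_op {g : ℝ → ℝ} (hg : A.MemDC2 g) (μ : A.Eig) :
    S.coef (A.op g) μ = μ * S.coef g μ := by
  have hc := continuousOn_op (A := A) hg.1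
  have hF : ContinuousOn (fun y => A.op g y - S.G.κ * g y) (Icc 0 1) :=
    hc.sub (continuousOn_const.mul hg.1.continuousOn)
  have h1 := S.coef_congr (S.G.res_op_sub hg) μ
  rw [S.coef_res hF] at h1
  have h2 : S.coef (fun y => A.op g y - S.G.κ * g y) μ =
      S.coef (A.op g) μ - S.G.κ * S.coef g μ := by
    have := S.coef_combo (memLp_wt hc) (memLp_wt hg.1.continuousOn) 1 (-S.G.κ) μ
    rw [one_mul] at this
    rw [sub_eq_add_neg, ← neg_mul, ← this]
    congr 1; ext x; ring
  have hω := (S.ω_pos μ).ne'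
  rw [h2, eq_inv_mul_iff_mul_eq₀ hω] at h1
  unfold ω at h1
  linarith

lemma coef_φ (μ ν : A.Eig) : S.coef (S.φ ν) μ = if ν = μ then 1 else 0 := by
  classical
  rw [S.coef_eq_inner (memLp_wt (S.continuousOn_φ ν))]
  have := orthonormal_iff_ite.1 (S.G.orthonormal_eigenfunctions S.hφ) μ ν
  rw [this]
  simp only [eq_comm]

/-- The coefficients of a uniformly convergent eigenfunction series. -/
lemma coef_tsum {c : A.Eig → ℝ} (hc : Summable fun μ => |c μ| * supAbs (S.φ μ)) (μ : A.Eig) :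
    S.coef (fun x => ∑' ν, c ν * S.φ ν x) μ = c μ := by
  have := S.countable_eig
  unfold coef
  obtain ⟨C, hC, hb⟩ := exists_abs_le_of_continuousOn (S.continuousOn_φ μ)
  have hcont : ∀ ν, ContinuousOn (fun x => c ν * S.φ ν x * S.φ μ x) (Icc 0 1) := fun ν =>
    (continuousOn_const.mul (S.continuousOn_φ ν)).mul (S.continuousOn_φ μ)
  have hsum : Summable fun ν => ∫ x, ‖c ν * S.φ ν x * S.φ μ x‖ ∂A.wt := by
    refine (hc.mul_right (∫ _, C ∂A.wt)).of_nonneg_of_le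
      (fun ν => integral_nonneg fun x => norm_nonneg _) fun ν => ?_
    rw [← integral_const_mul]
    refine integral_mono_ae (integrable_wt (hcont ν)).norm (integrable_const _) ?_
    filter_upwards [A.ae_wt_mem] with x hx
    rw [norm_mul, norm_mul]
    exact mul_le_mul (mul_le_mul_of_nonneg_left (abs_le_supAbs (S.continuousOn_φ ν) hx)
      (abs_nonneg _)) (hb x hx) (norm_nonneg _) (mul_nonneg (abs_nonneg _) (supAbs_nonneg _))
  have h1 := integral_tsum_of_summable_integral_norm (fun ν => integrable_wt (hcont ν)) hsum
  simp only [tsum_mul_right] at h1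
  rw [← h1, tsum_eq_single μ]
  · simp only [mul_assoc]
    rw [integral_const_mul]
    have := S.coef_φ μ μ
    rw [coef, if_pos rfl] at this
    rw [this, mul_one]
  · intro ν hν
    simp only [mul_assoc]
    rw [integral_const_mul]
    have := S.coef_φ μ ν
    rw [coef, if_neg hν] at this
    rw [this, mul_zero]

end Spectral

end SLData

/-! ### Estimates for a single mode -/

lemma sub_le_of_deriv_le {Y B Y' B' : ℝ → ℝ} {a b : ℝ} (hY : ContinuousOn Y (Icc a b))
    (hB : ContinuousOn B (Icc a b)) (hY' : ∀ t ∈ Ioo a b, HasDerivAt Y (Y' t) t)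
    (hB' : ∀ t ∈ Ioo a b, HasDerivAt B (B' t) t) (h : ∀ t ∈ Ioo a b, Y' t ≤ B' t) {t : ℝ}
    (ht : t ∈ Icc a b) : Y t - Y a ≤ B t - B a := by
  have hmono : MonotoneOn (fun t => B t - Y t) (Icc a b) := by
    refine monotoneOn_of_deriv_nonneg (convex_Icc a b) (hB.sub hY) ?_ ?_
    · rw [interior_Icc]
      exact fun x hx => ((hB' x hx).sub (hY' x hx)).differentiableAt.differentiableWithinAt
    · rw [interior_Icc]
      intro x hx
      have := ((hB' x hx).sub (hY' x hx)).deriv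
      change deriv (fun t => B t - Y t) x = _ at this
      rw [this]
      linarith [h x hx]
  have := hmono (left_mem_Icc.2 (ht.1.trans ht.2)) ht ht.1
  simp only at this
  linarith

/-- Decay of the solutions of `y' = -μ y + g`, with rate `ω = μ - κ` up to a factor. -/
lemma abs_le_of_mode {y g : ℝ → ℝ} {a b μ κ M : ℝ} (hκ : κ ≤ 0) (hω : 0 < μ - κ) (hM : 0 ≤ M)
    (hy : ContinuousOn y (Icc a b)) (hy' : ∀ t ∈ Ioo a b, HasDerivAt y (-μ * y t + g t) t)
    (hg : ∀ t ∈ Ioo a b, |g t| ≤ M) {t : ℝ} (ht : t ∈ Icc a b) :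
    |y t| ≤ Real.exp (-κ * (t - a)) * (Real.exp (-(μ - κ) * (t - a)) * |y a| + M / (μ - κ)) := by
  have hexp : ∀ ν t : ℝ, HasDerivAt (fun t => Real.exp (ν * (t - a)))
      (ν * Real.exp (ν * (t - a))) t := fun ν t => by
    have := (((hasDerivAt_id t).sub_const a).const_mul ν).exp
    exact this.congr_deriv (by simp [mul_comm])
  -- Y carries the integrating factor, so Y' = e^{μ(t−a)} g. As κ ≤ 0, |Y'| is at most B' = M
  -- e^{(μ−κ)(t−a)}. Using the rate μ − κ > 0 avoids the sign of μ; the price is the factor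
  -- e^{−κ(t−a)}.
  let Y : ℝ → ℝ := fun t => Real.exp (μ * (t - a)) * y t
  let B : ℝ → ℝ := fun t => M / (μ - κ) * Real.exp ((μ - κ) * (t - a))
  have hYc : ContinuousOn Y (Icc a b) := ContinuousOn.mul (by fun_prop) hy
  have hBc : ContinuousOn B (Icc a b) := by fun_prop
  have hY' : ∀ t ∈ Ioo a b, HasDerivAt Y (Real.exp (μ * (t - a)) * g t) t := fun t ht =>
    ((hexp μ t).mul (hy' t ht)).congr_deriv (by ring)
  have hB' : ∀ t ∈ Ioo a b, HasDerivAt B (M * Real.exp ((μ - κ) * (t - a))) t := fun t ht =>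
    ((hexp (μ - κ) t).const_mul (M / (μ - κ))).congr_deriv (by field_simp)
  have hle : ∀ t ∈ Ioo a b, |Real.exp (μ * (t - a)) * g t| ≤ M * Real.exp ((μ - κ) * (t - a)) := by
    intro t ht
    rw [abs_mul, Real.abs_exp, mul_comm]
    refine mul_le_mul (hg t ht) (Real.exp_le_exp.2 ?_) (Real.exp_pos _).le hM
    nlinarith [ht.1]
  have h1 := sub_le_of_deriv_le hYc hBc hY' hB' (fun t ht => (le_abs_self _).trans (hle t ht)) ht
  have h2 := sub_le_of_deriv_le (Y := fun t => -Y t) hYc.neg hBc (fun t ht => (hY' t ht).neg) hB'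
    (fun t ht => (neg_le_abs _).trans (hle t ht)) ht
  have hYa : Y a = y a := by simp [Y]
  have hBa : 0 ≤ B a := mul_nonneg (div_nonneg hM hω.le) (Real.exp_pos _).le
  rw [hYa] at h1 h2
  have h3 : |Y t| ≤ |y a| + B t := by
    rw [abs_le]
    constructor
    · linarith [neg_abs_le (y a)]
    · linarith [le_abs_self (y a)]
  have hyt : y t = Real.exp (-μ * (t - a)) * Y t := by
    simp only [Y]
    rw [← mul_assoc, ← Real.exp_add]
    simp
  rw [hyt, abs_mul, Real.abs_exp]
  refine (mul_le_mul_of_nonneg_left h3 (Real.exp_pos _).le).trans_eq ?_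
  simp only [B]
  rw [mul_add, mul_add, ← mul_assoc (Real.exp (-κ * (t - a))), ← Real.exp_add,
    mul_left_comm (Real.exp (-μ * (t - a))), ← Real.exp_add, mul_comm (M / (μ - κ))]
  congr 3
  · ring
  · ring

/-- Solution of `c' = -μ c + h` with a bounded source that is continuous on `(s, T]`. -/
lemma exists_mode {h : ℝ → ℝ} {s T M : ℝ} (hh : ContinuousOn h (Ioc s T))
    (hM : ∀ t ∈ Ioc s T, |h t| ≤ M) (μ c₀ : ℝ) :
    ∃ c : ℝ → ℝ, c s = c₀ ∧ ContinuousOn c (Icc s T) ∧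
      ∀ t ∈ Ioo s T, HasDerivAt c (-μ * c t + h t) t := by
  rcases le_or_gt T s with hsT | hsT
  · refine ⟨fun _ => c₀, rfl, continuousOn_const, fun t ht => ?_⟩
    exact absurd (ht.1.trans ht.2) (not_lt.2 hsT)
  have hc : ContinuousOn (fun σ => Real.exp (μ * (σ - s)) * h σ) (Ioc s T) :=
    ContinuousOn.mul (by fun_prop) hh
  -- The source may have no limit at s; boundedness alone gives integrability down to s.
  have hint : IntegrableOn (fun σ => Real.exp (μ * (σ - s)) * h σ) (Ioc s T) := by
    have hhi : IntegrableOn h (Ioc s T) :=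
      Integrable.of_bound (hh.aestronglyMeasurable measurableSet_Ioc) M
        ((ae_restrict_mem measurableSet_Ioc).mono fun t ht => hM t ht)
    have he : ContinuousOn (fun σ => Real.exp (μ * (σ - s))) (Icc s T) := by fun_prop
    obtain ⟨C, _, hC⟩ := exists_abs_le_of_continuousOn he
    exact hhi.bdd_mul (c := C)
      ((he.mono Ioc_subset_Icc_self).aestronglyMeasurable measurableSet_Ioc)
      ((ae_restrict_mem measurableSet_Ioc).mono fun t ht => hC t (Ioc_subset_Icc_self ht))
  have hII : IntervalIntegrable (fun σ => Real.exp (μ * (σ - s)) * h σ) volume s T :=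
    (intervalIntegrable_iff_integrableOn_Ioc_of_le hsT.le).2 hint
  refine ⟨fun t => Real.exp (-μ * (t - s)) *
    (c₀ + ∫ σ in s..t, Real.exp (μ * (σ - s)) * h σ), by simp, ?_, fun t ht => ?_⟩
  · refine ContinuousOn.mul (by fun_prop) (continuousOn_const.add ?_)
    have := intervalIntegral.continuousOn_primitive_interval' hII left_mem_uIcc
    rwa [uIcc_of_le hsT.le] at this
  · have hca : ContinuousAt (fun σ => Real.exp (μ * (σ - s)) * h σ) t :=
      (hc.mono Ioo_subset_Ioc_self).continuousAt (Ioo_mem_nhds ht.1 ht.2)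
    have h1 : HasDerivAt (fun t => ∫ σ in s..t, Real.exp (μ * (σ - s)) * h σ)
        (Real.exp (μ * (t - s)) * h t) t := by
      refine intervalIntegral.integral_hasDerivAt_right
        (hII.mono_set (by
          rw [uIcc_of_le ht.1.le, uIcc_of_le hsT.le]
          exact Icc_subset_Icc_right ht.2.le)) ?_ hca
      exact (hc.mono Ioo_subset_Ioc_self).stronglyMeasurableAtFilter isOpen_Ioo t ht
    have h2 : HasDerivAt (fun t => Real.exp (-μ * (t - s)))
        (-μ * Real.exp (-μ * (t - s))) t :=
      ((((hasDerivAt_id t).sub_const s).const_mul (-μ)).exp).congr_deriv (by simp [mul_comm])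
    refine (h2.mul (h1.const_add c₀)).congr_deriv ?_
    have h3 : Real.exp (-μ * (t - s)) * Real.exp (μ * (t - s)) = 1 := by
      rw [← Real.exp_add]; simp
    linear_combination h t * h3

/-- This and the quadratic version turn the exponential decay after a positive waiting time into
powers of 1/ω. -/
lemma exp_neg_le_inv {x : ℝ} (hx : 0 < x) : Real.exp (-x) ≤ x⁻¹ := by
  rw [Real.exp_neg]
  exact inv_anti₀ hx (by linarith [Real.add_one_le_exp x])

lemma exp_neg_le_inv_sq {x : ℝ} (hx : 0 < x) : Real.exp (-x) ≤ 2 * (x⁻¹) ^ 2 := by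
  rw [Real.exp_neg]
  have h := Real.quadratic_le_exp_of_nonneg hx.le
  have h2 : (2 : ℝ) * (x⁻¹) ^ 2 = (x ^ 2 / 2)⁻¹ := by field_simp
  rw [h2]
  exact inv_anti₀ (by positivity) (by linarith)

/-- Uniform bounds, of order `1 / ω`, for the modes and for their time derivatives. -/
lemma exists_mode_bound {s s₁ s₂ T κ : ℝ} (C₀ M M' : ℝ) (h01 : s < s₁) (h12 : s₁ < s₂)
    (hκ : κ ≤ 0) (hC₀ : 0 ≤ C₀) (hM : 0 ≤ M) (hM' : 0 ≤ M') :
    ∃ C : ℝ, 0 ≤ C ∧ ∀ (μ : ℝ) (c h₁ h₂ h₁' : ℝ → ℝ), 1 ≤ μ - κ → |c s| ≤ C₀ →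
      ContinuousOn c (Icc s T) → ContinuousOn h₁ (Ioc s T) →
      (∀ t ∈ Ioo s T, HasDerivAt c (-μ * c t + (h₁ t + h₂ t)) t) →
      (∀ t ∈ Ioc s T, |h₁ t| ≤ M) → (∀ t ∈ Ioc s T, |h₂ t| ≤ M * (μ - κ)⁻¹) →
      (∀ t ∈ Ioo s₁ T, HasDerivAt h₁ (h₁' t) t) → (∀ t ∈ Ioo s₁ T, |h₁' t| ≤ M') →
      ∀ t ∈ Icc s₂ T, |c t| ≤ C * (μ - κ)⁻¹ ∧
        |-μ * c t + (h₁ t + h₂ t)| ≤ C * (μ - κ)⁻¹ := by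
  -- R bounds the factors e^{−κ(t−a)}. The other constants give, in turn, C₁/ω as a bound for c on
  -- [s₁, T], G₁/ω for the source of the corrected mode y below, and C₂/ω² for y on [s₂, T].
  set R := Real.exp (-κ * (T - s))
  set C₁ := R * (C₀ * (s₁ - s)⁻¹ + (M + M))
  set G₁ := -κ * M + M + M'
  set C₂ := R * ((C₁ + M) * (2 * ((s₂ - s₁)⁻¹) ^ 2) + G₁)
  have hd1 : 0 < s₁ - s := by linarith
  have hd2 : 0 < s₂ - s₁ := by linarith
  have hκ' : 0 ≤ -κ := by linarith
  have hR : 0 < R := Real.exp_pos _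
  have hC₁ : 0 ≤ C₁ := by positivity
  have hG₁ : 0 ≤ G₁ := by positivity
  have hC₂ : 0 ≤ C₂ := by positivity
  refine ⟨max C₁ ((1 + -κ) * C₂ + (-κ * M + M)), le_max_of_le_left hC₁, ?_⟩
  intro μ c h₁ h₂ h₁' hω hcs hc hh₁ hc' hb₁ hb₂ hd₁ hbd₁ t ht
  set ω := μ - κ with hωdef
  have hω0 : 0 < ω := by linarith
  have hωi : 0 < ω⁻¹ := inv_pos.2 hω0
  have hωi1 : ω⁻¹ ≤ 1 := inv_le_one_of_one_le₀ hω
  have hRle : ∀ a t : ℝ, s ≤ a → t ≤ T → Real.exp (-κ * (t - a)) ≤ R := fun a t ha ht =>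
    Real.exp_le_exp.2 (mul_le_mul_of_nonneg_left (by linarith) hκ')
  have hc1 : ∀ t ∈ Icc s₁ T, |c t| ≤ C₁ * ω⁻¹ := by
    intro t ht
    have h1 := abs_le_of_mode (M := M + M) hκ hω0 (by positivity) hc hc' (fun t ht => by
      have e1 := hb₁ t (Ioo_subset_Ioc_self ht)
      have e2 := hb₂ t (Ioo_subset_Ioc_self ht)
      refine (abs_add_le _ _).trans (add_le_add e1 (e2.trans ?_))
      exact mul_le_of_le_one_right hM hωi1) (t := t) ⟨by linarith [ht.1], ht.2⟩
    have h2 : Real.exp (-ω * (t - s)) ≤ (s₁ - s)⁻¹ * ω⁻¹ := by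
      have : Real.exp (-ω * (t - s)) ≤ Real.exp (-(ω * (s₁ - s))) :=
        Real.exp_le_exp.2 (by nlinarith [ht.1])
      refine this.trans ((exp_neg_le_inv (by positivity)).trans_eq ?_)
      rw [mul_inv, mul_comm]
    refine h1.trans ?_
    rw [show C₁ * ω⁻¹ = R * ((s₁ - s)⁻¹ * ω⁻¹ * C₀ + (M + M) / ω) by
      simp only [C₁]; ring]
    refine mul_le_mul (hRle s t le_rfl ht.2) ?_ (by positivity) hR.le
    gcongr
  -- From c = O(1/ω) alone, −μ c + h₁ + h₂ would only be O(1). Removing the quasi-stationary part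
  -- h₁/ω leaves a source O(1/ω), so y = O(1/ω²) and c' = −μ y − κ h₁/ω + h₂ = O(1/ω). Here the
  -- derivative of h₁ enters.
  let y : ℝ → ℝ := fun t => c t - ω⁻¹ * h₁ t
  have hT : s₁ ≤ T := by linarith [ht.1, ht.2]
  have hsub : Icc s₁ T ⊆ Ioc s T := fun x hx => ⟨by linarith [hx.1], hx.2⟩
  have hy : ContinuousOn y (Icc s₁ T) :=
    (hc.mono (Icc_subset_Icc_left h01.le)).sub (continuousOn_const.mul (hh₁.mono hsub))
  have hy' : ∀ t ∈ Ioo s₁ T, HasDerivAt y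
      (-μ * y t + (-κ * h₁ t * ω⁻¹ + h₂ t - ω⁻¹ * h₁' t)) t := by
    intro t ht
    refine ((hc' t ⟨h01.trans ht.1, ht.2⟩).sub ((hd₁ t ht).const_mul ω⁻¹)).congr_deriv ?_
    simp only [y]
    have : μ = ω + κ := by simp [ω]
    rw [this]
    field_simp
    ring
  have hyb := abs_le_of_mode (M := G₁ * ω⁻¹) hκ hω0 (by positivity) hy hy' (fun t ht => by
      have ht' : t ∈ Ioc s T := ⟨h01.trans ht.1, ht.2.le⟩
      have e1 : |-κ * h₁ t * ω⁻¹| ≤ -κ * M * ω⁻¹ := by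
        rw [abs_mul, abs_mul, abs_of_nonneg hκ', abs_of_pos hωi]
        gcongr
        exact hb₁ t ht'
      have e2 := hb₂ t ht'
      have e3 : |ω⁻¹ * h₁' t| ≤ M' * ω⁻¹ := by
        rw [abs_mul, abs_of_pos hωi, mul_comm]
        gcongr
        exact hbd₁ t ht
      have e4 := abs_sub (-κ * h₁ t * ω⁻¹ + h₂ t) (ω⁻¹ * h₁' t)
      have e5 := abs_add_le (-κ * h₁ t * ω⁻¹) (h₂ t)
      have : G₁ * ω⁻¹ = -κ * M * ω⁻¹ + M * ω⁻¹ + M' * ω⁻¹ := by simp only [G₁]; ring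
      linarith) (t := t) ⟨h12.le.trans ht.1, ht.2⟩
  have hys : |y s₁| ≤ C₁ + M := by
    have e1 := hc1 s₁ ⟨le_rfl, hT⟩
    have e2 := hb₁ s₁ ⟨h01, hT⟩
    have e3 : |ω⁻¹ * h₁ s₁| ≤ M := by
      rw [abs_mul, abs_of_pos hωi]
      nlinarith [abs_nonneg (h₁ s₁)]
    have e4 := abs_sub (c s₁) (ω⁻¹ * h₁ s₁)
    have e5 : C₁ * ω⁻¹ ≤ C₁ := mul_le_of_le_one_right hC₁ hωi1
    simp only [y]
    linarith
  have hy2 : |y t| ≤ C₂ * (ω⁻¹ * ω⁻¹) := by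
    have h2 : Real.exp (-ω * (t - s₁)) ≤ 2 * ((s₂ - s₁)⁻¹) ^ 2 * (ω⁻¹ * ω⁻¹) := by
      have : Real.exp (-ω * (t - s₁)) ≤ Real.exp (-(ω * (s₂ - s₁))) :=
        Real.exp_le_exp.2 (by nlinarith [ht.1])
      refine this.trans ((exp_neg_le_inv_sq (by positivity)).trans_eq ?_)
      rw [mul_inv]
      ring
    refine hyb.trans ?_
    rw [show C₂ * (ω⁻¹ * ω⁻¹) = R * (2 * ((s₂ - s₁)⁻¹) ^ 2 * (ω⁻¹ * ω⁻¹) * (C₁ + M) +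
      G₁ * ω⁻¹ / ω) by simp only [C₂]; ring]
    refine mul_le_mul (hRle s₁ t h01.le ht.2) ?_ (by positivity) hR.le
    gcongr
  refine ⟨(hc1 t ⟨h12.le.trans ht.1, ht.2⟩).trans
    (mul_le_mul_of_nonneg_right (le_max_left _ _) hωi.le), ?_⟩
  refine le_trans ?_ (mul_le_mul_of_nonneg_right (le_max_right _ _) hωi.le)
  have ht' : t ∈ Ioc s T := ⟨by linarith [ht.1], ht.2⟩
  have e0 : -μ * c t + (h₁ t + h₂ t) = -μ * y t + (-κ * h₁ t * ω⁻¹) + h₂ t := by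
    simp only [y]
    have : μ = ω + κ := by simp [ω]
    rw [this]
    field_simp
    ring
  rw [e0]
  have e1 : |-κ * h₁ t * ω⁻¹| ≤ -κ * M * ω⁻¹ := by
    rw [abs_mul, abs_mul, abs_of_nonneg hκ', abs_of_pos hωi]
    gcongr
    exact hb₁ t ht'
  have e2 := hb₂ t ht'
  have e3 : |-μ * y t| ≤ (1 + -κ) * C₂ * ω⁻¹ := by
    rw [abs_mul, abs_neg]
    have hμ : |μ| ≤ (1 + -κ) * ω := by
      rw [abs_le]
      constructor <;> nlinarith
    calc |μ| * |y t| ≤ ((1 + -κ) * ω) * (C₂ * (ω⁻¹ * ω⁻¹)) :=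
          mul_le_mul hμ hy2 (abs_nonneg _) (by positivity)
      _ = (1 + -κ) * C₂ * ω⁻¹ := by field_simp
  have e4 := abs_add_le (-μ * y t + (-κ * h₁ t * ω⁻¹)) (h₂ t)
  have e5 := abs_add_le (-μ * y t) (-κ * h₁ t * ω⁻¹)
  have : ((1 + -κ) * C₂ + (-κ * M + M)) * ω⁻¹ =
    (1 + -κ) * C₂ * ω⁻¹ + -κ * M * ω⁻¹ + M * ω⁻¹ := by ring
  linarith

/-! ### Eigenfunction series and the problem with homogeneous boundary conditions -/

namespace SLData

variable {A : SLData}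

/-- A jointly continuous function is a continuous family of elements of `C([0,1])`. -/
lemma continuous_curry {F : ℝ → ℝ → ℝ} {J : Set ℝ}
    (hF : ContinuousOn (fun z : ℝ × ℝ => F z.1 z.2) (J ×ˢ Icc 0 1)) :
    ∃ K : C(J, C(Icc (0 : ℝ) 1, ℝ)), ∀ t x, K t x = F t x := by
  have hc : Continuous (fun z : J × Icc (0 : ℝ) 1 => F z.1 z.2) :=
    hF.comp_continuous (f := fun z : J × Icc (0 : ℝ) 1 => ((z.1 : ℝ), (z.2 : ℝ)))
      (by fun_prop) fun z => ⟨z.1.2, z.2.2⟩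
  exact ⟨ContinuousMap.curry ⟨_, hc⟩, fun _ _ => rfl⟩

lemma continuousOn_slice {F : ℝ → ℝ → ℝ} {J : Set ℝ}
    (hF : ContinuousOn (fun z : ℝ × ℝ => F z.1 z.2) (J ×ˢ Icc 0 1)) {t : ℝ} (ht : t ∈ J) :
    ContinuousOn (F t) (Icc 0 1) :=
  hF.comp (f := fun x : ℝ => (t, x)) (by fun_prop) fun _ hx => ⟨ht, hx⟩

lemma continuousOn_time {F : ℝ → ℝ → ℝ} {J : Set ℝ}
    (hF : ContinuousOn (fun z : ℝ × ℝ => F z.1 z.2) (J ×ˢ Icc 0 1)) {x : ℝ}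
    (hx : x ∈ Icc (0 : ℝ) 1) : ContinuousOn (fun t => F t x) J :=
  hF.comp (f := fun t : ℝ => (t, x)) (by fun_prop) fun _ ht => ⟨ht, hx⟩

/-- A jointly continuous function is a continuous curve in `L²_r`. -/
lemma continuousOn_cls {F : ℝ → ℝ → ℝ} {J : Set ℝ}
    (hF : ContinuousOn (fun z : ℝ × ℝ => F z.1 z.2) (J ×ˢ Icc 0 1)) :
    ContinuousOn (fun t => A.cls (F t)) J := by
  obtain ⟨K, hK⟩ := continuous_curry hF
  rw [continuousOn_iff_continuous_domRestrict]
  have : Continuous fun t : J => A.ofCont (K t) := A.ofCont.continuous.comp K.continuous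
  exact this.congr fun t => A.ofCont_eq_cls (hK t)

lemma eLpNorm_sub_eq {g h : ℝ → ℝ} (hg : MemLp g 2 A.wt) (hh : MemLp h 2 A.wt) :
    eLpNorm (g - h) 2 A.wt = ENNReal.ofReal ‖A.cls g - A.cls h‖ := by
  rw [← cls_sub hg hh, cls_of_memLp (hg.sub hh), Lp.norm_toLp,
    ENNReal.ofReal_toReal (hg.sub hh).eLpNorm_ne_top]

lemma tendsto_eLpNorm_iff {ι : Type*} {l : Filter ι} {u : ι → ℝ → ℝ} {g : ℝ → ℝ}
    (hu : ∀ᶠ t in l, MemLp (u t) 2 A.wt) (hg : MemLp g 2 A.wt) :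
    Tendsto (fun t => eLpNorm (u t - g) 2 A.wt) l (𝓝 0) ↔
      Tendsto (fun t => A.cls (u t)) l (𝓝 (A.cls g)) := by
  rw [tendsto_iff_norm_sub_tendsto_zero]
  have he : (fun t => eLpNorm (u t - g) 2 A.wt) =ᶠ[l]
      fun t => ENNReal.ofReal ‖A.cls (u t) - A.cls g‖ :=
    hu.mono fun t ht => eLpNorm_sub_eq ht hg
  rw [tendsto_congr' he]
  constructor
  · intro h
    have := (ENNReal.tendsto_toReal ENNReal.zero_ne_top).comp h
    simpa [Function.comp_def] using this
  · intro h
    have := ENNReal.tendsto_ofReal h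
    simpa using this

namespace Spectral

variable (S : A.Spectral)

lemma continuousOn_coef {F : ℝ → ℝ → ℝ} {J : Set ℝ}
    (hF : ContinuousOn (fun z : ℝ × ℝ => F z.1 z.2) (J ×ˢ Icc 0 1)) (μ : A.Eig) :
    ContinuousOn (fun t => S.coef (F t) μ) J := by
  have h : ContinuousOn (fun t => inner ℝ (A.cls (S.φ μ)) (A.cls (F t))) J :=
    continuousOn_const.inner (continuousOn_cls hF)
  exact h.congr fun t ht => S.coef_eq_inner (memLp_wt (continuousOn_slice hF ht)) μ

/-- An eigenfunction series with coefficients `O(1/ω)` converges to a continuous function. -/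
lemma continuousOn_series {c : A.Eig → ℝ → ℝ} {s T : ℝ} (hc : ∀ μ, ContinuousOn (c μ) (Ioc s T))
    (hb : ∀ s₂ ∈ Ioo s T, ∃ C, 0 ≤ C ∧ ∀ μ, ∀ t ∈ Icc s₂ T, |c μ t| ≤ C * (S.ω μ)⁻¹) :
    ContinuousOn (fun z : ℝ × ℝ => ∑' μ, c μ z.1 * S.φ μ z.2) (Ioc s T ×ˢ Icc 0 1) := by
  rintro ⟨t, x⟩ ⟨ht, hx⟩
  simp only at ht hx
  -- The coefficient bounds may degenerate as t → s, so the Weierstrass test is applied on [s₂, T],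
  -- which is a neighbourhood of t in (s, T].
  set s₂ := (s + t) / 2
  have hs₂ : s₂ ∈ Ioo s T := ⟨by simp only [s₂]; linarith [ht.1], by
    simp only [s₂]; linarith [ht.1, ht.2]⟩
  have hs₂t : s₂ < t := by simp only [s₂]; linarith [ht.1]
  obtain ⟨C, hC, hbC⟩ := hb s₂ hs₂
  have h1 : ContinuousOn (fun z : ℝ × ℝ => ∑' μ, c μ z.1 * S.φ μ z.2) (Icc s₂ T ×ˢ Icc 0 1) := by
    refine continuousOn_tsum (u := fun μ => C * ((S.ω μ)⁻¹ * supAbs (S.φ μ))) (fun μ => ?_)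
      (S.summable_inv_ω_mul.mul_left C) ?_
    · refine ContinuousOn.mul ?_ ?_
      · exact (hc μ).comp continuousOn_fst fun z hz => ⟨hs₂.1.trans_le hz.1.1, hz.1.2⟩
      · exact (S.continuousOn_φ μ).comp continuousOn_snd fun z hz => hz.2
    · rintro μ ⟨t, x⟩ ⟨ht, hx⟩
      rw [norm_mul, ← mul_assoc]
      exact mul_le_mul (hbC μ t ht) (abs_le_supAbs (S.continuousOn_φ μ) hx) (abs_nonneg _)
        (mul_nonneg hC (inv_nonneg.2 (S.ω_pos μ).le))
  refine (h1 (t, x) ⟨⟨hs₂t.le, ht.2⟩, hx⟩).mono_of_mem_nhdsWithin ?_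
  have : (Ioi s₂ ×ˢ (univ : Set ℝ)) ∈ 𝓝 (t, x) := prod_mem_nhds (Ioi_mem_nhds hs₂t) univ_mem
  refine mem_of_superset (inter_mem (mem_nhdsWithin_of_mem_nhds this) self_mem_nhdsWithin) ?_
  rintro z ⟨hz1, hz2⟩
  exact ⟨⟨(le_of_lt hz1.1), hz2.1.2⟩, hz2.2⟩

lemma summable_of_bound {c : A.Eig → ℝ} {C : ℝ} (hb : ∀ μ, |c μ| ≤ C * (S.ω μ)⁻¹) :
    Summable fun μ => |c μ| * supAbs (S.φ μ) := by
  refine (S.summable_inv_ω_mul.mul_left C).of_nonneg_of_le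
    (fun μ => mul_nonneg (abs_nonneg _) (supAbs_nonneg _)) fun μ => ?_
  rw [← mul_assoc]
  exact mul_le_mul_of_nonneg_right (hb μ) (supAbs_nonneg _)

/-- Solvability of the problem `w_t + A w = F` with homogeneous boundary conditions on the time
interval `(s, T]`. The equation is expressed by means of the resolvent. -/
theorem exists_solution_homogeneous {s T : ℝ} (hsT : s < T) {F : ℝ → ℝ → ℝ}
    (hF : ContinuousOn (fun z : ℝ × ℝ => F z.1 z.2) (Ioc s T ×ˢ Icc 0 1))
    {h₁ h₂ h₁' : A.Eig → ℝ → ℝ}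
    (hcoef : ∀ t ∈ Ioc s T, ∀ μ, S.coef (F t) μ = h₁ μ t + h₂ μ t)
    (hh₁ : ∀ μ, ContinuousOn (h₁ μ) (Ioc s T)) {M : ℝ} (hM : 0 ≤ M)
    (hb₁ : ∀ μ, ∀ t ∈ Ioc s T, |h₁ μ t| ≤ M)
    (hb₂ : ∀ μ, ∀ t ∈ Ioc s T, |h₂ μ t| ≤ M * (S.ω μ)⁻¹)
    (hd : ∀ μ, ∀ t ∈ Ioo s T, HasDerivAt (h₁ μ) (h₁' μ t) t)
    (hbd : ∀ s₁ ∈ Ioo s T, ∃ M', 0 ≤ M' ∧ ∀ μ, ∀ t ∈ Ioo s₁ T, |h₁' μ t| ≤ M')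
    {w₀ : ℝ → ℝ} (hw₀ : MemLp w₀ 2 A.wt) :
    ∃ w w' : ℝ → ℝ → ℝ,
      ContinuousOn (fun z : ℝ × ℝ => w z.1 z.2) (Ioc s T ×ˢ Icc 0 1) ∧
      ContinuousOn (fun z : ℝ × ℝ => w' z.1 z.2) (Ioc s T ×ˢ Icc 0 1) ∧
      (∀ t ∈ Ioo s T, ∀ x ∈ Icc (0 : ℝ) 1, HasDerivAt (fun t => w t x) (w' t x) t) ∧
      (∀ t ∈ Ioc s T, ∀ x ∈ Icc (0 : ℝ) 1,
        w t x = S.G.res (fun y => F t y - w' t y - S.G.κ * w t y) x) ∧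
      Tendsto (fun t => A.cls (w t)) (𝓝[Ioc s T] s) (𝓝 (A.cls w₀)) := by
  have hbh : ∀ μ, ∀ t ∈ Ioc s T, |S.coef (F t) μ| ≤ M + M := by
    intro μ t ht
    rw [hcoef t ht]
    refine (abs_add_le _ _).trans (add_le_add (hb₁ μ t ht) ((hb₂ μ t ht).trans ?_))
    exact mul_le_of_le_one_right hM (inv_le_one_of_one_le₀ (S.one_lt_ω μ).le)
  have hhc : ∀ μ, ContinuousOn (fun t => S.coef (F t) μ) (Ioc s T) := S.continuousOn_coef hF
  choose c hcs hcc hcd using fun μ : A.Eig =>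
    exists_mode (hhc μ) (hbh μ) μ (S.coef w₀ μ)
  let c' : A.Eig → ℝ → ℝ := fun μ t => -μ * c μ t + S.coef (F t) μ
  have hcc' : ∀ μ, ContinuousOn (c μ) (Ioc s T) := fun μ => (hcc μ).mono Ioc_subset_Icc_self
  have hc'c : ∀ μ, ContinuousOn (c' μ) (Ioc s T) := fun μ =>
    (continuousOn_const.mul (hcc' μ)).add (hhc μ)
  have hbound : ∀ s₂ ∈ Ioo s T, ∃ C, 0 ≤ C ∧ ∀ μ, ∀ t ∈ Icc s₂ T,
      |c μ t| ≤ C * (S.ω μ)⁻¹ ∧ |c' μ t| ≤ C * (S.ω μ)⁻¹ := by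
    intro s₂ hs₂
    -- Two waiting times: up to s₁ the initial coefficient decays to O(1/ω), and from s₁ to s₂ the
    -- corrected mode decays to O(1/ω²).
    obtain ⟨s₁, h01, h12⟩ := exists_between hs₂.1
    obtain ⟨M', hM', hbM'⟩ := hbd s₁ ⟨h01, h12.trans hs₂.2⟩
    obtain ⟨C, hC, hCb⟩ := exists_mode_bound (T := T) ‖A.cls w₀‖ M M' h01 h12 S.G.κ_nonpos
      (norm_nonneg _) hM hM'
    refine ⟨C, hC, fun μ t ht => ?_⟩
    have := hCb μ (c μ) (h₁ μ) (h₂ μ) (h₁' μ) (S.one_lt_ω μ).le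
      (by rw [hcs]; exact S.abs_coef_le hw₀ μ) (hcc μ) (hh₁ μ)
      (fun t ht => by
        have := hcd μ t ht
        rwa [hcoef t (Ioo_subset_Ioc_self ht)] at this) (hb₁ μ) (hb₂ μ)
      (fun t ht => hd μ t ⟨h01.trans ht.1, ht.2⟩) (hbM' μ) t ht
    rw [← hcoef t ⟨hs₂.1.trans_le ht.1, ht.2⟩] at this
    exact this
  have hmid : ∀ t ∈ Ioc s T, ∃ s₂ ∈ Ioo s T, s₂ < t := fun t ht =>
    (exists_between ht.1).imp fun s₂ h => ⟨⟨h.1, h.2.trans_le ht.2⟩, h.2⟩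
  have hpt : ∀ t ∈ Ioc s T, ∃ C, ∀ μ, |c μ t| ≤ C * (S.ω μ)⁻¹ ∧ |c' μ t| ≤ C * (S.ω μ)⁻¹ := by
    intro t ht
    obtain ⟨s₂, hs₂, hlt⟩ := hmid t ht
    obtain ⟨C, _, hCb⟩ := hbound s₂ hs₂
    exact ⟨C, fun μ => hCb μ t ⟨hlt.le, ht.2⟩⟩
  let w : ℝ → ℝ → ℝ := fun t x => ∑' μ, c μ t * S.φ μ x
  let w' : ℝ → ℝ → ℝ := fun t x => ∑' μ, c' μ t * S.φ μ x
  have hw : ContinuousOn (fun z : ℝ × ℝ => w z.1 z.2) (Ioc s T ×ˢ Icc 0 1) :=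
    S.continuousOn_series hcc' fun s₂ hs₂ => by
      obtain ⟨C, hC, h⟩ := hbound s₂ hs₂
      exact ⟨C, hC, fun μ t ht => (h μ t ht).1⟩
  have hw' : ContinuousOn (fun z : ℝ × ℝ => w' z.1 z.2) (Ioc s T ×ˢ Icc 0 1) :=
    S.continuousOn_series hc'c fun s₂ hs₂ => by
      obtain ⟨C, hC, h⟩ := hbound s₂ hs₂
      exact ⟨C, hC, fun μ t ht => (h μ t ht).2⟩
  have hwc : ∀ t ∈ Ioc s T, ∀ μ, S.coef (w t) μ = c μ t := fun t ht μ => by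
    obtain ⟨C, hC⟩ := hpt t ht
    exact S.coef_tsum (S.summable_of_bound fun μ => (hC μ).1) μ
  have hw'c : ∀ t ∈ Ioc s T, ∀ μ, S.coef (w' t) μ = c' μ t := fun t ht μ => by
    obtain ⟨C, hC⟩ := hpt t ht
    exact S.coef_tsum (S.summable_of_bound fun μ => (hC μ).2) μ
  refine ⟨w, w', hw, hw', fun t ht x hx => ?_, fun t ht => ?_, ?_⟩
  · obtain ⟨s₂, hs₂, hlt⟩ := hmid t (Ioo_subset_Ioc_self ht)
    obtain ⟨C, hC, hCb⟩ := hbound s₂ hs₂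
    have hmem : t ∈ Ioo s₂ T := ⟨hlt, ht.2⟩
    refine hasDerivAt_tsum_of_isPreconnected (g := fun μ t => c μ t * S.φ μ x)
      (g' := fun μ t => c' μ t * S.φ μ x) (S.summable_inv_ω_mul.mul_left C) isOpen_Ioo
      isPreconnected_Ioo (fun μ y hy => ?_) (fun μ y hy => ?_) hmem ?_ hmem
    · exact (hcd μ y ⟨hs₂.1.trans hy.1, hy.2⟩).mul_const _
    · rw [norm_mul, ← mul_assoc]
      exact mul_le_mul (hCb μ y (Ioo_subset_Icc_self hy)).2
        (abs_le_supAbs (S.continuousOn_φ μ) hx) (abs_nonneg _)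
        (mul_nonneg hC (inv_nonneg.2 (S.ω_pos μ).le))
    · refine Summable.of_norm_bounded
        (S.summable_of_bound fun μ => (hCb μ t (Ioo_subset_Icc_self hmem)).1) fun μ => ?_
      rw [norm_mul]
      exact mul_le_mul_of_nonneg_left (abs_le_supAbs (S.continuousOn_φ μ) hx) (abs_nonneg _)
  -- Both sides are continuous in x, so it is enough to compare coefficients, where the claim reads
  -- c = ω⁻¹(F̂ − c' − κ c), F̂ denoting the coefficient of F. This is the mode equation.
  · have cF := continuousOn_slice hF ht
    have cw := continuousOn_slice hw ht
    have cw' := continuousOn_slice hw' ht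
    have cg : ContinuousOn (fun y => F t y - w' t y - S.G.κ * w t y) (Icc 0 1) :=
      (cF.sub cw').sub (continuousOn_const.mul cw)
    refine S.eqOn_of_coef cw (S.G.continuousOn_res cg) fun μ => ?_
    rw [S.coef_res cg, hwc t ht]
    have e1 : S.coef (fun y => F t y - w' t y - S.G.κ * w t y) μ =
        S.coef (F t) μ - c' μ t - S.G.κ * c μ t := by
      rw [← hwc t ht μ, ← hw'c t ht μ]
      have h1 := S.coef_sub (memLp_wt cF) (memLp_wt cw') μ
      have h2 := S.coef_combo ((memLp_wt cF).sub (memLp_wt cw')) (memLp_wt cw) 1 (-S.G.κ) μ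
      rw [h1] at h2
      rw [show (fun y => F t y - w' t y - S.G.κ * w t y) =
        fun x => 1 * (F t - w' t) x + -S.G.κ * w t x by ext y; simp; ring, h2]
      ring
    rw [e1, eq_inv_mul_iff_mul_eq₀ (S.ω_pos μ).ne']
    simp only [c', ω]
    ring
  -- As w₀ is only in L²_r, uniform convergence is lost at s. Parseval turns the L²_r distance into
  -- ∑ (c(t) − c(s))², dominated by a summable multiple of |c(s)|² plus a multiple of ω⁻².
  · set R := Real.exp (-S.G.κ * (T - s))
    have hR : 0 < R := Real.exp_pos _
    have hsumM : Summable fun μ : A.Eig => 2 * ((R + 1) ^ 2 * S.coef w₀ μ ^ 2) +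
        2 * ((R * (M + M)) ^ 2 * ((S.ω μ)⁻¹) ^ 2) :=
      (((S.hasSum_coef_sq hw₀).summable.mul_left _).mul_left _).add
        ((S.summable_inv_ω_sq.mul_left _).mul_left _)
    have hlim : Tendsto (fun t => ∑' μ, (c μ t - S.coef w₀ μ) ^ 2) (𝓝[Ioc s T] s)
        (𝓝 (∑' _ : A.Eig, (0 : ℝ))) := by
      refine tendsto_tsum_of_dominated_convergence hsumM (fun μ => ?_) ?_
      · have h1 : Tendsto (c μ) (𝓝[Ioc s T] s) (𝓝 (c μ s)) :=
          ((hcc μ) s (left_mem_Icc.2 hsT.le)).mono_left (nhdsWithin_mono _ Ioc_subset_Icc_self)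
        have := (h1.sub_const (S.coef w₀ μ)).pow 2
        rwa [hcs, sub_self, zero_pow two_ne_zero] at this
      · filter_upwards [self_mem_nhdsWithin] with t ht μ
        have h1 := abs_le_of_mode (M := M + M) S.G.κ_nonpos (S.ω_pos μ) (by positivity) (hcc μ)
          (hcd μ) (fun t ht => hbh μ t (Ioo_subset_Ioc_self ht)) (Ioc_subset_Icc_self ht)
        rw [hcs] at h1
        have h2 : |c μ t| ≤ R * (|S.coef w₀ μ| + (M + M) * (S.ω μ)⁻¹) := by
          refine h1.trans (mul_le_mul (Real.exp_le_exp.2 ?_) ?_ ?_ hR.le)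
          · exact mul_le_mul_of_nonneg_left (by linarith [ht.2])
              (by linarith [S.G.κ_nonpos])
          · refine add_le_add (mul_le_of_le_one_left (abs_nonneg _) ?_) le_rfl
            rw [Real.exp_le_one_iff]
            have := S.ω_pos μ
            unfold ω at this
            nlinarith [ht.1]
          · have := S.ω_pos μ
            unfold ω at this
            positivity
        have h3 : |c μ t - S.coef w₀ μ| ≤ (R + 1) * |S.coef w₀ μ| +
            R * (M + M) * (S.ω μ)⁻¹ := by
          refine (abs_sub _ _).trans ?_
          linarith
        rw [Real.norm_eq_abs, abs_pow]
        refine (pow_le_pow_left₀ (abs_nonneg _) h3 2).trans ?_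
        rw [← sq_abs (S.coef w₀ μ)]
        nlinarith [sq_nonneg ((R + 1) * |S.coef w₀ μ| - R * (M + M) * (S.ω μ)⁻¹)]
    rw [tsum_zero] at hlim
    rw [tendsto_iff_norm_sub_tendsto_zero]
    have hsq : Tendsto (fun t => ‖A.cls (w t) - A.cls w₀‖ ^ 2) (𝓝[Ioc s T] s) (𝓝 0) := by
      refine hlim.congr' ?_
      filter_upwards [self_mem_nhdsWithin] with t ht
      have hm := memLp_wt (A := A) (continuousOn_slice hw ht)
      rw [← cls_sub hm hw₀, ← (S.hasSum_coef_sq (hm.sub hw₀)).tsum_eq]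
      refine tsum_congr fun μ => ?_
      rw [S.coef_sub hm hw₀, hwc t ht]
    have := hsq.sqrt
    simpa using this

end Spectral

end SLData

/-! ### Joint regularity and extension of the data to the final time -/

/-- A function on `O × [0,1]`, `O` open, with continuous partial derivatives is `C¹`. -/
lemma contDiffOn_one_of_partials {u ut ux : ℝ → ℝ → ℝ} {O : Set ℝ} (hO : IsOpen O)
    (ht : ∀ t ∈ O, ∀ x ∈ Icc (0 : ℝ) 1, HasDerivAt (fun s => u s x) (ut t x) t)
    (hx : ∀ t ∈ O, ∀ x ∈ Icc (0 : ℝ) 1, HasDerivWithinAt (u t) (ux t x) (Icc 0 1) x)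
    (hut : ContinuousOn (fun z : ℝ × ℝ => ut z.1 z.2) (O ×ˢ Icc 0 1))
    (hux : ContinuousOn (fun z : ℝ × ℝ => ux z.1 z.2) (O ×ˢ Icc 0 1)) :
    ContDiffOn ℝ 1 (fun z : ℝ × ℝ => u z.1 z.2) (O ×ˢ Icc 0 1) := by
  have hU : UniqueDiffOn ℝ (O ×ˢ Icc (0 : ℝ) 1) :=
    hO.uniqueDiffOn.prod (uniqueDiffOn_Icc zero_lt_one)
  let D : ℝ × ℝ → (ℝ × ℝ →L[ℝ] ℝ) := fun z =>
    ut z.1 z.2 • ContinuousLinearMap.fst ℝ ℝ ℝ + ux z.1 z.2 • ContinuousLinearMap.snd ℝ ℝ ℝ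
  have hD : ∀ z ∈ O ×ˢ Icc (0 : ℝ) 1,
      HasFDerivWithinAt (fun z : ℝ × ℝ => u z.1 z.2) (D z) (O ×ˢ Icc (0 : ℝ) 1) z := by
    rintro ⟨t, x⟩ ⟨htO, hxI⟩
    simp only at htO hxI
    rw [hasFDerivWithinAt_iff_isLittleO, Asymptotics.isLittleO_iff]
    intro ε hε
    have hε2 : 0 < ε / 2 := by positivity
    have h1 := (hasDerivWithinAt_iff_isLittleO.1 (hx t htO x hxI))
    rw [Asymptotics.isLittleO_iff] at h1
    obtain ⟨δ₁, hδ₁, H₁⟩ := Metric.mem_nhdsWithin_iff.1 (h1 hε2)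
    obtain ⟨δ₂, hδ₂, H₂⟩ := Metric.continuousWithinAt_iff.1 (hut (t, x) ⟨htO, hxI⟩) (ε / 2) hε2
    obtain ⟨δ₃, hδ₃, H₃⟩ := Metric.isOpen_iff.1 hO t htO
    refine Metric.mem_nhdsWithin_iff.2 ⟨min δ₁ (min δ₂ δ₃), by positivity, ?_⟩
    rintro ⟨t', x'⟩ ⟨hb, ht'O, hx'I⟩
    rw [Metric.mem_ball, Prod.dist_eq, max_lt_iff] at hb
    simp only [lt_min_iff] at hb
    obtain ⟨⟨a1, a2, a3⟩, b1, b2, b3⟩ := hb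
    -- The increment is taken through (t, x'): in x at the fixed time t by definition of the
    -- derivative, then in t at the fixed point x' by the mean value inequality. The second step
    -- needs joint continuity of ut, as x' varies.
    have e1 : |u t x' - u t x - (x' - x) * ux t x| ≤ ε / 2 * |x' - x| := by
      have := H₁ ⟨b1, hx'I⟩
      simpa [smul_eq_mul] using this
    have e2 : |u t' x' - u t x' - (t' - t) * ut t x| ≤ ε / 2 * |t' - t| := by
      have hconv : Convex ℝ (Metric.ball t (min δ₂ δ₃)) := convex_ball _ _
      have := hconv.norm_image_sub_le_of_norm_hasDerivWithin_le
        (f := fun s => u s x' - s * ut t x) (f' := fun s => ut s x' - ut t x) (C := ε / 2)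
        (x := t) (y := t') (fun s hs => ?_) (fun s hs => ?_)
        (Metric.mem_ball_self (by positivity)) (by simp [Metric.mem_ball, a2, a3])
      · simp only [Real.norm_eq_abs] at this
        refine le_trans (le_of_eq ?_) this
        congr 1; ring
      · have hs' : s ∈ O := H₃ (Metric.ball_subset_ball (min_le_right _ _) hs)
        have := (ht s hs' x' hx'I).sub ((hasDerivAt_id s).mul_const (ut t x))
        simp only [one_mul] at this
        exact this.hasDerivWithinAt
      · have hs' : s ∈ O := H₃ (Metric.ball_subset_ball (min_le_right _ _) hs)
        have hs2 : dist s t < δ₂ := (Metric.mem_ball.1 hs).trans_le (min_le_left _ _)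
        have := H₂ (x := (s, x')) ⟨hs', hx'I⟩ (by
          rw [Prod.dist_eq]; exact max_lt hs2 b2)
        exact (le_of_lt this)
    have n1 : |t' - t| ≤ ‖((t', x') : ℝ × ℝ) - (t, x)‖ :=
      norm_fst_le (((t', x') : ℝ × ℝ) - (t, x))
    have n2 : |x' - x| ≤ ‖((t', x') : ℝ × ℝ) - (t, x)‖ :=
      norm_snd_le (((t', x') : ℝ × ℝ) - (t, x))
    have e3 : u t' x' - u t x - D (t, x) ((t', x') - (t, x)) =
        (u t' x' - u t x' - (t' - t) * ut t x) + (u t x' - u t x - (x' - x) * ux t x) := by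
      simp [D]
      ring
    change ‖u t' x' - u t x - D (t, x) ((t', x') - (t, x))‖ ≤ _
    rw [e3]
    refine (abs_add_le _ _).trans ((add_le_add e2 e1).trans ?_)
    nlinarith
  rw [show (1 : WithTop ℕ∞) = 0 + 1 from (zero_add 1).symm, contDiffOn_succ_iff_fderivWithin hU]
  refine ⟨fun z hz => (hD z hz).differentiableWithinAt, by simp, ?_⟩
  rw [contDiffOn_zero]
  have hDc : ContinuousOn D (O ×ˢ Icc (0 : ℝ) 1) :=
    (hut.smul continuousOn_const).add (hux.smul continuousOn_const)
  exact hDc.congr fun z hz => (hD z hz).fderivWithin (hU z hz)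

/-- Extension of `g` to the final time `T` by `gT`. -/
def extT (T : ℝ) (g : ℝ → ℝ → ℝ) (gT : ℝ → ℝ) (t x : ℝ) : ℝ := if t < T then g t x else gT x

lemma extT_of_lt {T t : ℝ} (g : ℝ → ℝ → ℝ) (gT : ℝ → ℝ) (h : t < T) : extT T g gT t = g t := by
  ext x; simp [extT, h]

lemma extT_self (T : ℝ) (g : ℝ → ℝ → ℝ) (gT : ℝ → ℝ) : extT T g gT T = gT := by
  ext x; simp [extT]

lemma continuousOn_extT {g : ℝ → ℝ → ℝ} {gT : ℝ → ℝ} {s T : ℝ}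
    (hg : ContinuousOn (fun z : ℝ × ℝ => g z.1 z.2) (Ioo s T ×ˢ Icc 0 1))
    (hgT : ContinuousOn gT (Icc 0 1))
    (hlim : ∀ x ∈ Icc (0 : ℝ) 1, Tendsto (fun z : ℝ × ℝ => g z.1 z.2)
      (𝓝[Ioo s T ×ˢ Icc 0 1] (T, x)) (𝓝 (gT x))) :
    ContinuousOn (fun z : ℝ × ℝ => extT T g gT z.1 z.2) (Ioc s T ×ˢ Icc 0 1) := by
  rintro ⟨t, x⟩ ⟨ht, hx⟩
  simp only at ht hx
  rcases eq_or_lt_of_le ht.2 with rfl | hlt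
  · have hset : Ioc s t ×ˢ Icc (0 : ℝ) 1 ⊆ (Ioo s t ×ˢ Icc (0 : ℝ) 1) ∪ ({t} ×ˢ Icc (0 : ℝ) 1) := by
      rintro ⟨a, b⟩ ⟨ha, hb⟩
      rcases eq_or_lt_of_le ha.2 with h | h
      · exact Or.inr ⟨h, hb⟩
      · exact Or.inl ⟨⟨ha.1, h⟩, hb⟩
    refine ContinuousWithinAt.mono (ContinuousWithinAt.union ?_ ?_) hset
    · refine Tendsto.congr' ?_ (by simpa [extT] using hlim x hx)
      filter_upwards [self_mem_nhdsWithin] with z hz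
      rw [extT_of_lt _ _ hz.1.2]
    · have h1 : ContinuousWithinAt (fun z : ℝ × ℝ => gT z.2) ({t} ×ˢ Icc (0 : ℝ) 1) (t, x) :=
        (hgT.comp continuousOn_snd fun z hz => hz.2) (t, x) ⟨rfl, hx⟩
      refine h1.congr (fun z hz => ?_) (by simp [extT])
      have : z.1 = t := hz.1
      simp [extT, this]
  · have h1 := hg (t, x) ⟨⟨ht.1, hlt⟩, hx⟩
    have h2 : ContinuousWithinAt (fun z : ℝ × ℝ => g z.1 z.2) (Ioc s T ×ˢ Icc 0 1) (t, x) := by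
      refine h1.mono_of_mem_nhdsWithin ?_
      have : (Iio T ×ˢ (univ : Set ℝ)) ∈ 𝓝 (t, x) := prod_mem_nhds (Iio_mem_nhds hlt) univ_mem
      refine mem_of_superset (inter_mem (mem_nhdsWithin_of_mem_nhds this) self_mem_nhdsWithin) ?_
      rintro z ⟨hz1, hz2⟩
      exact ⟨⟨hz2.1.1, hz1.1⟩, hz2.2⟩
    refine h2.congr_of_eventuallyEq ?_ (by rw [extT_of_lt _ _ hlt])
    have : (Iio T ×ˢ (univ : Set ℝ)) ∈ 𝓝 (t, x) := prod_mem_nhds (Iio_mem_nhds hlt) univ_mem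
    filter_upwards [mem_nhdsWithin_of_mem_nhds this] with z hz
    rw [extT_of_lt _ _ hz.1]

lemma tendsto_fst_left (s T x : ℝ) :
    Tendsto (fun z : ℝ × ℝ => z.1) (𝓝[Ioo s T ×ˢ Icc 0 1] (T, x)) (𝓝[<] T) := by
  refine tendsto_nhdsWithin_iff.2 ⟨(continuous_fst.tendsto (T, x)).mono_left nhdsWithin_le_nhds, ?_⟩
  filter_upwards [self_mem_nhdsWithin] with z hz
  exact hz.1.2

lemma tendsto_snd_unit (s T x : ℝ) :
    Tendsto (fun z : ℝ × ℝ => z.2) (𝓝[Ioo s T ×ˢ Icc 0 1] (T, x)) (𝓝[Icc 0 1] x) := by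
  refine tendsto_nhdsWithin_iff.2 ⟨(continuous_snd.tendsto (T, x)).mono_left nhdsWithin_le_nhds, ?_⟩
  filter_upwards [self_mem_nhdsWithin] with z hz
  exact hz.2

/-- Uniform left limits give joint limits. -/
lemma tendsto_joint_of_uniform {g : ℝ → ℝ → ℝ} {gT : ℝ → ℝ} {s T : ℝ}
    (hgT : ContinuousOn gT (Icc 0 1)) (h : TendstoUniformlyOn g gT (𝓝[<] T) (Icc 0 1)) {x : ℝ}
    (hx : x ∈ Icc (0 : ℝ) 1) : Tendsto (fun z : ℝ × ℝ => g z.1 z.2)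
      (𝓝[Ioo s T ×ˢ Icc 0 1] (T, x)) (𝓝 (gT x)) := by
  rw [Metric.tendsto_nhds]
  intro ε hε
  have h1 := (tendsto_fst_left s T x).eventually
    (Metric.tendstoUniformlyOn_iff.1 h (ε / 2) (by positivity))
  have h2 := (tendsto_snd_unit s T x).eventually
    (Metric.tendsto_nhds.1 (hgT x hx) (ε / 2) (by positivity))
  filter_upwards [h1, h2, self_mem_nhdsWithin] with z hz1 hz2 hz
  have := hz1 z.2 hz.2
  rw [dist_comm] at this
  linarith [dist_triangle (g z.1 z.2) (gT z.2) (gT x)]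

/-- If `∂g/∂t` is bounded near `T`, the pointwise left limits of `g` are uniform. -/
lemma tendstoUniformlyOn_of_deriv_bound {g : ℝ → ℝ → ℝ} {gT : ℝ → ℝ} {s T B : ℝ}
    (hs : s < T)
    (hd : ∀ t ∈ Ioo s T, ∀ x ∈ Icc (0 : ℝ) 1, DifferentiableAt ℝ (fun s' => g s' x) t)
    (hb : ∀ t ∈ Ioo s T, ∀ x ∈ Icc (0 : ℝ) 1, |deriv (fun s' => g s' x) t| ≤ B)
    (hlim : ∀ x ∈ Icc (0 : ℝ) 1, Tendsto (fun t => g t x) (𝓝[<] T) (𝓝 (gT x))) :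
    TendstoUniformlyOn g gT (𝓝[<] T) (Icc 0 1) := by
  have key : ∀ t ∈ Ioo s T, ∀ x ∈ Icc (0 : ℝ) 1, |gT x - g t x| ≤ B * (T - t) := by
    intro t ht x hx
    have h1 : Tendsto (fun t' => |g t' x - g t x|) (𝓝[<] T) (𝓝 |gT x - g t x|) :=
      ((hlim x hx).sub_const _).abs
    have h2 : Tendsto (fun t' => B * (t' - t)) (𝓝[<] T) (𝓝 (B * (T - t))) := by
      refine Tendsto.mono_left ?_ nhdsWithin_le_nhds
      exact (Continuous.tendsto (by fun_prop) T)
    refine le_of_tendsto_of_tendsto h1 h2 ?_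
    filter_upwards [Ioo_mem_nhdsLT ht.2] with t' ht'
    have := (convex_Ioo s T).norm_image_sub_le_of_norm_deriv_le (f := fun s' => g s' x) (C := B)
      (fun τ hτ => hd τ hτ x hx) (fun τ hτ => hb τ hτ x hx) ht ⟨ht.1.trans ht'.1, ht'.2⟩
    simpa [Real.norm_eq_abs, abs_of_pos (sub_pos.2 ht'.1)] using this
  rw [Metric.tendstoUniformlyOn_iff]
  intro ε hε
  have h3 : Tendsto (fun t => B * (T - t)) (𝓝[<] T) (𝓝 0) := by
    refine Tendsto.mono_left ?_ nhdsWithin_le_nhds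
    have : Continuous fun t => B * (T - t) := by fun_prop
    simpa using this.tendsto T
  filter_upwards [h3.eventually_lt_const hε, Ioo_mem_nhdsLT hs] with t ht ht' x hx
  rw [Real.dist_eq]
  exact (key t ht' x hx).trans_lt ht

/-- A function continuous on `(s, T)` with a left limit at `T` extends continuously to `(s, T]`. -/
lemma continuousOn_update {d : ℝ → ℝ} {s T L : ℝ} (hd : ContinuousOn d (Ioo s T))
    (hL : Tendsto d (𝓝[<] T) (𝓝 L)) : ContinuousOn (Function.update d T L) (Ioc s T) := by
  intro t ht
  rcases eq_or_lt_of_le ht.2 with rfl | hlt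
  · refine continuousWithinAt_update_same.2 (hL.mono_left (nhdsWithin_mono _ ?_))
    rintro y ⟨hy, hne⟩
    exact lt_of_le_of_ne hy.2 hne
  · have h1 : ContinuousAt d t := hd.continuousAt (Ioo_mem_nhds ht.1 hlt)
    refine (h1.congr ?_).continuousWithinAt
    filter_upwards [Iio_mem_nhds hlt] with y hy
    rw [Function.update_of_ne (ne_of_lt hy)]

namespace SLData

variable {A : SLData}

lemma exists_bound_of_continuousOn_prod {g : ℝ → ℝ → ℝ} {a b : ℝ}
    (hg : ContinuousOn (fun z : ℝ × ℝ => g z.1 z.2) (Icc a b ×ˢ Icc 0 1)) :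
    ∃ C, 0 < C ∧ ∀ t ∈ Icc a b, ∀ x ∈ Icc (0 : ℝ) 1, |g t x| ≤ C := by
  obtain ⟨C, hC⟩ := (isCompact_Icc.prod isCompact_Icc).exists_bound_of_continuousOn hg
  exact ⟨max C 1, by positivity, fun t ht x hx => (hC (t, x) ⟨ht, hx⟩).trans (le_max_left _ _)⟩

/-- Differentiation of the coefficients with respect to time. -/
lemma Spectral.hasDerivAt_coef (S : A.Spectral) {g g' : ℝ → ℝ → ℝ} {s T : ℝ}
    (hg : ContinuousOn (fun z : ℝ × ℝ => g z.1 z.2) (Ioo s T ×ˢ Icc 0 1))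
    (hg' : ContinuousOn (fun z : ℝ × ℝ => g' z.1 z.2) (Ioo s T ×ˢ Icc 0 1))
    (hd : ∀ t ∈ Ioo s T, ∀ x ∈ Icc (0 : ℝ) 1, HasDerivAt (fun t => g t x) (g' t x) t)
    (μ : A.Eig) {t : ℝ} (ht : t ∈ Ioo s T) :
    HasDerivAt (fun t => S.coef (g t) μ) (S.coef (g' t) μ) t := by
  obtain ⟨a, ha1, ha2⟩ := exists_between ht.1
  obtain ⟨b, hb1, hb2⟩ := exists_between ht.2
  have hsub : Icc a b ⊆ Ioo s T := fun x hx => ⟨ha1.trans_le hx.1, hx.2.trans_lt hb2⟩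
  obtain ⟨C, hC, hbC⟩ := exists_bound_of_continuousOn_prod
    (hg'.mono (prod_mono hsub (Subset.refl _)))
  obtain ⟨C', hC', hbC'⟩ := exists_abs_le_of_continuousOn (S.continuousOn_φ μ)
  have hmul : ∀ {f : ℝ → ℝ}, ContinuousOn f (Icc 0 1) →
      ContinuousOn (fun x => f x * S.φ μ x) (Icc 0 1) := fun hf => hf.mul (S.continuousOn_φ μ)
  refine (hasDerivAt_integral_of_dominated_loc_of_deriv_le (μ := A.wt)
    (F := fun t x => g t x * S.φ μ x) (F' := fun t x => g' t x * S.φ μ x)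
    (bound := fun _ => C * C') (Ioo_mem_nhds ha2 hb1) ?_ ?_ ?_ ?_ (integrable_const _) ?_).2
  · filter_upwards [Ioo_mem_nhds ht.1 ht.2] with τ hτ
    exact aestronglyMeasurable_wt (hmul (continuousOn_slice hg hτ))
  · exact integrable_wt (hmul (continuousOn_slice hg ht))
  · exact aestronglyMeasurable_wt (hmul (continuousOn_slice hg' ht))
  · filter_upwards [A.ae_wt_mem] with x hx τ hτ
    rw [norm_mul]
    exact mul_le_mul (hbC τ (Ioo_subset_Icc_self hτ) x hx) (hbC' x hx) (abs_nonneg _) hC.le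
  · filter_upwards [A.ae_wt_mem] with x hx τ hτ
    exact (hd τ (hsub (Ioo_subset_Icc_self hτ)) x hx).mul_const _

/-- Joint continuity of the flux of the resolvent. -/
lemma Green.continuousOn_resFlux_joint (G : A.Green) {g : ℝ → ℝ → ℝ} {J : Set ℝ}
    (hg : ContinuousOn (fun z : ℝ × ℝ => g z.1 z.2) (J ×ˢ Icc 0 1)) :
    ContinuousOn (fun z : ℝ × ℝ => G.resFlux (g z.1) z.2) (J ×ˢ Icc 0 1) := by
  have key : ∀ k : ℝ → ℝ, ContinuousOn k (Icc 0 1) →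
      ContinuousOn (fun z : ℝ × ℝ => ∫ y in (0 : ℝ)..z.2, k y * (A.r y * g z.1 y))
        (J ×ˢ Icc 0 1) := by
    intro k hk
    rw [continuousOn_iff_continuous_domRestrict]
    -- The integrand is extended by constants beyond [0,1], so that continuity of integrals with a
    -- parameter applies with y ranging over the whole line.
    have hc : Continuous (Function.uncurry fun (z : ↥(J ×ˢ Icc (0 : ℝ) 1)) (y : ℝ) =>
        k (Green.unitProj y) * (A.r (Green.unitProj y) * g z.1.1 (Green.unitProj y))) := by
      refine Continuous.mul ?_ (Continuous.mul ?_ ?_)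
      · exact (Green.continuous_comp_unitProj hk).comp continuous_snd
      · exact (Green.continuous_comp_unitProj A.r_cont).comp continuous_snd
      · refine hg.comp_continuous (f := fun q : ↥(J ×ˢ Icc (0 : ℝ) 1) × ℝ =>
          (q.1.1.1, Green.unitProj q.2)) ?_ fun q => ⟨q.1.2.1, Green.unitProj_mem _⟩
        exact (by fun_prop : Continuous fun q : ↥(J ×ˢ Icc (0 : ℝ) 1) × ℝ => q.1.1.1).prodMk
          (Green.continuous_unitProj.comp continuous_snd)
    have h1 := intervalIntegral.continuous_parametric_intervalIntegral_of_continuous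
      (μ := volume) (a₀ := 0) hc (s := fun z : ↥(J ×ˢ Icc (0 : ℝ) 1) => z.1.2) (by fun_prop)
    refine h1.congr fun z => ?_
    refine intervalIntegral.integral_congr fun y hy => ?_
    rw [uIcc_of_le z.2.2.1] at hy
    simp only [Green.unitProj_of_mem (⟨hy.1, hy.2.trans z.2.2.2⟩ : y ∈ Icc (0 : ℝ) 1)]
  have key2 : ContinuousOn (fun z : ℝ × ℝ => ∫ y in z.2..(1 : ℝ), G.y₂ y * (A.r y * g z.1 y))
      (J ×ˢ Icc 0 1) := by
    have h1 := key G.y₂ G.continuousOn_y₂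
    have h2 : ContinuousOn (fun z : ℝ × ℝ => ∫ y in (0 : ℝ)..1, G.y₂ y * (A.r y * g z.1 y))
        (J ×ˢ Icc 0 1) :=
      h1.comp (f := fun z : ℝ × ℝ => (z.1, (1 : ℝ))) (by fun_prop)
        fun z hz => ⟨hz.1, right_mem_Icc.2 zero_le_one⟩
    refine (h2.sub h1).congr fun z hz => ?_
    have hc : ContinuousOn (fun y => G.y₂ y * (A.r y * g z.1 y)) (Icc 0 1) :=
      G.continuousOn_y₂.mul (A.r_cont.mul (continuousOn_slice hg hz.1))
    have := intervalIntegral.integral_add_adjacent_intervals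
      (intervalIntegrable_of_continuousOn hc (left_mem_Icc.2 zero_le_one) hz.2)
      (intervalIntegrable_of_continuousOn hc hz.2 (right_mem_Icc.2 zero_le_one))
    exact eq_sub_of_add_eq' this
  have c : ∀ k : ℝ → ℝ, ContinuousOn k (Icc 0 1) →
      ContinuousOn (fun z : ℝ × ℝ => k z.2) (J ×ˢ Icc (0 : ℝ) 1) := fun k hk =>
    hk.comp continuousOn_snd fun z hz => hz.2
  exact continuousOn_const.mul (((c _ G.continuousOn_z₂).mul (key _ G.continuousOn_y₁)).add
    ((c _ G.continuousOn_z₁).mul key2))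

end SLData

/-- The requirements of the class `GB` on one time interval. -/
structure BdryOn (s T : ℝ) (d : ℝ → ℝ) : Prop where
  right_cont : ContinuousWithinAt d (Ici s) s
  contDiff : ContDiffOn ℝ 2 d (Ioo s T)
  lim : ∃ L, Tendsto d (𝓝[<] T) (𝓝 L)
  lim_deriv : ∃ L, Tendsto (deriv d) (𝓝[<] T) (𝓝 L)
  lim_deriv_deriv : ∃ L, Tendsto (deriv (deriv d)) (𝓝[<] T) (𝓝 L)
  bdd : ∃ M : ℝ, ∀ t ∈ Ioo s T, |deriv d t| ≤ M

/-- A boundary datum on `[s, T)` extends to `[s, T]` with its derivative. -/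
lemma BdryOn.exists_extension {s T : ℝ} {d : ℝ → ℝ} (hd : BdryOn s T d) (hsT : s < T) :
    ∃ (D D' D'' : ℝ → ℝ) (M : ℝ), 0 ≤ M ∧ (∀ t, t ≠ T → D t = d t) ∧ ContinuousOn D (Icc s T) ∧
      ContinuousOn D' (Ioc s T) ∧ (∀ t ∈ Ioo s T, HasDerivAt D (D' t) t) ∧
      (∀ t ∈ Ioo s T, HasDerivAt D' (D'' t) t) ∧ (∀ t ∈ Ioc s T, |D t| ≤ M) ∧
      (∀ t ∈ Ioc s T, |D' t| ≤ M) ∧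
      ∀ s₁ ∈ Ioo s T, ∃ M', 0 ≤ M' ∧ ∀ t ∈ Ioo s₁ T, |D'' t| ≤ M' := by
  obtain ⟨L, hL⟩ := hd.lim
  obtain ⟨L', hL'⟩ := hd.lim_deriv
  obtain ⟨L'', hL''⟩ := hd.lim_deriv_deriv
  obtain ⟨M, hM⟩ := hd.bdd
  have h1 : ContDiffOn ℝ 1 (deriv d) (Ioo s T) :=
    hd.contDiff.deriv_of_isOpen isOpen_Ioo (by norm_num)
  have h2 : ContinuousOn (deriv (deriv d)) (Ioo s T) :=
    h1.continuousOn_deriv_of_isOpen isOpen_Ioo le_rfl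
  have e1 : ∀ t ∈ Ioo s T, HasDerivAt d (deriv d t) t := fun t ht =>
    ((hd.contDiff.differentiableOn two_ne_zero).differentiableAt
      (Ioo_mem_nhds ht.1 ht.2)).hasDerivAt
  have e2 : ∀ t ∈ Ioo s T, HasDerivAt (deriv d) (deriv (deriv d) t) t := fun t ht =>
    ((h1.differentiableOn one_ne_zero).differentiableAt (Ioo_mem_nhds ht.1 ht.2)).hasDerivAt
  have hloc : ∀ (g : ℝ → ℝ) (ℓ t : ℝ), t < T → Function.update g T ℓ =ᶠ[𝓝 t] g :=
    fun g ℓ t ht => by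
      filter_upwards [Iio_mem_nhds ht] with y hy
      rw [Function.update_of_ne (ne_of_lt hy)]
  have hDc : ContinuousOn (Function.update d T L) (Icc s T) := by
    have hc := continuousOn_update hd.contDiff.continuousOn hL
    intro t ht
    rcases eq_or_lt_of_le ht.1 with rfl | hlt
    · have : ContinuousWithinAt d (Icc s T) s := hd.right_cont.mono Icc_subset_Ici_self
      refine this.congr_of_eventuallyEq ((hloc d L s hsT).filter_mono nhdsWithin_le_nhds) ?_
      rw [Function.update_of_ne hsT.ne]
    · refine (hc t ⟨hlt, ht.2⟩).mono_of_mem_nhdsWithin ?_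
      filter_upwards [mem_nhdsWithin_of_mem_nhds (Ioi_mem_nhds hlt), self_mem_nhdsWithin]
        with y hy hy'
      exact ⟨hy, hy'.2⟩
  obtain ⟨M₂, hM₂, hbM₂⟩ := exists_abs_le_of_continuousOn hDc
  have hD'b : ∀ t ∈ Ioc s T, |Function.update (deriv d) T L' t| ≤ max (max M |L'|) M₂ := by
    intro t ht
    rcases eq_or_lt_of_le ht.2 with rfl | hlt
    · rw [Function.update_self]
      exact (le_max_right _ _).trans (le_max_left _ _)
    · rw [Function.update_of_ne hlt.ne]
      exact (hM t ⟨ht.1, hlt⟩).trans ((le_max_left _ _).trans (le_max_left _ _))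
  refine ⟨Function.update d T L, Function.update (deriv d) T L', deriv (deriv d),
    max (max M |L'|) M₂, le_max_of_le_right hM₂.le, fun t ht => Function.update_of_ne ht _ _, hDc,
    continuousOn_update h1.continuousOn hL', fun t ht => ?_, fun t ht => ?_,
    fun t ht => (hbM₂ t (Ioc_subset_Icc_self ht)).trans (le_max_right _ _), hD'b, fun s₁ hs₁ => ?_⟩
  · rw [Function.update_of_ne ht.2.ne]
    exact (e1 t ht).congr_of_eventuallyEq (hloc _ _ _ ht.2)
  · exact (e2 t ht).congr_of_eventuallyEq (hloc _ _ _ ht.2)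
  -- The second derivative has a limit at T but may be unbounded near s, so it is bounded on each
  -- [s₁, T] only.
  · have hc := (continuousOn_update h2 hL'').mono
      (fun x hx => ⟨hs₁.1.trans_le hx.1, hx.2⟩ : Icc s₁ T ⊆ Ioc s T)
    obtain ⟨M', hM', hb⟩ := exists_abs_le_of_continuousOn hc
    refine ⟨M', hM'.le, fun t ht => ?_⟩
    have := hb t (Ioo_subset_Icc_self ht)
    rwa [Function.update_of_ne ht.2.ne] at this

namespace SLData

variable {A : SLData}

lemma norm_cls_le_of_integral {g h : ℝ → ℝ} {M : ℝ} (hg : ContinuousOn g (Icc 0 1))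
    (hh : ContinuousOn h (Icc 0 1)) (hle : ∀ x, g x ^ 2 ≤ h x)
    (hM : ∫ x in (0 : ℝ)..1, A.r x * h x ≤ M) : ‖A.cls g‖ ≤ Real.sqrt M := by
  refine Real.le_sqrt_of_sq_le ?_
  rw [norm_cls_sq (memLp_wt hg), integral_wt]
  refine le_trans (intervalIntegral.integral_mono_on zero_le_one ?_ ?_ fun x hx => ?_) hM
  · exact intervalIntegrable_of_continuousOn (A.r_cont.mul (hg.pow 2)) (by simp) (by simp)
  · exact intervalIntegrable_of_continuousOn (A.r_cont.mul hh) (by simp) (by simp)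
  · exact mul_le_mul_of_nonneg_left (hle x) (A.r_pos x hx).le

lemma cls_op_sub {g : ℝ → ℝ} (hg : ContDiffOn ℝ 2 g (Icc 0 1)) (κ : ℝ) :
    A.cls (fun y => A.op g y - κ * g y) = A.cls (A.op g) - κ • A.cls g := by
  have h1 := memLp_wt (A := A) (continuousOn_op (A := A) hg)
  have h2 := memLp_wt (A := A) hg.continuousOn
  rw [← cls_smul h2, ← cls_sub h1 (h2.const_mul κ)]
  rfl

/-- The source on `(s, T)` extends continuously to `(s, T]`. -/
lemma GDOn.exists_extension (G : A.Green) {s T : ℝ} {f : ℝ → ℝ → ℝ} (hf : A.GDOn s T f)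
    (hsT : s < T) :
    ∃ (F₁ F₁' F₂ : ℝ → ℝ → ℝ) (N : ℝ), 0 ≤ N ∧
      ContinuousOn (fun z : ℝ × ℝ => F₁ z.1 z.2) (Ioc s T ×ˢ Icc 0 1) ∧
      ContinuousOn (fun z : ℝ × ℝ => F₁' z.1 z.2) (Ioc s T ×ˢ Icc 0 1) ∧
      ContinuousOn (fun z : ℝ × ℝ => F₂ z.1 z.2) (Ioc s T ×ˢ Icc 0 1) ∧
      (∀ t ∈ Ioo s T, ∀ x ∈ Icc (0 : ℝ) 1, HasDerivAt (fun t => F₁ t x) (F₁' t x) t) ∧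
      (∀ t ∈ Ioc s T, A.MemDC2 (F₂ t)) ∧ (∀ t ∈ Ioc s T, ‖A.cls (F₁ t)‖ ≤ N) ∧
      (∀ t ∈ Ioc s T, ‖A.cls (fun y => A.op (F₂ t) y - G.κ * F₂ t y)‖ ≤ N) ∧
      (∀ t ∈ Ioo s T, ∀ x ∈ Icc (0 : ℝ) 1, f t x = F₁ t x + F₂ t x) ∧
      ∀ x ∈ Icc (0 : ℝ) 1, Tendsto (fun t => f t x) (𝓝[<] T) (𝓝 (F₁ T x + F₂ T x)) := by
  obtain ⟨f₁, f₂, a, b, c, hf₁, hf₂, ha, hb, hc, hmem, hsum, ⟨M, hM⟩, hdiff, hdc, hlim₁, hlimd,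
    hlim₂⟩ := hf
  have hb1 : ∀ t ∈ Ioo s T, ‖A.cls (f₁ t)‖ ≤ Real.sqrt M ∧
      ‖A.cls (fun y => A.op (f₂ t) y - G.κ * f₂ t y)‖ ≤ Real.sqrt M + |G.κ| * Real.sqrt M := by
    intro t ht
    obtain ⟨-, h2⟩ := hmem t ht
    have c1 := continuousOn_slice hf₁ ht
    have c2 := h2.1.continuousOn
    have c3 := continuousOn_op (A := A) h2.1
    have cc : ContinuousOn (fun x => |f₁ t x| ^ 2 + |f₂ t x| ^ 2 + |A.op (f₂ t) x| ^ 2)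
        (Icc 0 1) := ((c1.abs.pow 2).add (c2.abs.pow 2)).add (c3.abs.pow 2)
    have b1 := norm_cls_le_of_integral c1 cc (fun x => by
      simp only [sq_abs]; nlinarith [sq_nonneg (f₂ t x), sq_nonneg (A.op (f₂ t) x)]) (hM t ht)
    have b2 := norm_cls_le_of_integral c2 cc (fun x => by
      simp only [sq_abs]; nlinarith [sq_nonneg (f₁ t x), sq_nonneg (A.op (f₂ t) x)]) (hM t ht)
    have b3 := norm_cls_le_of_integral c3 cc (fun x => by
      simp only [sq_abs]; nlinarith [sq_nonneg (f₁ t x), sq_nonneg (f₂ t x)]) (hM t ht)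
    refine ⟨b1, ?_⟩
    rw [cls_op_sub h2.1]
    refine (norm_sub_le _ _).trans (add_le_add b3 ?_)
    rw [norm_smul]
    exact mul_le_mul_of_nonneg_left b2 (norm_nonneg _)
  set f₁' : ℝ → ℝ → ℝ := fun t x => deriv (fun s' => f₁ s' x) t
  -- the source `f₁`
  have hF₁' : ContinuousOn (fun z : ℝ × ℝ => extT T f₁' b z.1 z.2) (Ioc s T ×ˢ Icc 0 1) :=
    continuousOn_extT hdc hb fun x hx => tendsto_joint_of_uniform hb hlimd hx
  have hF₁ : ContinuousOn (fun z : ℝ × ℝ => extT T f₁ a z.1 z.2) (Ioc s T ×ˢ Icc 0 1) := by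
    refine continuousOn_extT hf₁ ha.1 fun x hx => tendsto_joint_of_uniform ha.1 ?_ hx
    -- The time derivative is now continuous up to T, hence bounded on the later half of the
    -- interval; so f₁ is Lipschitz in t there, uniformly in x, and its pointwise limit is uniform.
    obtain ⟨B, hB, hbB⟩ := exists_bound_of_continuousOn_prod (g := extT T f₁' b)
      (a := (s + T) / 2) (b := T)
      (hF₁'.mono (prod_mono (fun x hx => ⟨by linarith [hx.1], hx.2⟩) (Subset.refl _)))
    refine tendstoUniformlyOn_of_deriv_bound (s := (s + T) / 2) (B := B) (by linarith)
      (fun t ht x hx => hdiff t ⟨by linarith [ht.1], ht.2⟩ x hx) (fun t ht x hx => ?_) hlim₁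
    have := hbB t (Ioo_subset_Icc_self ht) x hx
    rwa [extT_of_lt _ _ ht.2] at this
  -- the source `f₂`
  have hF₂ : ContinuousOn (fun z : ℝ × ℝ => extT T f₂ c z.1 z.2) (Ioc s T ×ˢ Icc 0 1) := by
    refine continuousOn_extT hf₂ hc.1.continuousOn fun x hx => ?_
    set N := Real.sqrt M + |G.κ| * Real.sqrt M
    have hsec : ContinuousOn (fun y => A.cls (G.ker y)) (Icc 0 1) := by
      rw [continuousOn_iff_continuous_domRestrict]
      exact G.continuous_section
    have h1 : Tendsto (fun z : ℝ × ℝ => ‖A.cls (G.ker z.2) - A.cls (G.ker x)‖ * N)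
        (𝓝[Ioo s T ×ˢ Icc 0 1] (T, x)) (𝓝 0) := by
      have e1 := (hsec x hx).tendsto.comp (tendsto_snd_unit s T x)
      have := ((e1.sub_const (A.cls (G.ker x))).norm).mul_const N
      simpa [Function.comp_def] using this
    have h2 := (hlim₂ x hx).comp (tendsto_fst_left s T x)
    -- The difference is ⟨k_z − k_x, (A − κ) f₂(t)⟩, with k_z, k_x the sections of the Green
    -- function at the two points, and its second factor is bounded in t. This equicontinuity
    -- upgrades the pointwise limit at x to a joint one.
    have h3 : Tendsto (fun z : ℝ × ℝ => f₂ z.1 z.2 - f₂ z.1 x)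
        (𝓝[Ioo s T ×ˢ Icc 0 1] (T, x)) (𝓝 0) := by
      refine squeeze_zero_norm' ?_ h1
      filter_upwards [self_mem_nhdsWithin] with z hz
      have hm := (hmem z.1 hz.1).2
      rw [G.eq_inner_of_memDC2 hm hz.2, G.eq_inner_of_memDC2 hm hx, ← inner_sub_left]
      exact (norm_inner_le_norm _ _).trans
        (mul_le_mul_of_nonneg_left (hb1 z.1 hz.1).2 (norm_nonneg _))
    have := h3.add h2
    simpa [Function.comp_def] using this
  refine ⟨extT T f₁ a, extT T f₁' b, extT T f₂ c,
    max (Real.sqrt M + |G.κ| * Real.sqrt M)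
      (max ‖A.cls a‖ ‖A.cls (fun y => A.op c y - G.κ * c y)‖), by positivity, hF₁, hF₁', hF₂,
    fun t ht x hx => ?_, fun t ht => ?_, fun t ht => ?_, fun t ht => ?_, fun t ht x hx => ?_,
    fun x hx => ?_⟩
  · rw [extT_of_lt _ _ ht.2]
    refine (hdiff t ht x hx).hasDerivAt.congr_of_eventuallyEq ?_
    filter_upwards [Iio_mem_nhds ht.2] with y hy
    rw [extT_of_lt _ _ hy]
  · rcases eq_or_lt_of_le ht.2 with rfl | hlt
    · rw [extT_self]; exact hc
    · rw [extT_of_lt _ _ hlt]; exact (hmem t ⟨ht.1, hlt⟩).2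
  · rcases eq_or_lt_of_le ht.2 with rfl | hlt
    · rw [extT_self]; exact (le_max_left _ _).trans (le_max_right _ _)
    · rw [extT_of_lt _ _ hlt]
      refine (hb1 t ⟨ht.1, hlt⟩).1.trans (le_trans ?_ (le_max_left _ _))
      exact le_add_of_nonneg_right (by positivity)
  · rcases eq_or_lt_of_le ht.2 with rfl | hlt
    · rw [extT_self]; exact (le_max_right _ _).trans (le_max_right _ _)
    · rw [extT_of_lt _ _ hlt]
      exact (hb1 t ⟨ht.1, hlt⟩).2.trans (le_max_left _ _)
  · rw [extT_of_lt _ _ ht.2, extT_of_lt _ _ ht.2]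
    exact hsum t ht x hx
  · rw [extT_self, extT_self]
    refine ((hlim₁ x hx).add (hlim₂ x hx)).congr' ?_
    filter_upwards [Ioo_mem_nhdsLT hsT] with t ht
    exact (hsum t ht x hx).symm

/-- Membership in the domain gains a factor 1/ω: g is the resolvent of (A − κ)g, and the resolvent
divides each coefficient by ω. This is why f₂ needs no time derivative. -/
lemma Spectral.abs_coef_le_of_memDC2 (S : A.Spectral) {g : ℝ → ℝ} (hg : A.MemDC2 g) (μ : A.Eig) :
    |S.coef g μ| ≤ ‖A.cls (fun y => A.op g y - S.G.κ * g y)‖ * (S.ω μ)⁻¹ := by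
  have hF : ContinuousOn (fun y => A.op g y - S.G.κ * g y) (Icc 0 1) :=
    (continuousOn_op hg.1).sub (continuousOn_const.mul hg.1.continuousOn)
  have hω := inv_pos.2 (S.ω_pos μ)
  rw [S.coef_congr (S.G.res_op_sub hg) μ, S.coef_res hF, abs_mul, abs_of_pos hω, mul_comm]
  exact mul_le_mul_of_nonneg_right (S.abs_coef_le (memLp_wt hF) μ) hω.le

/-- The solution of the initial-boundary value problem on one time interval `[s, T]`. -/
structure IntervalSol (A : SLData) (s T : ℝ) (f : ℝ → ℝ → ℝ) (d₀ d₁ : ℝ → ℝ) (u₀ : ℝ → ℝ)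
    (u : ℝ → ℝ → ℝ) : Prop where
  initial : u s = u₀
  cont : ContinuousOn (fun z : ℝ × ℝ => u z.1 z.2) (Ioc s T ×ˢ Icc 0 1)
  contDiff_two : ∀ t ∈ Ioc s T, ContDiffOn ℝ 2 (u t) (Icc 0 1)
  cont_dx : ContinuousOn (fun z : ℝ × ℝ => dx (u z.1) z.2) (Ioc s T ×ˢ Icc 0 1)
  boundary : ∀ t ∈ Ioo s T, A.bc0 (u t) = d₀ t ∧ A.bc1 (u t) = d₁ t
  -- Here fT is the source extended to t = T. Requiring the equation at T as well is what identifies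
  -- the left limit of ∂u/∂t there.
  equation : ∃ u' fT : ℝ → ℝ → ℝ,
    ContinuousOn (fun z : ℝ × ℝ => u' z.1 z.2) (Ioc s T ×ˢ Icc 0 1) ∧
    (∀ t ∈ Ioo s T, ∀ x ∈ Icc (0 : ℝ) 1, HasDerivAt (fun t => u t x) (u' t x) t) ∧
    (∀ t ∈ Ioc s T, ∀ x ∈ Icc (0 : ℝ) 1, u' t x = -A.op (u t) x + fT t x) ∧
    (∀ t ∈ Ioo s T, ∀ x ∈ Icc (0 : ℝ) 1, fT t x = f t x) ∧
    ∀ x ∈ Icc (0 : ℝ) 1, Tendsto (fun t => f t x) (𝓝[<] T) (𝓝 (fT T x))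
  tendsto_initial : Tendsto (fun t => A.cls (u t)) (𝓝[Ioc s T] s) (𝓝 (A.cls u₀))

end SLData

/-! ### The inhomogeneous problem on one time interval -/

namespace SLData

variable {A : SLData}

/-- Solvability of the initial-boundary value problem on one time interval. -/
theorem Spectral.exists_intervalSol (S : A.Spectral) {s T : ℝ} (hsT : s < T) {f : ℝ → ℝ → ℝ}
    {d₀ d₁ : ℝ → ℝ} (hf : A.GDOn s T f) (hd₀ : BdryOn s T d₀) (hd₁ : BdryOn s T d₁)
    {u₀ : ℝ → ℝ} (hu₀ : MemLp u₀ 2 A.wt) : ∃ u, A.IntervalSol s T f d₀ d₁ u₀ u := by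
  set κ := S.G.κ with hκ
  obtain ⟨F₁, F₁', F₂, N, hN, cF₁, cF₁', cF₂, hF₁d, hF₂m, hF₁N, hF₂N, hfF, hflim⟩ :=
    hf.exists_extension S.G hsT
  obtain ⟨D₀, D₀', D₀'', M₀, hM₀, eD₀, cD₀, cD₀', dD₀, dD₀', bD₀, bD₀', bD₀''⟩ :=
    hd₀.exists_extension hsT
  obtain ⟨D₁, D₁', D₁'', M₁, hM₁, eD₁, cD₁, cD₁', dD₁, dD₁', bD₁, bD₁', bD₁''⟩ :=
    hd₁.exists_extension hsT
  obtain ⟨g₀, hg₀, og₀, bg₀, bg₀'⟩ := S.G.exists_lift_left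
  obtain ⟨g₁, hg₁, og₁, bg₁, bg₁'⟩ := S.G.exists_lift_right
  have mg₀ := memLp_wt (A := A) hg₀.continuousOn
  have mg₁ := memLp_wt (A := A) hg₁.continuousOn
  -- The lift is v = D₀ g₀ + D₁ g₁. Since A g₀ = κ g₀ and A g₁ = κ g₁, one has v_t + A v = e₀ g₀ +
  -- e₁ g₁, which is subtracted from the source for w = u − v.
  let e₀ : ℝ → ℝ := fun t => D₀' t + κ * D₀ t
  let e₁ : ℝ → ℝ := fun t => D₁' t + κ * D₁ t
  have ce₀ : ContinuousOn e₀ (Ioc s T) :=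
    cD₀'.add (continuousOn_const.mul (cD₀.mono Ioc_subset_Icc_self))
  have ce₁ : ContinuousOn e₁ (Ioc s T) :=
    cD₁'.add (continuousOn_const.mul (cD₁.mono Ioc_subset_Icc_self))
  have be : ∀ (D D' : ℝ → ℝ) (M : ℝ), (∀ t ∈ Ioc s T, |D t| ≤ M) → (∀ t ∈ Ioc s T, |D' t| ≤ M) →
      ∀ t ∈ Ioc s T, |D' t + κ * D t| ≤ M + |κ| * M := by
    intro D D' M h1 h2 t ht
    refine (abs_add_le _ _).trans (add_le_add (h2 t ht) ?_)
    rw [abs_mul]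
    exact mul_le_mul_of_nonneg_left (h1 t ht) (abs_nonneg _)
  have be₀ := be D₀ D₀' M₀ bD₀ bD₀'
  have be₁ := be D₁ D₁' M₁ bD₁ bD₁'
  let F : ℝ → ℝ → ℝ := fun t x => F₁ t x + F₂ t x - (e₀ t * g₀ x + e₁ t * g₁ x)
  have cfst : ∀ k : ℝ → ℝ, ContinuousOn k (Ioc s T) →
      ContinuousOn (fun z : ℝ × ℝ => k z.1) (Ioc s T ×ˢ Icc (0 : ℝ) 1) := fun k hk =>
    hk.comp continuousOn_fst fun z hz => hz.1
  have csnd : ∀ k : ℝ → ℝ, ContinuousOn k (Icc 0 1) →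
      ContinuousOn (fun z : ℝ × ℝ => k z.2) (Ioc s T ×ˢ Icc (0 : ℝ) 1) := fun k hk =>
    hk.comp continuousOn_snd fun z hz => hz.2
  have cF : ContinuousOn (fun z : ℝ × ℝ => F z.1 z.2) (Ioc s T ×ˢ Icc 0 1) :=
    (cF₁.add cF₂).sub (((cfst _ ce₀).mul (csnd _ hg₀.continuousOn)).add
      ((cfst _ ce₁).mul (csnd _ hg₁.continuousOn)))
  -- The lift terms belong to h₁: g₀ and g₁ are not in the domain, so
  -- `Spectral.abs_coef_le_of_memDC2` does not cover them. Differentiating e₀ and e₁ is what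
  -- requires two derivatives of the boundary data.
  let h₁ : A.Eig → ℝ → ℝ := fun μ t =>
    S.coef (F₁ t) μ - (e₀ t * S.coef g₀ μ + e₁ t * S.coef g₁ μ)
  let h₂ : A.Eig → ℝ → ℝ := fun μ t => S.coef (F₂ t) μ
  let h₁' : A.Eig → ℝ → ℝ := fun μ t => S.coef (F₁' t) μ -
    ((D₀'' t + κ * D₀' t) * S.coef g₀ μ + (D₁'' t + κ * D₁' t) * S.coef g₁ μ)
  have hcoef : ∀ t ∈ Ioc s T, ∀ μ, S.coef (F t) μ = h₁ μ t + h₂ μ t := by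
    intro t ht μ
    have m1 := memLp_wt (A := A) (continuousOn_slice cF₁ ht)
    have m2 := memLp_wt (A := A) (continuousOn_slice cF₂ ht)
    have k1 := S.coef_combo m1 m2 1 1 μ
    have k2 := S.coef_combo mg₀ mg₁ (e₀ t) (e₁ t) μ
    have k3 := S.coef_combo ((m1.const_mul 1).add (m2.const_mul 1))
      ((mg₀.const_mul (e₀ t)).add (mg₁.const_mul (e₁ t))) 1 (-1) μ
    have eF : F t = fun x => 1 * ((fun x => 1 * F₁ t x) + fun x => 1 * F₂ t x) x +
        -1 * ((fun x => e₀ t * g₀ x) + fun x => e₁ t * g₁ x) x := by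
      ext x; simp [F]; ring
    rw [eF, k3]
    change 1 * S.coef (fun x => 1 * F₁ t x + 1 * F₂ t x) μ +
      -1 * S.coef (fun x => e₀ t * g₀ x + e₁ t * g₁ x) μ = _
    rw [k1, k2]
    simp only [h₁, h₂]
    ring
  have hh₁ : ∀ μ, ContinuousOn (h₁ μ) (Ioc s T) := fun μ =>
    (S.continuousOn_coef cF₁ μ).sub ((ce₀.mul continuousOn_const).add (ce₁.mul continuousOn_const))
  set P := (M₀ + |κ| * M₀) * ‖A.cls g₀‖ + (M₁ + |κ| * M₁) * ‖A.cls g₁‖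
  have hP : 0 ≤ P := by positivity
  have hcomb : ∀ (a b B₀ B₁ : ℝ) (μ : A.Eig), |a| ≤ B₀ → |b| ≤ B₁ →
      |a * S.coef g₀ μ + b * S.coef g₁ μ| ≤ B₀ * ‖A.cls g₀‖ + B₁ * ‖A.cls g₁‖ := by
    intro a b B₀ B₁ μ ha hb
    refine (abs_add_le _ _).trans ?_
    rw [abs_mul, abs_mul]
    exact add_le_add
      (mul_le_mul ha (S.abs_coef_le mg₀ μ) (abs_nonneg _) ((abs_nonneg _).trans ha))
      (mul_le_mul hb (S.abs_coef_le mg₁ μ) (abs_nonneg _) ((abs_nonneg _).trans hb))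
  have hb₁ : ∀ μ, ∀ t ∈ Ioc s T, |h₁ μ t| ≤ N + P := by
    intro μ t ht
    refine (abs_sub _ _).trans (add_le_add ?_ (hcomb _ _ _ _ μ (be₀ t ht) (be₁ t ht)))
    exact (S.abs_coef_le (memLp_wt (continuousOn_slice cF₁ ht)) μ).trans (hF₁N t ht)
  have hb₂ : ∀ μ, ∀ t ∈ Ioc s T, |h₂ μ t| ≤ (N + P) * (S.ω μ)⁻¹ := by
    intro μ t ht
    refine (S.abs_coef_le_of_memDC2 (hF₂m t ht) μ).trans ?_
    refine mul_le_mul_of_nonneg_right ((hF₂N t ht).trans ?_) (inv_pos.2 (S.ω_pos μ)).le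
    linarith
  have hsubset : Ioo s T ×ˢ Icc (0 : ℝ) 1 ⊆ Ioc s T ×ˢ Icc (0 : ℝ) 1 :=
    prod_mono Ioo_subset_Ioc_self (Subset.refl _)
  have hd : ∀ μ, ∀ t ∈ Ioo s T, HasDerivAt (h₁ μ) (h₁' μ t) t := by
    intro μ t ht
    refine (S.hasDerivAt_coef (cF₁.mono hsubset) (cF₁'.mono hsubset) hF₁d μ ht).sub ?_
    exact (((dD₀' t ht).add ((dD₀ t ht).const_mul κ)).mul_const _).add
      (((dD₁' t ht).add ((dD₁ t ht).const_mul κ)).mul_const _)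
  have hbd : ∀ s₁ ∈ Ioo s T, ∃ M', 0 ≤ M' ∧ ∀ μ, ∀ t ∈ Ioo s₁ T, |h₁' μ t| ≤ M' := by
    intro s₁ hs₁
    obtain ⟨Q₀, hQ₀, bQ₀⟩ := bD₀'' s₁ hs₁
    obtain ⟨Q₁, hQ₁, bQ₁⟩ := bD₁'' s₁ hs₁
    obtain ⟨C, hC, hbC⟩ := exists_bound_of_continuousOn_prod (g := F₁') (a := s₁) (b := T)
      (cF₁'.mono (prod_mono (fun x hx => ⟨hs₁.1.trans_le hx.1, hx.2⟩) (Subset.refl _)))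
    refine ⟨(measureUnivNNReal A.wt : ℝ) ^ ((2 : ℝ)⁻¹) * C +
      ((Q₀ + |κ| * M₀) * ‖A.cls g₀‖ + (Q₁ + |κ| * M₁) * ‖A.cls g₁‖), by positivity,
      fun μ t ht => ?_⟩
    have ht' : t ∈ Ioc s T := ⟨hs₁.1.trans ht.1, ht.2.le⟩
    have m1 := memLp_wt (A := A) (continuousOn_slice cF₁' ht')
    refine (abs_sub _ _).trans (add_le_add ?_ (hcomb _ _ _ _ μ ?_ ?_))
    · exact (S.abs_coef_le m1 μ).trans
        (norm_cls_le m1 hC.le fun x hx => hbC t (Ioo_subset_Icc_self ht) x hx)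
    · refine (abs_add_le _ _).trans (add_le_add (bQ₀ t ht) ?_)
      rw [abs_mul]
      exact mul_le_mul_of_nonneg_left (bD₀' t ht') (abs_nonneg _)
    · refine (abs_add_le _ _).trans (add_le_add (bQ₁ t ht) ?_)
      rw [abs_mul]
      exact mul_le_mul_of_nonneg_left (bD₁' t ht') (abs_nonneg _)
  let v : ℝ → ℝ → ℝ := fun t x => D₀ t * g₀ x + D₁ t * g₁ x
  have mv : ∀ t, MemLp (v t) 2 A.wt := fun t => (mg₀.const_mul _).add (mg₁.const_mul _)
  have hv2 : ∀ t, ContDiffOn ℝ 2 (v t) (Icc 0 1) := fun t =>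
    (contDiffOn_const.mul hg₀).add (contDiffOn_const.mul hg₁)
  obtain ⟨w, w', cw, cw', dw, hw, hwlim⟩ := S.exists_solution_homogeneous hsT cF hcoef hh₁
    (add_nonneg hN hP) hb₁ hb₂ hd hbd (hu₀.sub (mv s))
  let R : ℝ → ℝ → ℝ := fun t y => F t y - w' t y - κ * w t y
  have cR : ContinuousOn (fun z : ℝ × ℝ => R z.1 z.2) (Ioc s T ×ˢ Icc 0 1) :=
    (cF.sub cw').sub (continuousOn_const.mul cw)
  have hwR : ∀ t ∈ Ioc s T, EqOn (w t) (S.G.res (R t)) (Icc 0 1) := fun t ht x hx => hw t ht x hx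
  have cRt : ∀ t ∈ Ioc s T, ContinuousOn (R t) (Icc 0 1) := fun t ht => continuousOn_slice cR ht
  have hwm : ∀ t ∈ Ioc s T, A.MemDC2 (w t) := fun t ht =>
    (S.G.memDC2_res (cRt t ht)).congr (hwR t ht)
  have hwop : ∀ t ∈ Ioc s T, ∀ x ∈ Icc (0 : ℝ) 1, A.op (w t) x = F t x - w' t x := by
    intro t ht x hx
    rw [op_congr (hwR t ht) hx, S.G.op_res (cRt t ht) hx, ← hwR t ht hx]
    simp only [R]
    ring
  -- At t = s the eigenfunction series need not converge, so the initial function is inserted by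
  -- hand; it is attained from the right in L²_r only.
  let u : ℝ → ℝ → ℝ := fun t => if t ≤ s then u₀ else fun x => 1 * w t x + 1 * v t x
  have hu : ∀ t, s < t → u t = fun x => 1 * w t x + 1 * v t x := fun t ht => by
    simp [u, not_le.2 ht]
  have cD₀o := cD₀.mono (Ioc_subset_Icc_self : Ioc s T ⊆ Icc s T)
  have cD₁o := cD₁.mono (Ioc_subset_Icc_self : Ioc s T ⊆ Icc s T)
  have one2 : ∀ {g : ℝ → ℝ}, ContDiffOn ℝ 2 g (Icc 0 1) → ContDiffOn ℝ 1 g (Icc 0 1) :=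
    fun h => h.of_le (by norm_num)
  refine ⟨u, ?_, ?_, ?_, ?_, ?_, ⟨fun t x => w' t x + (D₀' t * g₀ x + D₁' t * g₁ x),
    fun t x => F₁ t x + F₂ t x, ?_, ?_, ?_, ?_, hflim⟩, ?_⟩
  · simp [u]
  · refine ((cw.add (((cfst _ cD₀o).mul (csnd _ hg₀.continuousOn)).add
      ((cfst _ cD₁o).mul (csnd _ hg₁.continuousOn))))).congr fun z hz => ?_
    rw [hu z.1 hz.1.1]
    simp [v]
  · intro t ht
    rw [hu t ht.1]
    exact (contDiffOn_const.mul (hwm t ht).1).add (contDiffOn_const.mul (hv2 t))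
  · have c1 : ContinuousOn (fun z : ℝ × ℝ => (A.p z.2)⁻¹ * S.G.resFlux (R z.1) z.2 +
        (D₀ z.1 * dx g₀ z.2 + D₁ z.1 * dx g₁ z.2)) (Ioc s T ×ˢ Icc 0 1) :=
      ((csnd _ A.continuousOn_inv_p).mul (S.G.continuousOn_resFlux_joint cR)).add
        (((cfst _ cD₀o).mul (csnd _ (continuousOn_dx (one2 hg₀)))).add
          ((cfst _ cD₁o).mul (csnd _ (continuousOn_dx (one2 hg₁)))))
    refine c1.congr fun z hz => ?_
    rw [hu z.1 hz.1.1, dx_combo (one2 (hwm z.1 hz.1).1) (one2 (hv2 z.1)) 1 1 hz.2,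
      dx_congr (hwR z.1 hz.1) hz.2, S.G.dx_res (cRt z.1 hz.1) hz.2]
    simp only [v]
    rw [dx_combo (one2 hg₀) (one2 hg₁) _ _ hz.2]
    ring
  · intro t ht
    have ht' := Ioo_subset_Ioc_self ht
    rw [hu t ht.1, bc0_combo (one2 (hwm t ht').1) (one2 (hv2 t)),
      bc1_combo (one2 (hwm t ht').1) (one2 (hv2 t)), (hwm t ht').2.1, (hwm t ht').2.2]
    simp only [v]
    rw [bc0_combo (one2 hg₀) (one2 hg₁), bc1_combo (one2 hg₀) (one2 hg₁), bg₀, bg₁, bg₀', bg₁',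
      eD₀ t ht.2.ne, eD₁ t ht.2.ne]
    constructor <;> ring
  · exact cw'.add (((cfst _ cD₀').mul (csnd _ hg₀.continuousOn)).add
      ((cfst _ cD₁').mul (csnd _ hg₁.continuousOn)))
  · intro t ht x hx
    have h1 := (dw t ht x hx).add (((dD₀ t ht).mul_const (g₀ x)).add ((dD₁ t ht).mul_const (g₁ x)))
    refine h1.congr_of_eventuallyEq ?_
    filter_upwards [Ioi_mem_nhds ht.1] with τ hτ
    rw [hu τ hτ]
    simp [v]
  · intro t ht x hx
    rw [hu t ht.1, op_combo (hwm t ht).1 (hv2 t) 1 1 hx, hwop t ht x hx]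
    simp only [v]
    rw [op_combo hg₀ hg₁ _ _ hx, og₀ x hx, og₁ x hx]
    simp only [F, e₀, e₁]
    ring
  · intro t ht x hx
    exact (hfF t ht x hx).symm
  · have hvc : ∀ t, A.cls (v t) = D₀ t • A.cls g₀ + D₁ t • A.cls g₁ := by
      intro t
      rw [← cls_smul mg₀, ← cls_smul mg₁, cls_of_memLp (mv t), cls_of_memLp (mg₀.const_mul _),
        cls_of_memLp (mg₁.const_mul _)]
      rfl
    have hs0 : Tendsto D₀ (𝓝[Ioc s T] s) (𝓝 (D₀ s)) :=
      (cD₀ s (left_mem_Icc.2 hsT.le)).mono_left (nhdsWithin_mono _ Ioc_subset_Icc_self)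
    have hs1 : Tendsto D₁ (𝓝[Ioc s T] s) (𝓝 (D₁ s)) :=
      (cD₁ s (left_mem_Icc.2 hsT.le)).mono_left (nhdsWithin_mono _ Ioc_subset_Icc_self)
    have hvlim : Tendsto (fun t => A.cls (v t)) (𝓝[Ioc s T] s) (𝓝 (A.cls (v s))) := by
      simp only [hvc]
      exact (hs0.smul_const _).add (hs1.smul_const _)
    have h1 := hwlim.add hvlim
    rw [cls_sub hu₀ (mv s), sub_add_cancel] at h1
    refine h1.congr' ?_
    filter_upwards [self_mem_nhdsWithin] with t ht
    rw [hu t ht.1]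
    have mw := memLp_wt (A := A) (continuousOn_slice cw ht)
    have : (fun x => 1 * w t x + 1 * v t x) = w t + v t := by ext x; simp
    rw [this, cls_of_memLp mw, cls_of_memLp (mv t), cls_of_memLp (mw.add (mv t))]
    rfl

end SLData

/-! ### Gluing over the switching times -/

namespace IsTimes

variable {τ : ℕ → ℝ}

lemma lt_succ (hτ : IsTimes τ) (i : ℕ) : τ i < τ (i + 1) := hτ.1 i.lt_succ_self

lemma nonneg (hτ : IsTimes τ) (i : ℕ) : 0 ≤ τ i := hτ.2.1 ▸ hτ.1.monotone i.zero_le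

lemma exists_mem_Ioc (hτ : IsTimes τ) {t : ℝ} (ht : 0 < t) :
    ∃ i, t ∈ Ioc (τ i) (τ (i + 1)) := by
  classical
  have hex : ∃ n, t ≤ τ n := (hτ.2.2.eventually_ge_atTop t).exists
  have hne : Nat.find hex ≠ 0 := fun h => by
    have := Nat.find_spec hex
    rw [h, hτ.2.1] at this
    exact absurd ht this.not_gt
  obtain ⟨i, hi⟩ := Nat.exists_eq_succ_of_ne_zero hne
  refine ⟨i, not_le.1 (Nat.find_min hex (by rw [hi]; exact i.lt_succ_self)), ?_⟩
  have := Nat.find_spec hex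
  rwa [hi] at this

lemma exists_mem_Ico (hτ : IsTimes τ) {t : ℝ} (ht : 0 ≤ t) :
    ∃ i, t ∈ Ico (τ i) (τ (i + 1)) := by
  rcases eq_or_lt_of_le ht with rfl | h0
  · exact ⟨0, hτ.2.1.le, hτ.2.1 ▸ hτ.lt_succ 0⟩
  · obtain ⟨i, hi⟩ := hτ.exists_mem_Ioc h0
    rcases eq_or_lt_of_le hi.2 with h | h
    · exact ⟨i + 1, h.ge, h ▸ hτ.lt_succ (i + 1)⟩
    · exact ⟨i, hi.1.le, h⟩

lemma eq_of_mem_Ioc (hτ : IsTimes τ) {t : ℝ} {i j : ℕ} (hi : t ∈ Ioc (τ i) (τ (i + 1)))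
    (hj : t ∈ Ioc (τ j) (τ (j + 1))) : i = j := by
  by_contra h
  rcases lt_or_gt_of_ne h with h | h
  · exact absurd (hi.2.trans (hτ.1.monotone h)) hj.1.not_ge
  · exact absurd (hj.2.trans (hτ.1.monotone h)) hi.1.not_ge

lemma Ioo_subset_offTimes (hτ : IsTimes τ) (i : ℕ) : Ioo (τ i) (τ (i + 1)) ⊆ offTimes τ := by
  rintro t ht
  refine ⟨(hτ.nonneg i).trans ht.1.le, ?_⟩
  rintro ⟨j, rfl⟩
  have h1 := hτ.1.lt_iff_lt.1 ht.1
  have h2 := hτ.1.lt_iff_lt.1 ht.2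
  omega

lemma exists_mem_Ioo (hτ : IsTimes τ) {t : ℝ} (ht : t ∈ offTimes τ) :
    ∃ i, t ∈ Ioo (τ i) (τ (i + 1)) := by
  have h0 : t ≠ 0 := fun h => ht.2 ⟨0, hτ.2.1.trans h.symm⟩
  obtain ⟨i, hi⟩ := hτ.exists_mem_Ioc (lt_of_le_of_ne ht.1 h0.symm)
  exact ⟨i, hi.1, lt_of_le_of_ne hi.2 fun h => ht.2 ⟨i + 1, h.symm⟩⟩

end IsTimes

lemma GBAlong.bdryOn {τ : ℕ → ℝ} {d : ℝ → ℝ} (hτ : IsTimes τ) (hd : GBAlong τ d) (i : ℕ) :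
    BdryOn (τ i) (τ (i + 1)) d where
  right_cont := hd.1 _ (hτ.nonneg i)
  contDiff := hd.2.1.mono (hτ.Ioo_subset_offTimes i)
  lim := (hd.2.2.1 (i + 1) (by omega)).1
  lim_deriv := (hd.2.2.1 (i + 1) (by omega)).2.1
  lim_deriv_deriv := (hd.2.2.1 (i + 1) (by omega)).2.2
  bdd := hd.2.2.2 i

namespace SLData

variable {A : SLData} {s T : ℝ} {f : ℝ → ℝ → ℝ} {d₀ d₁ u₀ : ℝ → ℝ} {u v : ℝ → ℝ → ℝ}

namespace IntervalSol

lemma congr (hu : A.IntervalSol s T f d₀ d₁ u₀ u) (hsT : s < T)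
    (h : ∀ t ∈ Icc s T, v t = u t) : A.IntervalSol s T f d₀ d₁ u₀ v := by
  have h' : ∀ t ∈ Ioc s T, v t = u t := fun t ht => h t (Ioc_subset_Icc_self ht)
  have h'' : ∀ t ∈ Ioo s T, v t = u t := fun t ht => h t (Ioo_subset_Icc_self ht)
  obtain ⟨u', fT, h1, h2, h3, h4, h5⟩ := hu.equation
  refine ⟨(h s (left_mem_Icc.2 hsT.le)).trans hu.initial,
    hu.cont.congr fun z hz => by simp only [h' _ hz.1],
    fun t ht => by rw [h' t ht]; exact hu.contDiff_two t ht,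
    hu.cont_dx.congr fun z hz => by simp only [h' _ hz.1],
    fun t ht => by rw [h'' t ht]; exact hu.boundary t ht,
    ⟨u', fT, h1, fun t ht x hx => (h2 t ht x hx).congr_of_eventuallyEq ?_,
      fun t ht x hx => by rw [h' t ht]; exact h3 t ht x hx, h4, h5⟩, ?_⟩
  · filter_upwards [Ioo_mem_nhds ht.1 ht.2] with y hy
    rw [h'' y hy]
  · refine hu.tendsto_initial.congr' ?_
    filter_upwards [self_mem_nhdsWithin] with y hy
    rw [h' y hy]

lemma memLp (hu : A.IntervalSol s T f d₀ d₁ u₀ u) {t : ℝ} (ht : t ∈ Ioc s T) :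
    MemLp (u t) 2 A.wt := memLp_wt (hu.contDiff_two t ht).continuousOn

lemma contDiffOn_one (hu : A.IntervalSol s T f d₀ d₁ u₀ u) :
    ContDiffOn ℝ 1 (fun z : ℝ × ℝ => u z.1 z.2) (Ioo s T ×ˢ Icc 0 1) := by
  obtain ⟨u', fT, h1, h2, -⟩ := hu.equation
  have hsub : Ioo s T ×ˢ Icc (0 : ℝ) 1 ⊆ Ioc s T ×ˢ Icc 0 1 :=
    prod_mono Ioo_subset_Ioc_self Subset.rfl
  exact contDiffOn_one_of_partials (ux := fun t => dx (u t)) isOpen_Ioo h2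
    (fun t ht x hx => hasDerivWithinAt_dx
      ((hu.contDiff_two t (Ioo_subset_Ioc_self ht)).of_le one_le_two) hx)
    (h1.mono hsub) (hu.cont_dx.mono hsub)

end IntervalSol

lemma tendsto_left_of_continuousOn {F : ℝ → ℝ → ℝ} (hsT : s < T)
    (hF : ContinuousOn (fun z : ℝ × ℝ => F z.1 z.2) (Ioc s T ×ˢ Icc 0 1)) {x : ℝ}
    (hx : x ∈ Icc (0 : ℝ) 1) : Tendsto (fun t => F t x) (𝓝[<] T) (𝓝 (F T x)) := by
  have := continuousOn_time hF hx T (right_mem_Ioc.2 hsT)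
  refine this.mono_left ?_
  rw [← nhdsWithin_Ioo_eq_nhdsLT hsT]
  exact nhdsWithin_mono _ Ioo_subset_Ioc_self

/-- Continuity at a switching time is the union of two one-sided statements: from the left by joint
continuity up to the end of an interval, from the right by attainment of the initial value on the
next. -/
lemma continuousOn_cls_of_intervalSol {τ : ℕ → ℝ} (hτ : IsTimes τ)
    (hu : ∀ i, A.IntervalSol (τ i) (τ (i + 1)) f d₀ d₁ (u (τ i)) u) :
    ContinuousOn (fun t => A.cls (u t)) (Ici 0) := by
  have hc : ∀ i, ContinuousOn (fun t => A.cls (u t)) (Icc (τ i) (τ (i + 1))) := by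
    intro i t ht
    rcases eq_or_lt_of_le ht.1 with rfl | hlt
    · rw [← Ioc_insert_left (hτ.lt_succ i).le, continuousWithinAt_insert_self]
      exact (hu i).tendsto_initial
    · refine (continuousOn_cls (hu i).cont t ⟨hlt, ht.2⟩).mono_of_mem_nhdsWithin ?_
      filter_upwards [mem_nhdsWithin_of_mem_nhds (Ioi_mem_nhds hlt), self_mem_nhdsWithin]
        with y hy hy'
      exact ⟨hy, hy'.2⟩
  intro t ht
  obtain ⟨i, hi⟩ := hτ.exists_mem_Ico ht
  have hright : ContinuousWithinAt (fun t => A.cls (u t)) (Ici t) t := by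
    refine (hc i t ⟨hi.1, hi.2.le⟩).mono_of_mem_nhdsWithin ?_
    filter_upwards [mem_nhdsWithin_of_mem_nhds (Iio_mem_nhds hi.2), self_mem_nhdsWithin]
      with y hy hy'
    exact ⟨hi.1.trans hy', le_of_lt hy⟩
  rcases eq_or_lt_of_le (mem_Ici.1 ht) with rfl | h0
  · exact hright
  obtain ⟨j, hj⟩ := hτ.exists_mem_Ioc h0
  have hleft : ContinuousWithinAt (fun t => A.cls (u t)) (Iic t) t := by
    refine (hc j t ⟨hj.1.le, hj.2⟩).mono_of_mem_nhdsWithin ?_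
    filter_upwards [mem_nhdsWithin_of_mem_nhds (Ioi_mem_nhds hj.1), self_mem_nhdsWithin]
      with y hy hy'
    exact ⟨le_of_lt hy, le_trans hy' hj.2⟩
  have := hleft.union hright
  rw [Iic_union_Ici, continuousWithinAt_univ] at this
  exact this.continuousWithinAt

/-- A function that solves the problem on all the intervals between switching times is a
solution. -/
theorem isSolution_of_intervalSol {τ : ℕ → ℝ} (hτ : IsTimes τ) (hu₀ : MemLp u₀ 2 A.wt)
    (h0 : u 0 = u₀) (hu : ∀ i, A.IntervalSol (τ i) (τ (i + 1)) f d₀ d₁ (u (τ i)) u) :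
    A.IsSolution τ f d₀ d₁ u₀ u := by
  have hmem : ∀ t, 0 ≤ t → MemLp (u t) 2 A.wt := by
    intro t ht
    rcases eq_or_lt_of_le ht with rfl | ht
    · rwa [h0]
    · obtain ⟨i, hi⟩ := hτ.exists_mem_Ioc ht
      exact (hu i).memLp hi
  have hdt : ∀ i, ∀ x ∈ Icc (0 : ℝ) 1, ∃ L, Tendsto (fun t => f t x) (𝓝[<] (τ (i + 1))) (𝓝 L) ∧
      Tendsto (fun t => deriv (fun s => u s x) t) (𝓝[<] (τ (i + 1)))
        (𝓝 (-A.op (u (τ (i + 1))) x + L)) := by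
    intro i x hx
    obtain ⟨u', fT, h1, h2, h3, h4, h5⟩ := (hu i).equation
    refine ⟨_, h5 x hx, ?_⟩
    rw [← h3 _ (right_mem_Ioc.2 (hτ.lt_succ i)) x hx]
    refine (tendsto_left_of_continuousOn (hτ.lt_succ i) h1 hx).congr' ?_
    filter_upwards [Ioo_mem_nhdsLT (hτ.lt_succ i)] with t ht
    exact (h2 t ht x hx).deriv.symm
  have hsucc : ∀ i, 1 ≤ i → ∃ j, i = j + 1 := fun i hi => ⟨i - 1, by omega⟩
  refine ⟨⟨hmem, fun t₀ ht₀ => ?_⟩, ?_, fun t ht => ?_, fun i hi x hx => ?_, fun i hi x hx => ?_,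
    fun i hi x hx => ?_, fun x _ => by rw [h0], fun t ht x hx => ?_, fun t ht => ?_⟩
  · refine (tendsto_eLpNorm_iff ?_ (hmem t₀ ht₀)).2 (continuousOn_cls_of_intervalSol hτ hu t₀ ht₀)
    exact mem_of_superset self_mem_nhdsWithin fun t ht => hmem t ht
  · rintro ⟨t, x⟩ ⟨ht, hx⟩
    obtain ⟨i, hi⟩ := hτ.exists_mem_Ioo ht
    refine ((hu i).contDiffOn_one (t, x) ⟨hi, hx⟩).mono_of_mem_nhdsWithin ?_
    have : Ioo (τ i) (τ (i + 1)) ×ˢ (univ : Set ℝ) ∈ 𝓝 (t, x) :=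
      prod_mem_nhds (Ioo_mem_nhds hi.1 hi.2) univ_mem
    filter_upwards [mem_nhdsWithin_of_mem_nhds this, self_mem_nhdsWithin] with z hz hz'
    exact ⟨hz.1, hz'.2⟩
  · obtain ⟨i, hi⟩ := hτ.exists_mem_Ioc ht
    exact (hu i).contDiff_two t hi
  · obtain ⟨j, rfl⟩ := hsucc i hi
    exact tendsto_left_of_continuousOn (hτ.lt_succ j) (hu j).cont hx
  · obtain ⟨j, rfl⟩ := hsucc i hi
    exact hdt j x hx
  · obtain ⟨j, rfl⟩ := hsucc i hi
    exact tendsto_left_of_continuousOn (F := fun t => dx (u t)) (hτ.lt_succ j) (hu j).cont_dx hx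
  · obtain ⟨i, hi⟩ := hτ.exists_mem_Ioo ht
    obtain ⟨u', fT, h1, h2, h3, h4, h5⟩ := (hu i).equation
    have hx' := Ioo_subset_Icc_self hx
    have e := h3 t (Ioo_subset_Ioc_self hi) x hx'
    rw [h4 t hi x hx', op] at e
    rw [(h2 t hi x hx').deriv, e]
    ring
  · obtain ⟨i, hi⟩ := hτ.exists_mem_Ioo ht
    rw [((hu i).boundary t hi).1, ((hu i).boundary t hi).2]
    exact ⟨sub_self _, sub_self _⟩

/-- Existence of solutions. -/
theorem Spectral.exists_isSolution (S : A.Spectral) {τ : ℕ → ℝ}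
    (h : A.Admissible τ f d₀ d₁) (hu₀ : MemLp u₀ 2 A.wt) :
    ∃ u, A.IsSolution τ f d₀ d₁ u₀ u := by
  classical
  obtain ⟨hτ, hf, hd₀, hd₁⟩ := h
  choose U hU using fun (i : ℕ) (g : {g : ℝ → ℝ // MemLp g 2 A.wt}) =>
    S.exists_intervalSol (hτ.lt_succ i) (hf i) (hd₀.bdryOn hτ i) (hd₁.bdryOn hτ i) g.2
  -- The state at τ_i: the final value on one interval is the initial value on the next.
  let F : ℕ → {g : ℝ → ℝ // MemLp g 2 A.wt} := fun n => Nat.rec ⟨u₀, hu₀⟩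
    (fun i g => ⟨U i g (τ (i + 1)), (hU i g).memLp (right_mem_Ioc.2 (hτ.lt_succ i))⟩) n
  -- The intervals (τ_i, τ_{i+1}], closed on the right, partition (0, ∞), so values at switching
  -- times are the smooth final values. The default u₀ is the value at t = 0.
  let u : ℝ → ℝ → ℝ := fun t =>
    if h : ∃ i, t ∈ Ioc (τ i) (τ (i + 1)) then U h.choose (F h.choose) t else u₀
  have hIoc : ∀ i, ∀ t ∈ Ioc (τ i) (τ (i + 1)), u t = U i (F i) t := by
    intro i t ht
    have hex : ∃ i, t ∈ Ioc (τ i) (τ (i + 1)) := ⟨i, ht⟩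
    simp only [u, dif_pos hex, hτ.eq_of_mem_Ioc hex.choose_spec ht]
  have h0 : u 0 = u₀ := by
    have hex : ¬ ∃ i, (0 : ℝ) ∈ Ioc (τ i) (τ (i + 1)) := by
      rintro ⟨i, hi⟩
      exact absurd (hτ.nonneg i) hi.1.not_ge
    simp only [u, dif_neg hex]
  have hstart : ∀ i, u (τ i) = (F i).1 := by
    rintro (_ | i)
    · exact (congrArg u hτ.2.1).trans h0
    · exact hIoc i _ (right_mem_Ioc.2 (hτ.lt_succ i))
  refine ⟨u, isSolution_of_intervalSol hτ hu₀ h0 fun i => ?_⟩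
  rw [hstart i]
  refine (hU i (F i)).congr (hτ.lt_succ i) fun t ht => ?_
  rcases eq_or_lt_of_le ht.1 with rfl | hlt
  · rw [hstart i, (hU i (F i)).initial]
  · exact hIoc i t ⟨hlt, ht.2⟩

end SLData

/-! ### Uniqueness -/

/-- The chain rule along the direction (1, 0) stays inside the set even at x = 0 and x = 1, and
openness of O turns the derivative within O into a genuine one. -/
lemma partial_fst_of_contDiffOn {w : ℝ → ℝ → ℝ} {O : Set ℝ} (hO : IsOpen O)
    (hw : ContDiffOn ℝ 1 (fun z : ℝ × ℝ => w z.1 z.2) (O ×ˢ Icc 0 1)) :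
    ContinuousOn (fun z : ℝ × ℝ => deriv (fun s => w s z.2) z.1) (O ×ˢ Icc 0 1) ∧
      ∀ t ∈ O, ∀ x ∈ Icc (0 : ℝ) 1, DifferentiableAt ℝ (fun s => w s x) t := by
  have hU : UniqueDiffOn ℝ (O ×ˢ Icc (0 : ℝ) 1) :=
    hO.uniqueDiffOn.prod (uniqueDiffOn_Icc zero_lt_one)
  have hd : ∀ z ∈ O ×ˢ Icc (0 : ℝ) 1, HasDerivAt (fun s => w s z.2)
      (fderivWithin ℝ (fun z : ℝ × ℝ => w z.1 z.2) (O ×ˢ Icc 0 1) z (1, 0)) z.1 := by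
    rintro ⟨t, x⟩ ⟨ht, hx⟩
    have h1 := (hw.differentiableOn one_ne_zero (t, x) ⟨ht, hx⟩).hasFDerivWithinAt
    have h2 : HasDerivWithinAt (fun s : ℝ => (s, x)) (1, 0) O t :=
      ((hasDerivAt_id t).prodMk (hasDerivAt_const t x)).hasDerivWithinAt
    have h3 := h1.comp_hasDerivWithinAt (f := fun s : ℝ => (s, x)) t h2
      fun s hs => ⟨hs, hx⟩
    exact h3.hasDerivAt (hO.mem_nhds ht)
  refine ⟨?_, fun t ht x hx => (hd (t, x) ⟨ht, hx⟩).differentiableAt⟩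
  have hc := (hw.continuousOn_fderivWithin hU le_rfl).clm_apply
    (continuousOn_const (c := ((1 : ℝ), (0 : ℝ))))
  exact hc.congr fun z hz => (hd z hz).deriv

namespace SLData

variable {A : SLData} {f : ℝ → ℝ → ℝ} {d₀ d₁ u₀ : ℝ → ℝ} {u v : ℝ → ℝ → ℝ} {τ : ℕ → ℝ}

lemma IsSolution.continuousOn_coef (S : A.Spectral) (hu : A.IsSolution τ f d₀ d₁ u₀ u)
    (μ : A.Eig) : ContinuousOn (fun t => S.coef (u t) μ) (Ici 0) := by
  have hc : ContinuousOn (fun t => A.cls (u t)) (Ici 0) := fun t ht =>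
    (tendsto_eLpNorm_iff (mem_of_superset self_mem_nhdsWithin fun t ht => hu.contL2.1 t ht)
      (hu.contL2.1 t ht)).1 (hu.contL2.2 t ht)
  exact (continuousOn_const.inner hc).congr fun t ht => S.coef_eq_inner (hu.contL2.1 t ht) μ

/-- The coefficients of the difference of two solutions satisfy `c' = -μ c`. -/
lemma IsSolution.hasDerivAt_coef_sub (S : A.Spectral) (hτ : IsTimes τ)
    (hu : A.IsSolution τ f d₀ d₁ u₀ u) (hv : A.IsSolution τ f d₀ d₁ u₀ v) (μ : A.Eig) {t : ℝ}
    (ht : t ∈ offTimes τ) :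
    HasDerivAt (fun t => S.coef (u t) μ - S.coef (v t) μ)
      (-μ * (S.coef (u t) μ - S.coef (v t) μ)) t := by
  obtain ⟨i, hi⟩ := hτ.exists_mem_Ioo ht
  have hsub := prod_mono (hτ.Ioo_subset_offTimes i) (Subset.refl (Icc (0 : ℝ) 1))
  obtain ⟨cu, du⟩ := partial_fst_of_contDiffOn isOpen_Ioo (hu.contDiff_one.mono hsub)
  obtain ⟨cv, dv⟩ := partial_fst_of_contDiffOn isOpen_Ioo (hv.contDiff_one.mono hsub)
  have h1 := S.hasDerivAt_coef (hu.contDiff_one.mono hsub).continuousOn cu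
    (fun t ht x hx => (du t ht x hx).hasDerivAt) μ hi
  have h2 := S.hasDerivAt_coef (hv.contDiff_one.mono hsub).continuousOn cv
    (fun t ht x hx => (dv t ht x hx).hasDerivAt) μ hi
  refine (h1.sub h2).congr_deriv ?_
  have ht0 : 0 < t := (hτ.nonneg i).trans_lt hi.1
  have u2 := hu.contDiff_two t ht0
  have v2 := hv.contDiff_two t ht0
  -- The boundary data cancel in the difference, so it lies in the domain and `coef_op` applies.
  have hw : A.MemDC2 (fun y => 1 * u t y + -1 * v t y) := by
    refine ⟨(contDiffOn_const.mul u2).add (contDiffOn_const.mul v2), ?_, ?_⟩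
    · rw [bc0_combo (u2.of_le one_le_two) (v2.of_le one_le_two)]
      linarith [(hu.boundary t ht).1, (hv.boundary t ht).1]
    · rw [bc1_combo (u2.of_le one_le_two) (v2.of_le one_le_two)]
      linarith [(hu.boundary t ht).2, (hv.boundary t ht).2]
  have e1 := S.coef_op hw μ
  rw [S.coef_combo (memLp_wt u2.continuousOn) (memLp_wt v2.continuousOn)] at e1
  have e2 := S.coef_combo (memLp_wt (A := A) (continuousOn_slice
    (F := fun t x => deriv (fun s => u s x) t) cu hi))
    (memLp_wt (continuousOn_slice (F := fun t x => deriv (fun s => v s x) t) cv hi)) (-1) 1 μ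
  have e3 : S.coef (fun x => -1 * deriv (fun s => u s x) t + 1 * deriv (fun s => v s x) t) μ =
      S.coef (A.op fun y => 1 * u t y + -1 * v t y) μ := by
    -- The equation is only known for x in the open interval; the end points are null.
    refine integral_congr_ae (A.ae_wt_mem_Ioo.mono fun x hx => ?_)
    have hx' := Ioo_subset_Icc_self hx
    have p1 := hu.pde t ht x hx
    have p2 := hv.pde t ht x hx
    simp only
    rw [op_combo u2 v2 1 (-1) hx', op, op]
    congr 1
    linear_combination p2 - p1
  rw [e3, e1] at e2
  linear_combination e2

/-- Solutions are unique. -/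
theorem IsSolution.eqOn (S : A.Spectral) (hτ : IsTimes τ)
    (hu : A.IsSolution τ f d₀ d₁ u₀ u) (hv : A.IsSolution τ f d₀ d₁ u₀ v) {t : ℝ} (ht : 0 ≤ t) :
    EqOn (v t) (u t) (Icc 0 1) := by
  rcases eq_or_lt_of_le ht with rfl | ht
  · exact fun x hx => (hv.initial x hx).trans (hu.initial x hx).symm
  refine S.eqOn_of_coef (hv.contDiff_two t ht).continuousOn (hu.contDiff_two t ht).continuousOn
    fun μ => ?_
  set c : ℝ → ℝ := fun t => S.coef (u t) μ - S.coef (v t) μ with hc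
  have hcc : ContinuousOn c (Ici 0) := (hu.continuousOn_coef S μ).sub (hv.continuousOn_coef S μ)
  have hstep : ∀ i, c (τ i) = 0 → ∀ t ∈ Icc (τ i) (τ (i + 1)), c t = 0 := by
    intro i hi t ht
    rcases eq_or_lt_of_le ht.1 with rfl | hlt
    · exact hi
    -- With the integrating factor e^{μt} the difference of coefficients has zero derivative inside
    -- the interval. Continuity at τ_i, which comes from continuity into L²_r, lets the mean value
    -- theorem start at τ_i.
    have hE : ContinuousOn (fun t => Real.exp (μ * t) * c t) (Icc (τ i) t) :=
      ContinuousOn.mul (by fun_prop) (hcc.mono fun y hy => (hτ.nonneg i).trans hy.1)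
    obtain ⟨y, _, hy⟩ := exists_hasDerivAt_eq_slope _ (fun _ => 0) hlt hE fun y hy => by
      have h1 := hu.hasDerivAt_coef_sub S hτ hv μ
        (hτ.Ioo_subset_offTimes i ⟨hy.1, hy.2.trans_le ht.2⟩)
      have h2 : HasDerivAt (fun t : ℝ => Real.exp (μ * t)) (Real.exp (μ * y) * μ) y := by
        simpa using ((hasDerivAt_id y).const_mul (μ : ℝ)).exp
      exact (h2.mul h1).congr_deriv (by ring)
    rw [eq_div_iff (sub_pos.2 hlt).ne', zero_mul, hi, mul_zero, sub_zero] at hy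
    exact (mul_eq_zero.1 hy.symm).resolve_left (Real.exp_ne_zero _)
  have hτ0 : ∀ i, c (τ i) = 0 := by
    intro i
    induction i with
    | zero =>
      rw [hτ.2.1]
      exact sub_eq_zero.2 (S.coef_congr
        (fun x hx => (hu.initial x hx).trans (hv.initial x hx).symm) μ)
    | succ i ih => exact hstep i ih _ (right_mem_Icc.2 (hτ.lt_succ i).le)
  obtain ⟨i, hi⟩ := hτ.exists_mem_Ioc ht
  exact (sub_eq_zero.1 (hstep i (hτ0 i) t (Ioc_subset_Icc_self hi))).symm

end SLData

/-! ### Common refinements of time sequences -/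

/-- Every interval between consecutive times of `σ` lies in one between consecutive times
of `τ`. -/
def Refines (σ τ : ℕ → ℝ) : Prop := ∀ n, ∃ i, τ i ≤ σ n ∧ σ (n + 1) ≤ τ (i + 1)

lemma Refines.trans {σ τ ρ : ℕ → ℝ} (h : Refines σ τ) (h' : Refines τ ρ) : Refines σ ρ := by
  intro n
  obtain ⟨i, hi⟩ := h n
  obtain ⟨j, hj⟩ := h' i
  exact ⟨j, hj.1.trans hi.1, hi.2.trans hj.2⟩

lemma IsTimes.finite_range_inter_Iio {τ : ℕ → ℝ} (hτ : IsTimes τ) (b : ℝ) :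
    (range τ ∩ Iio b).Finite := by
  obtain ⟨N, hN⟩ := (hτ.2.2.eventually_ge_atTop b).exists
  refine ((finite_Iio N).image τ).subset ?_
  rintro _ ⟨⟨i, rfl⟩, hi⟩
  exact ⟨i, hτ.1.lt_iff_lt.1 (lt_of_lt_of_le hi hN), rfl⟩

/-- Two sequences of times have a common refinement. -/
lemma IsTimes.exists_common_refinement {τ τ' : ℕ → ℝ} (hτ : IsTimes τ) (hτ' : IsTimes τ') :
    ∃ σ, IsTimes σ ∧ Refines σ τ ∧ Refines σ τ' := by
  -- The point y is the first time after x in either sequence; iterating from 0 lists the union of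
  -- the two.
  have key : ∀ x : ℝ, 0 ≤ x → ∃ y, x < y ∧ y ∈ range τ ∪ range τ' ∧
      (∃ i, τ i ≤ x ∧ y ≤ τ (i + 1)) ∧ ∃ j, τ' j ≤ x ∧ y ≤ τ' (j + 1) := by
    intro x hx
    obtain ⟨i, hi⟩ := hτ.exists_mem_Ico hx
    obtain ⟨j, hj⟩ := hτ'.exists_mem_Ico hx
    refine ⟨min (τ (i + 1)) (τ' (j + 1)), lt_min hi.2 hj.2, ?_, ⟨i, hi.1, min_le_left _ _⟩,
      ⟨j, hj.1, min_le_right _ _⟩⟩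
    rcases min_choice (τ (i + 1)) (τ' (j + 1)) with h | h
    · exact Or.inl ⟨_, h.symm⟩
    · exact Or.inr ⟨_, h.symm⟩
  choose! next hlt hmem h₁ h₂ using key
  let σ : ℕ → ℝ := fun n => next^[n] 0
  have hsucc : ∀ n, σ (n + 1) = next (σ n) := fun n => Function.iterate_succ_apply' next n 0
  have hnn : ∀ n, 0 ≤ σ n := by
    intro n
    induction n with
    | zero => exact le_rfl
    | succ n ih => rw [hsucc]; exact ih.trans (hlt _ ih).le
  have hmono : StrictMono σ := strictMono_nat_of_lt_succ fun n => by
    rw [hsucc]; exact hlt _ (hnn n)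
  refine ⟨σ, ⟨hmono, rfl, ?_⟩, fun n => by rw [hsucc]; exact h₁ _ (hnn n),
    fun n => by rw [hsucc]; exact h₂ _ (hnn n)⟩
  refine tendsto_atTop_atTop_of_monotone hmono.monotone fun b => ?_
  -- A bounded σ would be an infinite set of times below b, but each sequence has finitely many
  -- there.
  by_contra! hb
  refine infinite_range_of_injective hmono.injective
    (((hτ.finite_range_inter_Iio b).union (hτ'.finite_range_inter_Iio b)).subset ?_)
  rintro _ ⟨n, rfl⟩
  rcases n with _ | n
  · exact Or.inl ⟨⟨0, hτ.2.1⟩, hb 0⟩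
  · have := hmem _ (hnn n)
    rw [← hsucc] at this
    exact this.imp (fun h => ⟨h, hb _⟩) fun h => ⟨h, hb _⟩

/-- Compactness of [0,1] makes joint continuity at the slice {t} × [0,1] uniform in x. -/
lemma tendstoUniformlyOn_left_of_continuousOn {F : ℝ → ℝ → ℝ} {s T t : ℝ}
    (hF : ContinuousOn (fun z : ℝ × ℝ => F z.1 z.2) (Ioo s T ×ˢ Icc 0 1)) (ht : t ∈ Ioo s T) :
    TendstoUniformlyOn F (F t) (𝓝[<] t) (Icc 0 1) := by
  intro U hU
  obtain ⟨V, hV, h⟩ := isCompact_Icc.mem_uniformity_of_prod hF ht (symm_le_uniformity hU)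
  rw [isOpen_Ioo.nhdsWithin_eq ht] at hV
  filter_upwards [mem_nhdsWithin_of_mem_nhds hV] with y hy x hx
  exact h y hy x hx

/-- If T' is interior to (s, T), the data are continuous at T' and the required limits are their
values there; if T' = T, the original limits are kept. -/
lemma SLData.GDOn.mono {A : SLData} {f : ℝ → ℝ → ℝ} {s T s' T' : ℝ} (hf : A.GDOn s T f)
    (hs : s ≤ s') (hlt : s' < T') (hT : T' ≤ T) : A.GDOn s' T' f := by
  obtain ⟨f₁, f₂, a, b, c, c₁, c₂, ha, hb, hc, hmem, hsum, ⟨M, hM⟩, hd, cd, la, lb, lc⟩ := hf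
  have hsub : Ioo s' T' ⊆ Ioo s T := Ioo_subset_Ioo hs hT
  have hsub₂ := prod_mono hsub (Subset.refl (Icc (0 : ℝ) 1))
  rcases eq_or_lt_of_le hT with rfl | hT
  · exact ⟨f₁, f₂, a, b, c, c₁.mono hsub₂, c₂.mono hsub₂, ha, hb, hc,
      fun t ht => hmem t (hsub ht), fun t ht => hsum t (hsub ht),
      ⟨M, fun t ht => hM t (hsub ht)⟩, fun t ht => hd t (hsub ht), cd.mono hsub₂, la, lb, lc⟩
  have hmemT : T' ∈ Ioo s T := ⟨hs.trans_lt hlt, hT⟩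
  have hlim : ∀ {F : ℝ → ℝ → ℝ},
      ContinuousOn (fun z : ℝ × ℝ => F z.1 z.2) (Ioo s T ×ˢ Icc 0 1) →
      ∀ x ∈ Icc (0 : ℝ) 1, Tendsto (fun t => F t x) (𝓝[<] T') (𝓝 (F T' x)) :=
    fun hF x hx => (tendstoUniformlyOn_left_of_continuousOn hF hmemT).tendsto_at hx
  exact ⟨f₁, f₂, f₁ T', fun x => deriv (fun s' => f₁ s' x) T', f₂ T', c₁.mono hsub₂,
    c₂.mono hsub₂, (hmem T' hmemT).1,
    SLData.continuousOn_slice (F := fun t x => deriv (fun s' => f₁ s' x) t) cd hmemT,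
    (hmem T' hmemT).2, fun t ht => hmem t (hsub ht), fun t ht => hsum t (hsub ht),
    ⟨M, fun t ht => hM t (hsub ht)⟩, fun t ht => hd t (hsub ht), cd.mono hsub₂, hlim c₁,
    tendstoUniformlyOn_left_of_continuousOn (F := fun t x => deriv (fun s' => f₁ s' x) t) cd hmemT,
    hlim c₂⟩

lemma SLData.GDAlong.of_refines {A : SLData} {f : ℝ → ℝ → ℝ} {σ τ : ℕ → ℝ}
    (hf : A.GDAlong τ f) (hσ : IsTimes σ) (h : Refines σ τ) : A.GDAlong σ f := by
  intro n
  obtain ⟨i, hi⟩ := h n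
  exact (hf i).mono hi.1 (hσ.lt_succ n) hi.2

/-- A new time is either an old one, where the limits are given, or interior to an old interval,
where d is C² and the limits exist by continuity. -/
lemma GBAlong.of_refines {d : ℝ → ℝ} {σ τ : ℕ → ℝ} (hd : GBAlong τ d) (hτ : IsTimes τ)
    (hσ : IsTimes σ) (h : Refines σ τ) : GBAlong σ d := by
  refine ⟨hd.1, hd.2.1.mono fun t ht => ?_, fun n hn => ?_, fun n => ?_⟩
  · obtain ⟨n, hn⟩ := hσ.exists_mem_Ioo ht
    obtain ⟨i, hi⟩ := h n
    exact hτ.Ioo_subset_offTimes i ⟨hi.1.trans_lt hn.1, hn.2.trans_le hi.2⟩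
  · obtain ⟨m, rfl⟩ : ∃ m, n = m + 1 := ⟨n - 1, by omega⟩
    obtain ⟨i, hi⟩ := h m
    rcases eq_or_lt_of_le hi.2 with heq | hlt
    · rw [heq]
      exact hd.2.2.1 (i + 1) (by omega)
    · have hmem : σ (m + 1) ∈ Ioo (τ i) (τ (i + 1)) := ⟨hi.1.trans_lt (hσ.lt_succ m), hlt⟩
      have h0 := (hd.bdryOn hτ i).contDiff
      have h1 : ContDiffOn ℝ 1 (deriv d) (Ioo (τ i) (τ (i + 1))) :=
        h0.deriv_of_isOpen isOpen_Ioo (by norm_num)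
      have h2 := h1.continuousOn_deriv_of_isOpen isOpen_Ioo le_rfl
      have hlim : ∀ {g : ℝ → ℝ}, ContinuousOn g (Ioo (τ i) (τ (i + 1))) →
          ∃ L, Tendsto g (𝓝[<] (σ (m + 1))) (𝓝 L) := fun hg =>
        ⟨_, (hg.continuousAt (Ioo_mem_nhds hmem.1 hmem.2)).tendsto.mono_left nhdsWithin_le_nhds⟩
      exact ⟨hlim h0.continuousOn, hlim h1.continuousOn, hlim h2⟩
  · obtain ⟨i, hi⟩ := h n
    obtain ⟨M, hM⟩ := hd.2.2.2 i
    exact ⟨M, fun t ht => hM t ⟨hi.1.trans_lt ht.1, ht.2.trans_le hi.2⟩⟩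

/-- There is a sequence of times that serves for `f`, `d₀` and `d₁` simultaneously. -/
theorem SLData.exists_admissible {A : SLData} {f : ℝ → ℝ → ℝ} {d₀ d₁ : ℝ → ℝ} (hf : A.GD f)
    (hd₀ : GB d₀) (hd₁ : GB d₁) : ∃ τ, A.Admissible τ f d₀ d₁ := by
  obtain ⟨τ, hτ, hf⟩ := hf
  obtain ⟨τ₀, hτ₀, hd₀⟩ := hd₀
  obtain ⟨τ₁, hτ₁, hd₁⟩ := hd₁
  obtain ⟨ρ, hρ, hρ₀, hρ₁⟩ := hτ₀.exists_common_refinement hτ₁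
  obtain ⟨σ, hσ, hστ, hσρ⟩ := hτ.exists_common_refinement hρ
  exact ⟨σ, hσ, hf.of_refines hσ hστ, hd₀.of_refines hτ₀ hσ (hσρ.trans hρ₀),
    hd₁.of_refines hτ₁ hσ (hσρ.trans hρ₁)⟩

end SLParabolic

end

theorem theorem2p2 (A : SLParabolic.SLData) (hH : A.AssumptionH)
    (f : ℝ → ℝ → ℝ) (d₀ d₁ : ℝ → ℝ) (hf : A.GD f) (hd₀ : SLParabolic.GB d₀) (hd₁ : SLParabolic.GB d₁) :
    (∃ τ : ℕ → ℝ, A.Admissible τ f d₀ d₁) ∧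
    ∀ τ : ℕ → ℝ, A.Admissible τ f d₀ d₁ →
      ∀ u₀ : ℝ → ℝ, MemLp u₀ 2 A.wt →
        ∃ u : ℝ → ℝ → ℝ, A.IsSolution τ f d₀ d₁ u₀ u ∧
          ∀ v : ℝ → ℝ → ℝ, A.IsSolution τ f d₀ d₁ u₀ v →
            ∀ t, 0 ≤ t → ∀ x ∈ Icc (0 : ℝ) 1, v t x = u t x := by
  obtain ⟨S⟩ := SLParabolic.SLData.nonempty_spectral hH
  refine ⟨SLParabolic.SLData.exists_admissible hf hd₀ hd₁, fun τ hτ u₀ hu₀ => ?_⟩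
  obtain ⟨u, hu⟩ := S.exists_isSolution hτ hu₀
  exact ⟨u, hu, fun v hv t ht => hu.eqOn S hτ.1 hv ht⟩
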